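/- Let $k$ be an algebraically closed field containing $\mathbb{R}$, let $F=k((z))$, $\mathfrak{o}=k[[z]]$, $\tau=z\frac{d}{dz}$, and let $V$ be a nonzero finite-dimensional $k$-vector space; write $\hat W=F\otimes_k W$ for a $k$-vector space $W$. A flat $\mathrm{GL}(V)$-bundle $(\mathcal{G},\nabla)$ on $\operatorname{Spec}F$ is a principal $\mathrm{GL}(V)$-bundle $\mathcal{G}$ whose trivializations $\phi$ form a torsor under $\mathrm{GL}(\hat V)$, together with a matrix $[\nabla]_\phi\in\mathfrak{gl}(\hat V)\frac{dz}{z}$ for each $\phi$ such that $[\nabla]_{g\phi}=g[\nabla]_\phi g^{-1}-(dg)g^{-1}$. For an algebraic representation $(W,\rho)$ of $\mathrm{GL}(V)$, the associated flat vector bundle $(W_{\mathcal{G}},\nabla_W)$ is, in the trivialization $\phi$, $(\hat W,\,d+\rho([\nabla]_\phi))$. A flat vector bundle $(U,\nabla)$ over $F$ is regular singular if some $\mathfrak{o}$-lattice $L\subset U$ satisfies $\nabla(L)\subset L\frac{dz}{z}$; then its slope is $0$. Otherwise its slope is the positive rational number $r$ such that, writing $\nabla_\tau$ for the contraction of $\nabla$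 with $\tau$, the set $\{v(\nabla_\tau^i\mathbf{e})+ri : i>0\}$ is bounded, for $\mathbf{e}$ a basis of $U$ and $v(\mathbf{e}')$ the greatest $m$ with $\mathbf{e}'\subset z^mL$, $L$ a lattice. The bundle $(\mathcal{G},\nabla)$ is regular singular if $(W_{\mathcal{G}},\nabla_W)$ is regular singular for every finite-dimensional algebraic representation $W$ of $\mathrm{GL}(V)$. Let $\mathcal{B}$ be the enlarged Bruhat–Tits building of $\mathrm{GL}(V)$ over $F$. A point $x\in\mathcal{B}$ has Moy–Prasad filtrations $\{\hat W_{x,r}\}_{r\in\mathbb{R}}$ on $\hat W$ for all finite-dimensional representations $W$, and $\{\mathfrak{gl}(\hat V)_{x,r}\}$ on $\mathfrak{gl}(\hat V)$; a subscript $r+$ denotes the union over all indices $>r$. A stratum of depth $r\ge 0$ is a triple $(x,r,\beta)$ with $\beta$ a $k$-linear functional on $\mathfrak{gl}(\hat V)_{x,r}/\mathfrak{gl}(\hat V)_{x,r+}$. It is fundamental if $\beta$ is a semistable point for the coadjoint action of the parahoric subgroup at $x$, i.e. $0$ is not in the Zariski closure of its orbit. It is contained in $(\mathcal{G},\nabla)$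 if, for some trivialization $\phi$ and some $X\in\mathfrak{gl}(\hat V)_{x,-r}$ with $\beta(Y)=\operatorname{Res}\operatorname{Tr}(XY)\frac{dz}{z}$ for all $Y\in\mathfrak{gl}(\hat V)_{x,r}$, one has $$\Bigl(d+\rho([\nabla]_\phi)-i\tfrac{dz}{z}-\rho(X)\tfrac{dz}{z}\Bigr)\hat W_{x,i}\subset \hat W_{x,(i-r)+}\tfrac{dz}{z}$$ for all $i\in\mathbb{R}$ and all finite-dimensional algebraic representations $(W,\rho)$ of $\mathrm{GL}(V)$. The slope of $(\mathcal{G},\nabla)$ is the depth of any fundamental stratum contained in it. **Corollary.** For every flat $\mathrm{GL}(V)$-bundle $(\mathcal{G},\nabla)$, both the slope of $(\mathcal{G},\nabla)$ and the slope of the flat vector bundle $(V_{\mathcal{G}},\nabla_V)$ associated to the standard representation $V$ are well defined (each exists and is unique), and they are equal. In particular, $(\mathcal{G},\nabla)$ is regular singular if and only if $(V_{\mathcal{G}},\nabla_V)$ is regular singular. -/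

import Mathlib

open scoped TensorProduct PowerSeries
universe u

noncomputable section

/-- The field `F = k((z))` of formal Laurent series. (A type synonym of Mathlib's `LaurentSeries k`
which carries the `k`-algebra structure and the `k⟦z⟧`-algebra structure.) -/
def LF (k : Type u) [Field k] : Type u := LaurentSeries k

namespace LF

variable {k : Type u} [Field k]

/-- `z * df/dz` for a Laurent series. -/
def eulerDeriv (f : LaurentSeries k) : LaurentSeries k :=
  HahnSeries.single 1 1 * LaurentSeries.derivative k f

theorem eulerDeriv_coeff (f : LaurentSeries k) (n : ℤ) :
    (eulerDeriv f).coeff n = (n : k) * f.coeff n := by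
  have := HahnSeries.coeff_single_mul_add (Γ := ℤ) (r := (1 : k))
    (x := LaurentSeries.derivative k f) (a := n - 1) (b := 1)
  rw [sub_add_cancel, one_mul] at this
  rw [eulerDeriv, this, LaurentSeries.derivative_apply, LaurentSeries.hasseDeriv_coeff]
  simp

theorem eulerDeriv_mul (f g : LaurentSeries k) :
    eulerDeriv (f * g) = eulerDeriv f * g + f * eulerDeriv g := by
  ext n
  have hs : ∀ h : LaurentSeries k, (eulerDeriv h).support ⊆ h.support := by
    intro h m hm h0
    apply hm
    rw [eulerDeriv_coeff, h0, mul_zero]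
  rw [HahnSeries.coeff_add, HahnSeries.coeff_mul_left' f.isPWO_support (hs f),
    HahnSeries.coeff_mul_right' g.isPWO_support (hs g), eulerDeriv_coeff, HahnSeries.coeff_mul,
    Finset.mul_sum, ← Finset.sum_add_distrib]
  refine Finset.sum_congr rfl fun ij hij => ?_
  have hn : ij.1 + ij.2 = n := (Finset.mem_antidiagonal.1 hij).2.2
  rw [eulerDeriv_coeff, eulerDeriv_coeff, ← hn]
  push_cast
  ring

instance instField : Field (LF k) := inferInstanceAs (Field (LaurentSeries k))

instance instAlgebraConst : Algebra k (LF k) where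
  smul c f := let f' : LaurentSeries k := f; (c • f' : LaurentSeries k)
  algebraMap := (HahnSeries.C : k →+* LaurentSeries k)
  commutes' _ _ := mul_comm (G := LaurentSeries k) _ _
  smul_def' c f := (HahnSeries.C_mul_eq_smul (Γ := ℤ) (r := c) (x := f)).symm

instance instAlgebraInt : Algebra k⟦X⟧ (LF k) :=
  inferInstanceAs (Algebra k⟦X⟧ (LaurentSeries k))

/-- The coefficient of `z ^ n`. -/
def coeff (f : LF k) (n : ℤ) : k := HahnSeries.coeff f n

/-- The monomial `z ^ n`. -/
def zpow (n : ℤ) : LF k := (HahnSeries.single n (1 : k) : LaurentSeries k)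

/-- The derivation `τ = z d/dz` of `F`. -/
def tau : LF k →ₗ[k] LF k where
  toFun f := eulerDeriv f
  map_add' f g := HahnSeries.ext (funext fun n => by
    have h : ∀ a b : LaurentSeries k,
        (eulerDeriv (a + b)).coeff n = (eulerDeriv a + eulerDeriv b).coeff n := fun a b => by
      rw [HahnSeries.coeff_add]; simp only [eulerDeriv_coeff, HahnSeries.coeff_add, mul_add]
    exact h f g)
  map_smul' c f := HahnSeries.ext (funext fun n => by
    have h : ∀ a : LaurentSeries k,
        (eulerDeriv (c • a)).coeff n = (c • eulerDeriv a).coeff n := fun a => by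
      rw [HahnSeries.coeff_smul]
      simp only [eulerDeriv_coeff, HahnSeries.coeff_smul, smul_eq_mul]; ring
    exact h f)

theorem tau_mul (f g : LF k) : tau (f * g) = tau f * g + f * tau g := eulerDeriv_mul f g

theorem tau_coeff (f : LF k) (n : ℤ) : (tau f).coeff n = (n : k) * f.coeff n :=
  eulerDeriv_coeff f n

end LF

/-! ### Algebraic representations of `GL(V)` -/

/-- The map `R ⊗ V → S ⊗ V` induced by a `k`-linear map `R → S`. -/
abbrev bc {k : Type u} [Field k] {R S : Type u} [CommRing R] [Algebra k R] [CommRing S]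
    [Algebra k S] (V : Type u) [AddCommGroup V] [Module k V] (f : R →ₗ[k] S) :
    R ⊗[k] V →ₗ[k] S ⊗[k] V :=
  f.rTensor V

/-- An algebraic representation of the algebraic group `GL(V)` over `k` on the vector space `W`:
a homomorphism of group functors `GL(V) → GL(W)`, i.e. a family of group homomorphisms
`GL(R ⊗ V) → GL(R ⊗ W)`, for commutative `k`-algebras `R`, which is natural in `R`. (An
automorphism `h` of `S ⊗ V` is the base change of `g` along `f : R → S` iff `h ∘ f = f ∘ g`.) -/
structure AlgRep (k V W : Type u) [Field k] [AddCommGroup V] [Module k V] [AddCommGroup W]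
    [Module k W] where
  /-- the action of the `R`-points -/
  act : ∀ (R : Type u) [CommRing R] [Algebra k R],
    LinearMap.GeneralLinearGroup R (R ⊗[k] V) →* LinearMap.GeneralLinearGroup R (R ⊗[k] W)
  natural : ∀ (R S : Type u) [CommRing R] [Algebra k R] [CommRing S] [Algebra k S]
    (f : R →ₐ[k] S) (g : LinearMap.GeneralLinearGroup R (R ⊗[k] V))
    (h : LinearMap.GeneralLinearGroup S (S ⊗[k] V)),
    (∀ v, h.1 (bc V f.toLinearMap v) = bc V f.toLinearMap (g.1 v)) →
    ∀ w, (act S h).1 (bc W f.toLinearMap w) = bc W f.toLinearMap ((act R g).1 w)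

/-- The standard representation of `GL(V)` on `V`. -/
def AlgRep.std (k V : Type u) [Field k] [AddCommGroup V] [Module k V] : AlgRep k V V where
  act _ _ _ := MonoidHom.id _
  natural _ _ _ _ _ _ _ _ _ hgh := hgh

namespace AlgRep

section differential

variable {k V W : Type u} [Field k] [AddCommGroup V] [Module k V] [AddCommGroup W] [Module k W]
variable (R : Type u) [CommRing R] [Algebra k R]

/-- `r ↦ r`, as a `k`-linear map `R → R[ε]`. -/
def inl : R →ₗ[k] DualNumber R := (TrivSqZeroExt.inlAlgHom k R R).toLinearMap

/-- `r ↦ r ε`, as a `k`-linear map `R → R[ε]`. -/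
def inr : R →ₗ[k] DualNumber R := (TrivSqZeroExt.inrHom R R).restrictScalars k

/-- `r + s ε ↦ r`, as a `k`-algebra homomorphism `R[ε] → R`. -/
def fst : DualNumber R →ₐ[k] R := TrivSqZeroExt.fstHom k R R

/-- `r + s ε ↦ s`, as a `k`-linear map `R[ε] → R`. -/
def snd : DualNumber R →ₗ[k] R := (TrivSqZeroExt.sndHom R R).restrictScalars k

variable {R}

/-- The endomorphism `ε X` of `R[ε] ⊗ V`, for an endomorphism `X` of `R ⊗ V`. -/
def epsEnd (X : Module.End R (R ⊗[k] V)) : Module.End (DualNumber R) (DualNumber R ⊗[k] V) :=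
  LinearMap.liftBaseChange (DualNumber R)
    (bc V (inr R) ∘ₗ X.restrictScalars k ∘ₗ TensorProduct.mk k R V 1)

theorem bc_inr_smul (r : R) (x : R ⊗[k] V) :
    bc V (inr R) (r • x) = (TrivSqZeroExt.inl r : DualNumber R) • bc V (inr R) x := by
  induction x with
  | zero => simp
  | add x y hx hy => rw [smul_add, map_add, map_add, smul_add, hx, hy]
  | tmul s v =>
    have h : inr R (k := k) (r • s) = (TrivSqZeroExt.inl r : DualNumber R) • inr R (k := k) s := by
      ext <;> simp [inr, mul_comm]
    rw [TensorProduct.smul_tmul']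
    simp only [bc, LinearMap.rTensor_tmul]
    rw [h, TensorProduct.smul_tmul']

theorem inr_smul_bc_inr (r : R) (x : R ⊗[k] V) :
    (TrivSqZeroExt.inr r : DualNumber R) • bc V (inr R) x = 0 := by
  induction x with
  | zero => simp
  | add x y hx hy => rw [map_add, smul_add, hx, hy, add_zero]
  | tmul s v =>
    simp [bc, inr, TensorProduct.smul_tmul']

theorem epsEnd_inl (X : Module.End R (R ⊗[k] V)) (x : R ⊗[k] V) :
    epsEnd X (bc V (inl R) x) = bc V (inr R) (X x) := by
  induction x with
  | zero => simp
  | add x y hx hy => rw [map_add, map_add, map_add, map_add, hx, hy]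
  | tmul s v =>
    have h : X (s ⊗ₜ v) = s • X (1 ⊗ₜ v) := by
      rw [← map_smul, TensorProduct.smul_tmul', smul_eq_mul, mul_one]
    rw [h, bc_inr_smul]
    rfl

theorem epsEnd_inr (X : Module.End R (R ⊗[k] V)) (x : R ⊗[k] V) :
    epsEnd X (bc V (inr R) x) = 0 := by
  induction x with
  | zero => simp
  | add x y hx hy => rw [map_add, map_add, hx, hy, add_zero]
  | tmul s v => exact inr_smul_bc_inr s (X (1 ⊗ₜ v))

/-- Two `R[ε]`-linear endomorphisms agree if they agree on `R ⊗ V`. -/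
theorem end_ext {A B : Module.End (DualNumber R) (DualNumber R ⊗[k] V)}
    (h : ∀ x : R ⊗[k] V, A (bc V (inl R) x) = B (bc V (inl R) x)) : A = B := by
  apply LinearMap.ext
  intro y
  induction y with
  | zero => simp
  | add x y hx hy => rw [map_add, map_add, hx, hy]
  | tmul s v =>
    have h1 : (s ⊗ₜ[k] v : DualNumber R ⊗[k] V) = s • bc V (inl R) (1 ⊗ₜ v) := by
      simp [bc, inl, TensorProduct.smul_tmul']
    rw [h1, map_smul, map_smul, h]

theorem epsEnd_mul (X Y : Module.End R (R ⊗[k] V)) : epsEnd X * epsEnd Y = 0 :=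
  end_ext fun x => by
    rw [Module.End.mul_apply, epsEnd_inl, epsEnd_inr, LinearMap.zero_apply]

theorem epsEnd_add (X Y : Module.End R (R ⊗[k] V)) : epsEnd (X + Y) = epsEnd X + epsEnd Y :=
  end_ext fun x => by
    rw [LinearMap.add_apply, epsEnd_inl, epsEnd_inl, epsEnd_inl, LinearMap.add_apply, map_add]

theorem epsEnd_zero : epsEnd (0 : Module.End R (R ⊗[k] V)) = 0 :=
  end_ext fun x => by
    rw [LinearMap.zero_apply, epsEnd_inl, LinearMap.zero_apply, map_zero]

theorem one_add_epsEnd_mul (X Y : Module.End R (R ⊗[k] V)) :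
    (1 + epsEnd X) * (1 + epsEnd Y) = 1 + epsEnd (X + Y) := by
  rw [add_mul, mul_add, mul_add, epsEnd_mul, epsEnd_add, one_mul, mul_one, one_mul]
  abel

/-- The element `1 + ε X` of `GL(R[ε] ⊗ V)`. -/
def oneAddEps (X : Module.End R (R ⊗[k] V)) :
    LinearMap.GeneralLinearGroup (DualNumber R) (DualNumber R ⊗[k] V) where
  val := 1 + epsEnd X
  inv := 1 + epsEnd (-X)
  val_inv := by rw [one_add_epsEnd_mul, show X + -X = 0 from add_neg_cancel X, epsEnd_zero, add_zero]
  inv_val := by rw [one_add_epsEnd_mul, show -X + X = 0 from neg_add_cancel X, epsEnd_zero, add_zero]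

theorem oneAddEps_add (X Y : Module.End R (R ⊗[k] V)) :
    oneAddEps (X + Y) = oneAddEps X * oneAddEps Y :=
  Units.ext (one_add_epsEnd_mul X Y).symm

theorem oneAddEps_inl (X : Module.End R (R ⊗[k] V)) (x : R ⊗[k] V) :
    (oneAddEps X).1 (bc V (inl R) x) = bc V (inl R) x + bc V (inr R) (X x) := by
  show (1 + epsEnd X) _ = _
  rw [LinearMap.add_apply, epsEnd_inl]; rfl

/-- The differential `dρ : gl(R ⊗ V) → gl(R ⊗ W)` of a representation, characterized by
`ρ(1 + ε X) = 1 + ε dρ(X)`. -/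
def diff (ρ : AlgRep k V W) (X : Module.End R (R ⊗[k] V)) : Module.End R (R ⊗[k] W) :=
  LinearMap.liftBaseChange R
    (bc W (snd R) ∘ₗ ((ρ.act (DualNumber R) (oneAddEps X)).1).restrictScalars k ∘ₗ
      TensorProduct.mk k (DualNumber R) W 1)

theorem bc_inl_smul (r : R) (x : R ⊗[k] V) :
    bc V (inl R) (r • x) = (TrivSqZeroExt.inl r : DualNumber R) • bc V (inl R) x := by
  induction x with
  | zero => simp
  | add x y hx hy => rw [smul_add, map_add, map_add, smul_add, hx, hy]
  | tmul s v => simp [bc, inl, TensorProduct.smul_tmul']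

theorem bc_snd_smul (r : R) (x : DualNumber R ⊗[k] V) :
    bc V (snd R) ((TrivSqZeroExt.inl r : DualNumber R) • x) = r • bc V (snd R) x := by
  induction x with
  | zero => simp
  | add x y hx hy => rw [smul_add, map_add, map_add, smul_add, hx, hy]
  | tmul s v => simp [bc, snd, TensorProduct.smul_tmul']

theorem decomp (x : DualNumber R ⊗[k] V) :
    x = bc V (inl R) (bc V (fst R).toLinearMap x) + bc V (inr R) (bc V (snd R) x) := by
  induction x with
  | zero => simp
  | add x y hx hy =>
    conv_lhs => rw [hx, hy]
    simp only [map_add]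
    abel
  | tmul s v =>
    simp only [bc, inl, inr, fst, snd, LinearMap.rTensor_tmul]
    rw [← TensorProduct.add_tmul]
    congr 1
    exact (TrivSqZeroExt.inl_fst_add_inr_snd_eq s).symm

theorem bc_fst_inl (x : R ⊗[k] V) : bc V (fst R).toLinearMap (bc V (inl R) x) = x := by
  induction x with
  | zero => simp
  | add x y hx hy => rw [map_add, map_add, hx, hy]
  | tmul s v => simp [bc, inl, fst]

theorem bc_fst_inr (x : R ⊗[k] V) : bc V (fst R).toLinearMap (bc V (inr R) x) = 0 := by
  induction x with
  | zero => simp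
  | add x y hx hy => rw [map_add, map_add, hx, hy, add_zero]
  | tmul s v => simp [bc, inr, fst]

theorem bc_snd_inl (x : R ⊗[k] V) : bc V (snd R) (bc V (inl R) x) = 0 := by
  induction x with
  | zero => simp
  | add x y hx hy => rw [map_add, map_add, hx, hy, add_zero]
  | tmul s v => simp [bc, inl, snd]

theorem bc_snd_inr (x : R ⊗[k] V) : bc V (snd R) (bc V (inr R) x) = x := by
  induction x with
  | zero => simp
  | add x y hx hy => rw [map_add, map_add, hx, hy]
  | tmul s v => simp [bc, inr, snd]

theorem oneAddEps_inr (X : Module.End R (R ⊗[k] V)) (x : R ⊗[k] V) :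
    (oneAddEps X).1 (bc V (inr R) x) = bc V (inr R) x := by
  show (1 + epsEnd X) _ = _
  rw [LinearMap.add_apply, epsEnd_inr, add_zero]; rfl

theorem bc_snd_act (ρ : AlgRep k V W) (X : Module.End R (R ⊗[k] V)) (w : R ⊗[k] W) :
    bc W (snd R) ((ρ.act (DualNumber R) (oneAddEps X)).1 (bc W (inl R) w)) = diff ρ X w := by
  induction w with
  | zero => simp
  | add x y hx hy => rw [map_add, map_add, map_add, map_add, hx, hy]
  | tmul s v =>
    have h : (s ⊗ₜ[k] v : R ⊗[k] W) = s • (1 ⊗ₜ v) := by simp [TensorProduct.smul_tmul']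
    rw [h, bc_inl_smul, map_smul, bc_snd_smul, map_smul]
    congr 1
    rw [diff, LinearMap.liftBaseChange_tmul, one_smul]
    rfl

theorem act_oneAddEps (ρ : AlgRep k V W) (X : Module.End R (R ⊗[k] V)) :
    ρ.act (DualNumber R) (oneAddEps X) = oneAddEps (diff ρ X) := by
  apply Units.ext
  apply end_ext
  intro w
  rw [oneAddEps_inl, ← bc_snd_act]
  have h1 : bc W (fst R).toLinearMap
      ((ρ.act (DualNumber R) (oneAddEps X)).1 (bc W (inl R) w)) = w := by
    rw [← ρ.natural (DualNumber R) R (fst R) (oneAddEps X) 1, map_one, bc_fst_inl]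
    · rfl
    · intro v
      conv_rhs => rw [decomp v, map_add, oneAddEps_inl, oneAddEps_inr]
      simp only [map_add, bc_fst_inl, bc_fst_inr, add_zero]
      rfl
  conv_lhs => rw [decomp ((ρ.act (DualNumber R) (oneAddEps X)).1 (bc W (inl R) w)), h1]

theorem oneAddEps_injective {X Y : Module.End R (R ⊗[k] V)} (h : oneAddEps X = oneAddEps Y) :
    X = Y := by
  apply LinearMap.ext
  intro x
  have h1 := congrArg (fun g => bc V (snd R) (g.1 (bc V (inl R) x))) h
  simpa only [oneAddEps_inl, map_add, bc_snd_inl, bc_snd_inr, zero_add] using h1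

theorem diff_add (ρ : AlgRep k V W) (X Y : Module.End R (R ⊗[k] V)) :
    diff ρ (X + Y) = diff ρ X + diff ρ Y := by
  apply oneAddEps_injective
  rw [← act_oneAddEps, oneAddEps_add, map_mul, act_oneAddEps, act_oneAddEps, oneAddEps_add]

end differential

end AlgRep

namespace AlgRep

section basechange

variable {k V W : Type u} [Field k] [AddCommGroup V] [Module k V] [AddCommGroup W] [Module k W]
variable {R S : Type u} [CommRing R] [Algebra k R] [CommRing S] [Algebra k S]

theorem bc_algHom_smul (f : R →ₐ[k] S) (r : R) (x : R ⊗[k] V) :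
    bc V f.toLinearMap (r • x) = f r • bc V f.toLinearMap x := by
  induction x with
  | zero => simp
  | add x y hx hy => rw [smul_add, map_add, map_add, smul_add, hx, hy]
  | tmul s v => simp [bc, TensorProduct.smul_tmul']

/-- The base change of an endomorphism along `f : R → S`. -/
def bcEnd (f : R →ₐ[k] S) (g : Module.End R (R ⊗[k] V)) : Module.End S (S ⊗[k] V) :=
  LinearMap.liftBaseChange S
    (bc V f.toLinearMap ∘ₗ g.restrictScalars k ∘ₗ TensorProduct.mk k R V 1)

theorem bcEnd_bc (f : R →ₐ[k] S) (g : Module.End R (R ⊗[k] V)) (x : R ⊗[k] V) :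
    bcEnd f g (bc V f.toLinearMap x) = bc V f.toLinearMap (g x) := by
  induction x with
  | zero => simp
  | add x y hx hy => rw [map_add, map_add, map_add, map_add, hx, hy]
  | tmul s v =>
    have h : (s ⊗ₜ[k] v : R ⊗[k] V) = s • (1 ⊗ₜ v) := by simp [TensorProduct.smul_tmul']
    rw [h, bc_algHom_smul, map_smul, map_smul g, bc_algHom_smul]
    congr 1
    rw [bc, LinearMap.rTensor_tmul, AlgHom.toLinearMap_apply, map_one, bcEnd,
      LinearMap.liftBaseChange_tmul, one_smul]
    rfl

theorem bcEnd_ext (f : R →ₐ[k] S) {A B : Module.End S (S ⊗[k] V)}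
    (h : ∀ x : R ⊗[k] V, A (bc V f.toLinearMap x) = B (bc V f.toLinearMap x)) : A = B := by
  apply LinearMap.ext
  intro y
  induction y with
  | zero => simp
  | add x y hx hy => rw [map_add, map_add, hx, hy]
  | tmul s v =>
    have h1 : (s ⊗ₜ[k] v : S ⊗[k] V) = s • bc V f.toLinearMap (1 ⊗ₜ v) := by
      simp [bc, TensorProduct.smul_tmul']
    rw [h1, map_smul, map_smul, h]

/-- The base change of an automorphism along `f : R → S`. -/
def bcGL (f : R →ₐ[k] S) (g : LinearMap.GeneralLinearGroup R (R ⊗[k] V)) :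
    LinearMap.GeneralLinearGroup S (S ⊗[k] V) where
  val := bcEnd f g.1
  inv := bcEnd f g⁻¹.1
  val_inv := bcEnd_ext f fun x => by
    rw [Module.End.mul_apply, bcEnd_bc, bcEnd_bc, ← Module.End.mul_apply, Units.mul_inv]; rfl
  inv_val := bcEnd_ext f fun x => by
    rw [Module.End.mul_apply, bcEnd_bc, bcEnd_bc, ← Module.End.mul_apply, Units.inv_mul]; rfl

theorem bcGL_bc (f : R →ₐ[k] S) (g : LinearMap.GeneralLinearGroup R (R ⊗[k] V)) (x : R ⊗[k] V) :
    (bcGL f g).1 (bc V f.toLinearMap x) = bc V f.toLinearMap (g.1 x) :=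
  bcEnd_bc f g.1 x

theorem act_bcGL (ρ : AlgRep k V W) (f : R →ₐ[k] S)
    (g : LinearMap.GeneralLinearGroup R (R ⊗[k] V)) :
    ρ.act S (bcGL f g) = bcGL f (ρ.act R g) := by
  apply Units.ext
  apply bcEnd_ext f
  intro w
  rw [ρ.natural R S f g (bcGL f g) (bcGL_bc f g), bcGL_bc]

/-- The inclusion `R → R[ε]`. -/
abbrev inlA (k R : Type u) [Field k] [CommRing R] [Algebra k R] : R →ₐ[k] DualNumber R :=
  TrivSqZeroExt.inlAlgHom k R R

theorem bc_inr_eq (x : R ⊗[k] V) :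
    bc V (inr R) x = (TrivSqZeroExt.inr 1 : DualNumber R) • bc V (inl R) x := by
  induction x with
  | zero => simp
  | add x y hx hy => rw [map_add, map_add, smul_add, hx, hy]
  | tmul s v =>
    have h : inr R (k := k) s = (TrivSqZeroExt.inr 1 : DualNumber R) • inl R (k := k) s := by
      ext <;> simp [inr, inl]
    simp only [bc, LinearMap.rTensor_tmul]
    rw [h, TensorProduct.smul_tmul']

theorem bcGL_inl (g : LinearMap.GeneralLinearGroup R (R ⊗[k] V)) (x : R ⊗[k] V) :
    (bcGL (inlA k R) g).1 (bc V (inl R) x) = bc V (inl R) (g.1 x) :=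
  bcGL_bc (inlA k R) g x

theorem bcGL_inr (g : LinearMap.GeneralLinearGroup R (R ⊗[k] V)) (x : R ⊗[k] V) :
    (bcGL (inlA k R) g).1 (bc V (inr R) x) = bc V (inr R) (g.1 x) := by
  rw [bc_inr_eq, map_smul, bcGL_inl, bc_inr_eq]

theorem oneAddEps_conj (g : LinearMap.GeneralLinearGroup R (R ⊗[k] V))
    (X : Module.End R (R ⊗[k] V)) :
    oneAddEps (g.1 * X * g⁻¹.1) * bcGL (inlA k R) g = bcGL (inlA k R) g * oneAddEps X := by
  apply Units.ext
  apply end_ext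
  intro x
  show (oneAddEps _).1 ((bcGL (inlA k R) g).1 _) = (bcGL (inlA k R) g).1 ((oneAddEps X).1 _)
  rw [bcGL_inl, oneAddEps_inl, oneAddEps_inl, map_add, bcGL_inl, bcGL_inr]
  have h : (g.1 * X * g⁻¹.1) (g.1 x) = g.1 (X x) := by
    show (g.1 * X) ((g⁻¹.1 * g.1) x) = _
    rw [Units.inv_mul]; rfl
  rw [h]

theorem diff_conj (ρ : AlgRep k V W) (g : LinearMap.GeneralLinearGroup R (R ⊗[k] V))
    (X : Module.End R (R ⊗[k] V)) :
    diff ρ (g.1 * X * g⁻¹.1) = (ρ.act R g).1 * diff ρ X * (ρ.act R g)⁻¹.1 := by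
  apply oneAddEps_injective
  have h := congrArg (ρ.act (DualNumber R)) (oneAddEps_conj g X)
  rw [map_mul, map_mul, act_oneAddEps, act_oneAddEps, act_bcGL, ← oneAddEps_conj] at h
  exact mul_right_cancel h

end basechange

end AlgRep

/-! ### Gauge transformations -/

section gauge

variable {k V W : Type u} [Field k] [AddCommGroup V] [Module k V] [AddCommGroup W] [Module k W]

/-- The operator `τ ⊗ 1` on `F ⊗ V`. -/
def tauHat (V : Type u) [AddCommGroup V] [Module k V] : LF k ⊗[k] V →ₗ[k] LF k ⊗[k] V :=
  bc V LF.tau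

theorem tauHat_smul (f : LF k) (x : LF k ⊗[k] V) :
    tauHat V (f • x) = LF.tau f • x + f • tauHat V x := by
  induction x with
  | zero => simp
  | add x y hx hy => rw [smul_add, map_add, map_add, smul_add, hx, hy, smul_add]; abel
  | tmul s v =>
    simp only [tauHat, bc, TensorProduct.smul_tmul', LinearMap.rTensor_tmul, smul_eq_mul,
      LF.tau_mul, TensorProduct.add_tmul]

/-- The matrix `τ(g)` obtained by applying `τ` to the entries of `g`; it is the commutator of the
operators `τ ⊗ 1` and `g` on `F ⊗ V`. -/
def tauEnd (g : Module.End (LF k) (LF k ⊗[k] V)) : Module.End (LF k) (LF k ⊗[k] V) where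
  toFun x := tauHat V (g x) - g (tauHat V x)
  map_add' x y := by simp only [map_add]; abel
  map_smul' f x := by
    simp only [map_smul, tauHat_smul, map_add, RingHom.id_apply, smul_sub]; abel

/-- The Maurer–Cartan form `(dg) g⁻¹`, contracted with `τ`: the matrix `τ(g) g⁻¹`. -/
def maurerCartan (g : LinearMap.GeneralLinearGroup (LF k) (LF k ⊗[k] V)) :
    Module.End (LF k) (LF k ⊗[k] V) :=
  tauEnd g.1 * g⁻¹.1

theorem maurerCartan_apply (g : LinearMap.GeneralLinearGroup (LF k) (LF k ⊗[k] V))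
    (x : LF k ⊗[k] V) : maurerCartan g (g.1 x) = tauHat V (g.1 x) - g.1 (tauHat V x) := by
  have h : g⁻¹.1 (g.1 x) = x := by
    show (g⁻¹.1 * g.1) x = x
    rw [Units.inv_mul]; rfl
  show tauEnd g.1 (g⁻¹.1 (g.1 x)) = _
  rw [h]; rfl

/-- The `k`-algebra homomorphism `F → F[ε]`, `f ↦ f + τ(f) ε`. -/
def tauAlgHom (k : Type u) [Field k] : LF k →ₐ[k] DualNumber (LF k) :=
  AlgHom.ofLinearMap (AlgRep.inl (LF k) + AlgRep.inr (LF k) ∘ₗ LF.tau)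
    (by
      have h : LF.tau (1 : LF k) = 0 := by
        have := LF.tau_mul (1 : LF k) 1
        simpa using this
      simp [AlgRep.inl, h])
    (by
      intro f g
      ext <;> simp [AlgRep.inl, AlgRep.inr, LF.tau_mul, mul_comm, add_comm])

theorem bc_tauAlgHom (x : LF k ⊗[k] V) :
    bc V (tauAlgHom k).toLinearMap x
      = bc V (AlgRep.inl (LF k)) x + bc V (AlgRep.inr (LF k)) (tauHat V x) := by
  have h : (tauAlgHom k).toLinearMap = AlgRep.inl (LF k) + AlgRep.inr (LF k) ∘ₗ LF.tau := rfl
  rw [h, bc, LinearMap.rTensor_add, LinearMap.rTensor_comp]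
  rfl

theorem AlgRep.diff_maurerCartan (ρ : AlgRep k V W)
    (g : LinearMap.GeneralLinearGroup (LF k) (LF k ⊗[k] V)) (w : LF k ⊗[k] W) :
    ρ.diff (maurerCartan g) ((ρ.act (LF k) g).1 w) + (ρ.act (LF k) g).1 (tauHat W w)
      = tauHat W ((ρ.act (LF k) g).1 w) := by
  have h := ρ.natural (LF k) (DualNumber (LF k)) (tauAlgHom k) g
    (oneAddEps (maurerCartan g) * bcGL (inlA k (LF k)) g) (fun v => by
      show (oneAddEps _).1 ((bcGL (inlA k (LF k)) g).1 _) = _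
      rw [bc_tauAlgHom, bc_tauAlgHom, map_add, bcGL_inl, bcGL_inr, map_add, oneAddEps_inl,
        oneAddEps_inr, maurerCartan_apply, map_sub]
      abel) w
  rw [map_mul, act_oneAddEps, act_bcGL, bc_tauAlgHom, bc_tauAlgHom] at h
  change (oneAddEps _).1 ((bcGL (inlA k (LF k)) _).1 _) = _ at h
  rw [map_add, bcGL_inl, bcGL_inr, map_add, oneAddEps_inl, oneAddEps_inr] at h
  have h2 := congrArg (bc W (snd (LF k))) h
  simpa only [map_add, bc_snd_inl, bc_snd_inr, zero_add] using h2

end gauge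

/-! ### Flat vector bundles on the formal punctured disk -/

/-- A connection `∇` on an `F`-vector space `U`, given by the operator `ι_τ ∘ ∇ : U → U` obtained
by contracting with `τ = z d/dz` (so `∇ u = op u · dz/z`). Such an operator is `k`-linear by the
Leibniz rule, since `τ` kills `k`. -/
structure FlatConn (k : Type u) [Field k] (U : Type u) [AddCommGroup U] [Module (LF k) U] where
  op : U →+ U
  leibniz : ∀ (f : LF k) (u : U), op (f • u) = LF.tau f • u + f • op u

namespace FlatConn

variable {k : Type u} [Field k] {U : Type u} [AddCommGroup U] [Module (LF k) U]
  [Module k⟦X⟧ U] [IsScalarTower k⟦X⟧ (LF k) U]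

/-- `(U, ∇)` is regular singular if some `k⟦z⟧`-lattice `L ⊂ U` satisfies `(ι_τ ∘ ∇)(L) ⊂ L`. -/
def RegularSingular (D : FlatConn k U) : Prop :=
  ∃ L : Submodule k⟦X⟧ U, Submodule.IsLattice (LF k) L ∧ ∀ u ∈ L, D.op u ∈ L

/-- `r` is the slope of `(U, ∇)`. A regular singular `(U, ∇)` has slope `0`. An irregular singular
one has slope `r`, where `r` is a positive rational number, if the numbers
`v((ι_τ ∘ ∇)^i e) + r i`, `i > 0`, are bounded; here `e` is a basis of `U`, and for a finite family
`e'` in `U`, `v(e')` is the greatest integer `m` with `e' ⊂ z ^ m L`, for a lattice `L`. -/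
def HasSlope (D : FlatConn k U) (r : ℝ) : Prop :=
  (D.RegularSingular ∧ r = 0) ∨
  (¬ D.RegularSingular ∧ 0 < r ∧ (∃ q : ℚ, (q : ℝ) = r) ∧
    ∀ L : Submodule k⟦X⟧ U, Submodule.IsLattice (LF k) L →
    ∀ (n : ℕ) (e : Module.Basis (Fin n) (LF k) U),
    ∃ (v : ℕ → ℤ) (C : ℝ), ∀ i : ℕ, 0 < i →
      IsGreatest {m : ℤ | ∀ j, (LF.zpow (-m) : LF k) • (D.op^[i] (e j)) ∈ L} (v i) ∧
      |(v i : ℝ) + r * i| ≤ C)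

end FlatConn

/-! ### Flat `GL(V)`-bundles on the formal punctured disk -/

/-- The group `GL(V)(F) = GL(F ⊗ V)`. -/
abbrev GLhat (k V : Type u) [Field k] [AddCommGroup V] [Module k V] : Type u :=
  LinearMap.GeneralLinearGroup (LF k) (LF k ⊗[k] V)

/-- A flat `GL(V)`-bundle on `Spec F`. A principal bundle is given by the set of its
trivializations `φ`, a torsor under `GL(V)(F)`. A flat structure `∇` assigns to each trivialization
`φ` the matrix `[∇]_φ = conn φ · dz/z` of the connection, subject to the gauge transformation rule
`[∇]_{g φ} = g [∇]_φ g⁻¹ - (dg) g⁻¹`. -/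
structure FlatGLBundle (k V : Type u) [Field k] [AddCommGroup V] [Module k V] where
  /-- the set of trivializations -/
  Triv : Type u
  [mulAction : MulAction (GLhat k V) Triv]
  nonempty : Nonempty Triv
  simply_transitive : ∀ φ ψ : Triv, ∃! g : GLhat k V, g • φ = ψ
  /-- the matrix of the connection, contracted with `τ` -/
  conn : Triv → Module.End (LF k) (LF k ⊗[k] V)
  gauge : ∀ (g : GLhat k V) (φ : Triv),
    conn (g • φ) = g.1 * conn φ * g⁻¹.1 - maurerCartan g

namespace FlatGLBundle

variable {k V : Type u} [Field k] [AddCommGroup V] [Module k V]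

instance (P : FlatGLBundle k V) : MulAction (GLhat k V) P.Triv := P.mulAction

variable {W : Type u} [AddCommGroup W] [Module k W]

/-- The vector bundle associated to a representation `(W, ρ)`: a section `s` is the compatible
family of its expressions `s φ ∈ F ⊗ W` in the trivializations `φ`. -/
def assocSpace (P : FlatGLBundle k V) (ρ : AlgRep k V W) :
    Submodule (LF k) (P.Triv → LF k ⊗[k] W) where
  carrier := {s | ∀ (g : GLhat k V) (φ : P.Triv), s (g • φ) = (ρ.act (LF k) g).1 (s φ)}
  add_mem' hs ht g φ := by rw [Pi.add_apply, hs g φ, ht g φ, Pi.add_apply, map_add]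
  zero_mem' g φ := by rw [Pi.zero_apply, Pi.zero_apply, map_zero]
  smul_mem' f s hs g φ := by rw [Pi.smul_apply, hs g φ, Pi.smul_apply, map_smul]

theorem assoc_equivariant (P : FlatGLBundle k V) (ρ : AlgRep k V W) (g : GLhat k V)
    (φ : P.Triv) (w : LF k ⊗[k] W) :
    tauHat W ((ρ.act (LF k) g).1 w) + ρ.diff (P.conn (g • φ)) ((ρ.act (LF k) g).1 w)
      = (ρ.act (LF k) g).1 (tauHat W w + ρ.diff (P.conn φ) w) := by
  have h : P.conn (g • φ) + maurerCartan g = g.1 * P.conn φ * g⁻¹.1 := by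
    rw [P.gauge]; exact sub_add_cancel (g.1 * P.conn φ * g⁻¹.1) (maurerCartan g)
  have h1 := congrArg (fun X => ρ.diff X ((ρ.act (LF k) g).1 w)) h
  simp only [AlgRep.diff_add, AlgRep.diff_conj, LinearMap.add_apply] at h1
  have h2 : ((ρ.act (LF k) g).1 * ρ.diff (P.conn φ) * (ρ.act (LF k) g)⁻¹.1)
      ((ρ.act (LF k) g).1 w) = (ρ.act (LF k) g).1 (ρ.diff (P.conn φ) w) := by
    show ((ρ.act (LF k) g).1 * ρ.diff (P.conn φ))
      (((ρ.act (LF k) g)⁻¹.1 * (ρ.act (LF k) g).1) w) = _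
    rw [Units.inv_mul]; rfl
  rw [← AlgRep.diff_maurerCartan ρ g w, map_add, ← h2, ← h1]
  abel

/-- The flat vector bundle `(W_𝒢, ∇_W)` associated to a representation `(W, ρ)`. In the
trivialization `φ` it is `(F ⊗ W, d + ρ([∇]_φ))`. -/
def assoc (P : FlatGLBundle k V) (ρ : AlgRep k V W) : FlatConn k (P.assocSpace ρ) where
  op :=
    { toFun := fun s =>
        ⟨fun φ => tauHat W (s.1 φ) + ρ.diff (P.conn φ) (s.1 φ), fun g φ => by
          show tauHat W (s.1 (g • φ)) + ρ.diff (P.conn (g • φ)) (s.1 (g • φ)) = _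
          rw [s.2 g φ, assoc_equivariant]⟩
      map_zero' := Subtype.ext (funext fun φ => by
        show tauHat W (0 : LF k ⊗[k] W) + ρ.diff (P.conn φ) 0 = 0
        rw [map_zero, map_zero, add_zero])
      map_add' := fun s t => Subtype.ext (funext fun φ => by
        show tauHat W (s.1 φ + t.1 φ) + ρ.diff (P.conn φ) (s.1 φ + t.1 φ)
          = (tauHat W (s.1 φ) + ρ.diff (P.conn φ) (s.1 φ))
            + (tauHat W (t.1 φ) + ρ.diff (P.conn φ) (t.1 φ))
        rw [map_add, map_add]; abel) }
  leibniz f s := Subtype.ext (funext fun φ => by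
    show tauHat W (f • s.1 φ) + ρ.diff (P.conn φ) (f • s.1 φ)
      = LF.tau f • s.1 φ + f • (tauHat W (s.1 φ) + ρ.diff (P.conn φ) (s.1 φ))
    rw [tauHat_smul, map_smul, smul_add]; abel)

/-- A flat `GL(V)`-bundle is regular singular if all associated flat vector bundles are. -/
def RegularSingular (P : FlatGLBundle k V) : Prop :=
  ∀ (W : Type u) [AddCommGroup W] [Module k W] [FiniteDimensional k W] (ρ : AlgRep k V W),
    (P.assoc ρ).RegularSingular

end FlatGLBundle

/-! ### Moy–Prasad filtrations and the building -/

section building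

variable {k V : Type u} [Field k] [AddCommGroup V] [Module k V] {n : ℕ}
  (b : Module.Basis (Fin n) k V)

/-- The element of the maximal torus `T ⊂ GL(V)`, diagonal in the basis `b`, with entries `t i`. -/
def torusElt (t : Fin n → kˣ) : LinearMap.GeneralLinearGroup k (k ⊗[k] V) :=
  LinearMap.GeneralLinearGroup.ofLinearEquiv
    ((b.baseChange k).equiv ((b.baseChange k).unitsSMul t) (Equiv.refl (Fin n)))

variable {W : Type u} [AddCommGroup W] [Module k W]

/-- The weight space `W_χ` of a representation, for the character `t ↦ ∏ i, (t i) ^ (χ i)`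
of `T`. -/
def weightSpace (ρ : AlgRep k V W) (χ : Fin n → ℤ) : Submodule k W where
  carrier := {w | ∀ t : Fin n → kˣ, (ρ.act k (torusElt b t)).1 (1 ⊗ₜ w)
    = 1 ⊗ₜ (((∏ i, t i ^ χ i : kˣ) : k) • w)}
  add_mem' hv hw t := by
    rw [TensorProduct.tmul_add, map_add, hv t, hw t, smul_add, TensorProduct.tmul_add]
  zero_mem' t := by simp
  smul_mem' c w hw t := by
    rw [← TensorProduct.smul_tmul, ← TensorProduct.smul_tmul', map_smul, hw t, smul_comm,
      TensorProduct.smul_tmul', TensorProduct.smul_tmul]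

/-- For a point `a ∈ X_*(T) ⊗ ℝ = ℝⁿ` of the standard apartment, the lattice
`∏_{χ(a) + m ≥ r} W_χ z ^ m ⊂ F ⊗ W`. -/
def stdFilt (ρ : AlgRep k V W) (a : Fin n → ℝ) (r : ℝ) : Submodule k⟦X⟧ (LF k ⊗[k] W) :=
  Submodule.span k⟦X⟧ {y | ∃ (χ : Fin n → ℤ) (m : ℤ), r ≤ (∑ i, (χ i : ℝ) * a i) + m ∧
    ∃ w ∈ weightSpace b ρ χ, y = LF.zpow m ⊗ₜ w}

/-- The Moy–Prasad lattice `(F ⊗ W)_{g a, r} = g (F ⊗ W)_{a, r}`. -/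
def preFilt (p : GLhat k V × (Fin n → ℝ)) (ρ : AlgRep k V W) (r : ℝ) :
    Submodule k⟦X⟧ (LF k ⊗[k] W) :=
  (stdFilt b ρ p.2 r).map ((ρ.act (LF k) p.1).1.restrictScalars k⟦X⟧)

/-- Two pairs `(g, a)` define the same point of the building iff they define the same filtration on
all representations. -/
def buildingSetoid : Setoid (GLhat k V × (Fin n → ℝ)) where
  r p q := ∀ (W : Type u) [AddCommGroup W] [Module k W] [FiniteDimensional k W]
    (ρ : AlgRep k V W) (r : ℝ), preFilt b p ρ r = preFilt b q ρ r
  iseqv :=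
    { refl := fun _ _ _ _ _ _ _ => rfl
      symm := fun h W _ _ _ ρ r => (h W ρ r).symm
      trans := fun h h' W _ _ _ ρ r => (h W ρ r).trans (h' W ρ r) }

/-- The (enlarged) Bruhat–Tits building of `GL(V)` over `F`: the points `g a` with `g ∈ GL(V)(F)`
and `a` in the standard apartment `ℝⁿ`. -/
def Building : Type u := Quotient (buildingSetoid b)

namespace Building

variable {b}

/-- The Moy–Prasad filtration `(F ⊗ W)_{x, r}`. -/
def filt [FiniteDimensional k W] (x : Building b) (ρ : AlgRep k V W) (r : ℝ) :
    Submodule k⟦X⟧ (LF k ⊗[k] W) :=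
  Quotient.lift (fun p => preFilt b p ρ r) (fun p q (h : (buildingSetoid b).r p q) => h W ρ r) x

/-- `(F ⊗ W)_{x, r+}`, the union of the `(F ⊗ W)_{x, s}` with `s > r`. -/
def filtPlus [FiniteDimensional k W] (x : Building b) (ρ : AlgRep k V W) (r : ℝ) :
    Submodule k⟦X⟧ (LF k ⊗[k] W) :=
  ⨆ s : {s : ℝ // r < s}, x.filt ρ s

variable [FiniteDimensional k V]

/-- The filtration `gl(F ⊗ V)_{x, r}`. -/
def glFilt (x : Building b) (r : ℝ) : Submodule k (Module.End (LF k) (LF k ⊗[k] V)) where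
  carrier := {X | ∀ (s : ℝ), ∀ u ∈ x.filt (AlgRep.std k V) s,
    X u ∈ x.filt (AlgRep.std k V) (s + r)}
  add_mem' hX hY s u hu := add_mem (hX s u hu) (hY s u hu)
  zero_mem' s u _ := zero_mem _
  smul_mem' c X hX s u hu := by
    have h : (c • X) u = (PowerSeries.C c : k⟦X⟧) • X u := by
      rw [LinearMap.smul_apply, ← algebraMap_smul (LF k) c, ← algebraMap_smul (LF k)]
      congr 1
      exact (HahnSeries.ofPowerSeries_C c).symm
    rw [h]
    exact Submodule.smul_mem _ _ (hX s u hu)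

/-- `gl(F ⊗ V)_{x, r+}`, the union of the `gl(F ⊗ V)_{x, s}` with `s > r`. -/
def glFiltPlus (x : Building b) (r : ℝ) : Submodule k (Module.End (LF k) (LF k ⊗[k] V)) :=
  ⨆ s : {s : ℝ // r < s}, x.glFilt s

instance instAddCommGroupGlFilt (x : Building b) (r : ℝ) : AddCommGroup (x.glFilt r) :=
  Module.addCommMonoidToAddCommGroup k

/-- The quotient `gl(F ⊗ V)_{x, r} / gl(F ⊗ V)_{x, r+}`. -/
abbrev Gr (x : Building b) (r : ℝ) : Type u :=
  x.glFilt r ⧸ (x.glFiltPlus r).submoduleOf (x.glFilt r)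

/-- The parahoric subgroup of `GL(V)(F)` attached to `x`. For the general linear group it is the
stabilizer of the filtration `(F ⊗ V)_{x, •}`. -/
def parahoric (x : Building b) : Subgroup (GLhat k V) where
  carrier := {g | ∀ (s : ℝ) (u : LF k ⊗[k] V),
    g.1 u ∈ x.filt (AlgRep.std k V) s ↔ u ∈ x.filt (AlgRep.std k V) s}
  one_mem' _ _ := Iff.rfl
  mul_mem' hg hh s u := (hg s _).trans (hh s u)
  inv_mem' {g} hg s u := by
    rw [← hg s (g⁻¹.1 u)]
    have h : g.1 (g⁻¹.1 u) = u := by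
      show (g.1 * g⁻¹.1) u = u
      rw [Units.mul_inv]; rfl
    rw [h]

/-- Conjugation `Ad(g) : X ↦ g X g⁻¹` on `gl(F ⊗ V)`. -/
def conj (g : GLhat k V) :
    Module.End (LF k) (LF k ⊗[k] V) →ₗ[k] Module.End (LF k) (LF k ⊗[k] V) where
  toFun X := g.1 * X * g⁻¹.1
  map_add' X Y := by rw [mul_add, add_mul]
  map_smul' c X := by
    rw [RingHom.id_apply, mul_smul_comm, smul_mul_assoc]

theorem conj_mem (x : Building b) {g : GLhat k V} (hg : g ∈ x.parahoric) {r : ℝ}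
    {X : Module.End (LF k) (LF k ⊗[k] V)} (hX : X ∈ x.glFilt r) : conj g X ∈ x.glFilt r := by
  intro s u hu
  exact (hg _ _).2 (hX s _ ((x.parahoric.inv_mem hg s u).2 hu))

theorem conj_mem_plus (x : Building b) {g : GLhat k V} (hg : g ∈ x.parahoric) {r : ℝ}
    {X : Module.End (LF k) (LF k ⊗[k] V)} (hX : X ∈ x.glFiltPlus r) :
    conj g X ∈ x.glFiltPlus r := by
  have h : x.glFiltPlus r ≤ (x.glFiltPlus r).comap (conj g) :=
    iSup_le fun s Y hY => (le_iSup (fun s : {s : ℝ // r < s} => x.glFilt s) s) (x.conj_mem hg hY)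
  exact h hX

/-- The adjoint action of the parahoric subgroup on `gl(F ⊗ V)_{x, r} / gl(F ⊗ V)_{x, r+}`. -/
def adGr (x : Building b) (r : ℝ) (g : x.parahoric) : x.Gr r →ₗ[k] x.Gr r :=
  Submodule.mapQ _ _ ((conj g.1).restrict fun _ hX => x.conj_mem g.2 hX)
    (fun Y hY => x.conj_mem_plus g.2 (X := Y.1) hY)

end Building

/-! ### Strata -/

/-- The Zariski closure of a subset of a finite-dimensional `k`-vector space. -/
def zariskiClosure {M : Type u} [AddCommGroup M] [Module k M] (S : Set M) : Set M :=
  {x | ∀ p ∈ Algebra.adjoin k (Set.range fun (l : Module.Dual k M) (y : M) => l y),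
    (∀ y ∈ S, p y = 0) → p x = 0}

variable [FiniteDimensional k V] {b}

/-- The stratum `(x, r, β)` is fundamental if `β` is a semistable point of the coadjoint
representation of the parahoric at `x` on `(gl(F ⊗ V)_{x, r} / gl(F ⊗ V)_{x, r+})^∨`, i.e. `0` is not
in the Zariski closure of its orbit. (The action factors through the reductive quotient of the
parahoric.) -/
def IsFundamental (x : Building b) (r : ℝ) (β : Module.Dual k (x.Gr r)) : Prop :=
  (0 : Module.Dual k (x.Gr r)) ∉
    zariskiClosure (k := k) (Set.range fun g : x.parahoric => β ∘ₗ x.adGr r g⁻¹)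

/-- `X dz/z`, with `X ∈ gl(F ⊗ V)_{x, -r}`, represents the functional `β` on
`gl(F ⊗ V)_{x, r} / gl(F ⊗ V)_{x, r+}` if `β(Y) = Res Tr(X Y) dz/z` for all `Y`. -/
def IsRepresentative (x : Building b) (r : ℝ) (β : Module.Dual k (x.Gr r))
    (X : Module.End (LF k) (LF k ⊗[k] V)) : Prop :=
  X ∈ x.glFilt (-r) ∧ ∀ Y : x.glFilt r,
    β (Submodule.Quotient.mk Y) = (LinearMap.trace (LF k) (LF k ⊗[k] V) (X * Y.1)).coeff 0

namespace FlatGLBundle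

variable [Algebra ℝ k]

/-- The flat `GL(V)`-bundle contains the stratum `(x, r, β)` with respect to the trivialization
`φ`: for a representative `X dz/z` of `β`, the operator `∇_φ - i dz/z - X dz/z` maps
`(F ⊗ W)_{x, i}` to `Ω¹(F ⊗ W)_{x, (i-r)+} = (F ⊗ W)_{x, (i-r)+} dz/z`, for all real `i` and all
representations `W`. -/
def ContainsStratum (P : FlatGLBundle k V) (φ : P.Triv) (x : Building b) (r : ℝ)
    (β : Module.Dual k (x.Gr r)) : Prop :=
  ∃ X, IsRepresentative x r β X ∧
    ∀ (W : Type u) [AddCommGroup W] [Module k W] [FiniteDimensional k W] (ρ : AlgRep k V W)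
      (i : ℝ), ∀ w ∈ x.filt ρ i,
      tauHat W w + ρ.diff (P.conn φ) w - algebraMap ℝ k i • w - ρ.diff X w ∈ x.filtPlus ρ (i - r)

variable (b) in
/-- `r` is a slope of the flat `GL(V)`-bundle: it is the depth of a fundamental stratum contained in
the bundle (with respect to some trivialization). -/
def HasSlope (P : FlatGLBundle k V) (r : ℝ) : Prop :=
  0 ≤ r ∧ ∃ (φ : P.Triv) (x : Building b) (β : Module.Dual k (x.Gr r)),
    IsFundamental x r β ∧ P.ContainsStratum φ x r β

end FlatGLBundle

end building

end

/-!
In the trivialization `φ`, write `∇_τ = τ + A` on `F ⊗ V`. For a point of the building, that is, a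
basis of `F ⊗ V` with real weights, a stratum of depth `r` contained in the bundle is the functional
given by the leading matrix of `A`: the matrix over `k` of the map of degree `-r` which `A` induces
on the graded pieces of the filtration, up to an integral shift when `r = 0`. The stratum is
fundamental iff this leading matrix is not nilpotent: one-parameter subgroups of the parahoric
contract a nilpotent matrix to `0`, whereas the characteristic polynomial is constant on the Zariski
closure of an orbit.

If `r > 0` and the leading matrix `C` is not nilpotent, then the powers of `C` are the leading terms
of the iterates of `∇_τ`, so the iterates of a basis have order `-r * i` up to a bounded error. If
`r = 0`, then `∇_τ` preserves a lattice. As the growth rate is unique, all the fundamental strata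
contained in the bundle have the same depth, and this is the slope of the vector bundle.

Such a stratum exists: a cyclic vector puts `A` in the form of a companion matrix. If `q` is the
largest slope of its Newton polygon, then for the weights `-q * j` the leading matrix is again a
companion matrix, which is not nilpotent when `q > 0`. When `q = 0`, the gauge transformation by
`z⁻¹` adds `1` to the leading matrix, so that a nilpotent one becomes unipotent.
-/

noncomputable section

/-! ### Orders and coefficients of Laurent series -/

namespace LF

variable {k : Type u} [Field k] {f g : LF k} {u v : ℝ}

theorem ext (h : ∀ m, f.coeff m = g.coeff m) : f = g := HahnSeries.ext (funext h)

@[simp] theorem coeff_add (f g : LF k) (m : ℤ) : (f + g).coeff m = f.coeff m + g.coeff m := rfl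

@[simp] theorem coeff_smul (c : k) (f : LF k) (m : ℤ) : (c • f).coeff m = c * f.coeff m := rfl

theorem coeff_zpow (n m : ℤ) : (zpow n : LF k).coeff m = if m = n then 1 else 0 :=
  Eq.trans (HahnSeries.coeff_single (Γ := ℤ) (R := k)) (by congr)

@[simp] theorem coeff_zpow_mul (n m : ℤ) (f : LF k) :
    (zpow n * f).coeff m = f.coeff (m - n) := by
  have h := HahnSeries.coeff_single_mul_add (Γ := ℤ) (r := (1 : k)) (x := f) (a := m - n) (b := n)
  rwa [sub_add_cancel, one_mul] at h

theorem coeff_algebraMap (p : k⟦X⟧) (m : ℤ) :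
    (algebraMap k⟦X⟧ (LF k) p).coeff m = if m < 0 then 0 else PowerSeries.coeff m.natAbs p :=
  PowerSeries.coeff_coe p m

protected theorem zpow_zero : (zpow 0 : LF k) = 1 := rfl

theorem zpow_mul_zpow (m n : ℤ) : (zpow m * zpow n : LF k) = zpow (m + n) :=
  ext fun l => by
    rw [coeff_zpow_mul, coeff_zpow, coeff_zpow]
    exact if_congr (by lia) rfl rfl

protected theorem zpow_ne_zero (m : ℤ) : (zpow m : LF k) ≠ 0 :=
  right_ne_zero_of_mul_eq_one (a := zpow (-m)) (by rw [zpow_mul_zpow, neg_add_cancel, LF.zpow_zero])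

theorem tau_zpow (m : ℤ) : tau (zpow m : LF k) = (m : k) • zpow m :=
  ext fun l => by
    rw [tau_coeff, coeff_smul, coeff_zpow]
    split_ifs with h
    · rw [h]
    · rw [mul_zero, mul_zero]

theorem tau_one : tau (1 : LF k) = 0 := by
  rw [← LF.zpow_zero, tau_zpow, Int.cast_zero, zero_smul]

/-- `f` has order at least the real number `u`. -/
def OrdGE (f : LF k) (u : ℝ) : Prop := ∀ m : ℤ, (m : ℝ) < u → f.coeff m = 0

namespace OrdGE

theorem zero (u : ℝ) : OrdGE (0 : LF k) u := fun _ _ => rfl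

theorem mono (hf : OrdGE f u) (h : v ≤ u) : OrdGE f v := fun m hm => hf m (hm.trans_le h)

theorem add (hf : OrdGE f u) (hg : OrdGE g u) : OrdGE (f + g) u := fun m hm => by
  rw [coeff_add, hf m hm, hg m hm, add_zero]

theorem smul (c : k) (hf : OrdGE f u) : OrdGE (c • f) u := fun m hm => by
  rw [coeff_smul, hf m hm, mul_zero]

theorem sum {ι : Type*} {s : Finset ι} {f : ι → LF k} (hf : ∀ i ∈ s, OrdGE (f i) u) :
    OrdGE (∑ i ∈ s, f i) u :=
  Finset.sum_induction f (OrdGE · u) (fun _ _ => OrdGE.add) (OrdGE.zero u) hf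

theorem tau (hf : OrdGE f u) : OrdGE (tau f) u := fun m hm => by
  rw [tau_coeff, hf m hm, mul_zero]

theorem zpow {m : ℤ} (h : u ≤ m) : OrdGE (zpow m : LF k) u := fun l hl => by
  rw [coeff_zpow, if_neg]
  rintro rfl
  exact h.not_gt hl

theorem one (h : u ≤ 0) : OrdGE (1 : LF k) u := OrdGE.zpow (m := 0) (by simpa using h)

theorem const (c : k) (h : u ≤ 0) : OrdGE (algebraMap k (LF k) c) u := by
  rw [Algebra.algebraMap_eq_smul_one]; exact (OrdGE.one h).smul c

theorem powerSeries (p : k⟦X⟧) : OrdGE (algebraMap k⟦X⟧ (LF k) p) 0 := fun m hm => by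
  rw [coeff_algebraMap, if_pos (by exact_mod_cast hm)]

theorem tau_ordGE_one (hf : OrdGE f 0) : OrdGE (LF.tau f) 1 := fun m hm => by
  have hm : m ≤ 0 := Int.lt_add_one_iff.1 (by exact_mod_cast hm)
  rw [tau_coeff]
  rcases hm.eq_or_lt with rfl | hm
  · rw [Int.cast_zero, zero_mul]
  · rw [hf m (by exact_mod_cast hm), mul_zero]

theorem zpow_mul_iff {m : ℤ} : OrdGE (LF.zpow m * f) u ↔ OrdGE f (u - m) := by
  refine ⟨fun h l hl => ?_, fun h l hl => ?_⟩
  · have := h (l + m) (by push_cast; linarith)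
    rwa [coeff_zpow_mul, add_sub_cancel_right] at this
  · rw [coeff_zpow_mul]
    exact h _ (by push_cast; linarith)

theorem ceil (hf : OrdGE f u) : OrdGE f ⌈u⌉ :=
  fun m hm => hf m (Int.lt_ceil.1 (by exact_mod_cast hm))

theorem exists_eq_zpow_mul {m : ℤ} (hf : OrdGE f m) :
    ∃ p : k⟦X⟧, f = LF.zpow m * algebraMap k⟦X⟧ (LF k) p := by
  refine ⟨PowerSeries.mk fun n => f.coeff (m + n), ext fun l => ?_⟩
  rw [coeff_zpow_mul, coeff_algebraMap, PowerSeries.coeff_mk]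
  split_ifs with h
  · exact hf l (by exact_mod_cast sub_neg.1 h)
  · congr 1; lia

theorem exists_powerSeries (hf : OrdGE f 0) :
    ∃ p : k⟦X⟧, algebraMap k⟦X⟧ (LF k) p = f := by
  obtain ⟨p, rfl⟩ := exists_eq_zpow_mul (m := 0) (by simpa using hf)
  exact ⟨p, (one_mul _).symm⟩

theorem mul (hf : OrdGE f u) (hg : OrdGE g v) : OrdGE (f * g) (u + v) := by
  obtain ⟨p, rfl⟩ := hf.ceil.exists_eq_zpow_mul
  obtain ⟨q, rfl⟩ := hg.ceil.exists_eq_zpow_mul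
  rw [mul_mul_mul_comm, zpow_mul_zpow, ← map_mul, zpow_mul_iff]
  refine (powerSeries _).mono ?_
  push_cast
  linarith [Int.le_ceil u, Int.le_ceil v]

end OrdGE

theorem exists_coeff_ne_zero_and_ordGE (hf : f ≠ 0) : ∃ m : ℤ, f.coeff m ≠ 0 ∧ OrdGE f m :=
  ⟨HahnSeries.order (Γ := ℤ) f,
    fun h => hf (HahnSeries.coeff_order_eq_zero.1 h),
    fun _ hl => HahnSeries.coeff_eq_zero_of_lt_order (by exact_mod_cast hl)⟩

theorem eventually_ordGE_neg (f : LF k) : ∀ᶠ c : ℝ in Filter.atTop, OrdGE f (-c) := by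
  obtain rfl | hf := eq_or_ne f 0
  · exact .of_forall fun _ => OrdGE.zero _
  · obtain ⟨m, -, hm⟩ := exists_coeff_ne_zero_and_ordGE hf
    filter_upwards [Filter.eventually_ge_atTop (-m : ℝ)] with c hc
    exact hm.mono (by linarith)

/-- The coefficient of `z ^ u` for a real exponent `u`; it is `0` if `u` is not an integer. -/
def rcoeff (u : ℝ) : LF k →ₗ[k] k where
  toFun f := if (⌊u⌋ : ℝ) = u then f.coeff ⌊u⌋ else 0
  map_add' f g := by split_ifs <;> simp
  map_smul' c f := by split_ifs <;> simp

theorem rcoeff_intCast (f : LF k) (m : ℤ) : rcoeff m f = f.coeff m := by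
  rw [rcoeff, LinearMap.coe_mk, AddHom.coe_mk, Int.floor_intCast, if_pos rfl]

theorem rcoeff_eq_zero_of_forall_ne (f : LF k) (h : ∀ m : ℤ, (m : ℝ) ≠ u) : rcoeff u f = 0 :=
  if_neg (h _)

theorem OrdGE.rcoeff_eq_zero (hf : OrdGE f v) (h : u < v) : rcoeff u f = 0 := by
  by_cases hu : ∃ m : ℤ, (m : ℝ) = u
  · obtain ⟨m, rfl⟩ := hu
    rw [rcoeff_intCast, hf m h]
  · exact rcoeff_eq_zero_of_forall_ne f (not_exists.1 hu)

theorem OrdGE.rcoeff_mul (hf : OrdGE f u) (hg : OrdGE g v) :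
    rcoeff (u + v) (f * g) = rcoeff u f * rcoeff v g := by
  rcases (Int.le_ceil u).lt_or_eq with hu | hu
  · rw [hf.ceil.rcoeff_eq_zero hu, zero_mul, (hf.ceil.mul hg).rcoeff_eq_zero (by linarith)]
  rcases (Int.le_ceil v).lt_or_eq with hv | hv
  · rw [hg.ceil.rcoeff_eq_zero hv, mul_zero, (hf.mul hg.ceil).rcoeff_eq_zero (by linarith)]
  obtain ⟨m, rfl⟩ : ∃ m : ℤ, u = m := ⟨_, hu⟩
  obtain ⟨n, rfl⟩ : ∃ n : ℤ, v = n := ⟨_, hv⟩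
  obtain ⟨p, rfl⟩ := hf.exists_eq_zpow_mul
  obtain ⟨q, rfl⟩ := hg.exists_eq_zpow_mul
  rw [mul_mul_mul_comm, zpow_mul_zpow, ← map_mul, ← Int.cast_add, rcoeff_intCast, rcoeff_intCast,
    rcoeff_intCast]
  simp only [coeff_zpow_mul, sub_self, coeff_algebraMap]
  simp

theorem OrdGE.exists_gt (hf : OrdGE f u) (h : rcoeff u f = 0) : ∃ v > u, OrdGE f v := by
  rcases (Int.le_ceil u).eq_or_lt with hu | hu
  · rw [hu, rcoeff_intCast] at h
    refine ⟨⌈u⌉ + 1, by linarith, fun m hm => ?_⟩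
    rcases (Int.lt_add_one_iff.1 (by exact_mod_cast hm : m < ⌈u⌉ + 1)).eq_or_lt with rfl | hm
    · exact h
    · exact hf.ceil m (by exact_mod_cast hm)
  · exact ⟨⌈u⌉, hu, hf.ceil⟩

/-- The monomial `c z ^ u` for a real exponent `u`, as a function of `c`; it is `0` if `u` is not an
integer. -/
def rmonomial (u : ℝ) : k →ₗ[k] LF k where
  toFun c := if (⌊u⌋ : ℝ) = u then c • zpow ⌊u⌋ else 0
  map_add' c d := by split_ifs <;> simp [add_smul]
  map_smul' c d := by split_ifs <;> simp [mul_smul]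

theorem rmonomial_intCast (c : k) (m : ℤ) : rmonomial m c = c • zpow m := by
  rw [rmonomial, LinearMap.coe_mk, AddHom.coe_mk, Int.floor_intCast, if_pos rfl]

theorem ordGE_rmonomial (u : ℝ) (c : k) : OrdGE (rmonomial u c) u := by
  by_cases hu : ∃ m : ℤ, (m : ℝ) = u
  · obtain ⟨m, rfl⟩ := hu
    rw [rmonomial_intCast]
    exact (OrdGE.zpow le_rfl).smul c
  · rw [rmonomial, LinearMap.coe_mk, AddHom.coe_mk, if_neg (not_exists.1 hu _)]
    exact OrdGE.zero u

theorem rcoeff_rmonomial {c : k} (h : c ≠ 0 → ∃ m : ℤ, (m : ℝ) = u) :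
    rcoeff u (rmonomial u c) = c := by
  obtain rfl | hc := eq_or_ne c 0
  · rw [map_zero, map_zero]
  · obtain ⟨m, rfl⟩ := h hc
    rw [rmonomial_intCast, rcoeff_intCast, coeff_smul, coeff_zpow, if_pos rfl, mul_one]

theorem rmonomial_mul_rmonomial {c d : k} (hc : c ≠ 0 → ∃ m : ℤ, (m : ℝ) = u)
    (hd : d ≠ 0 → ∃ m : ℤ, (m : ℝ) = v) :
    rmonomial u c * rmonomial v d = rmonomial (u + v) (c * d) := by
  obtain rfl | hc0 := eq_or_ne c 0
  · simp only [map_zero, zero_mul]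
  obtain rfl | hd0 := eq_or_ne d 0
  · simp only [map_zero, mul_zero]
  obtain ⟨m, rfl⟩ := hc hc0
  obtain ⟨l, rfl⟩ := hd hd0
  rw [← Int.cast_add, rmonomial_intCast, rmonomial_intCast, rmonomial_intCast, smul_mul_smul_comm,
    zpow_mul_zpow]

end LF

/-! ### The filtration attached to a weighted basis -/

section weighted

open LF Filter

variable {k : Type u} [Field k] {U : Type*} [AddCommGroup U] [Module (LF k) U] {ι : Type*}
  {f : LF k} {m : ℤ} {u : U}

theorem zpow_neg_smul_zpow_smul (m : ℤ) (u : U) :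
    (zpow (-m) : LF k) • (zpow m : LF k) • u = u := by
  rw [smul_smul, zpow_mul_zpow, neg_add_cancel, LF.zpow_zero, one_smul]

variable [Module k⟦X⟧ U]

theorem span_eq_top_of_zpow_smul_mem {e : Module.Basis ι (LF k) U}
    {L : Submodule k⟦X⟧ U} (m : ι → ℤ)
    (h : ∀ i, (zpow (m i) : LF k) • e i ∈ L) : Submodule.span (LF k) (L : Set U) = ⊤ := by
  rw [eq_top_iff, ← e.span_eq, Submodule.span_le]
  rintro _ ⟨i, rfl⟩
  rw [← zpow_neg_smul_zpow_smul (k := k) (m i) (e i)]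
  exact Submodule.smul_mem _ _ (Submodule.subset_span (h i))

variable [IsScalarTower k⟦X⟧ (LF k) U]

theorem algebraMap_powerSeries_smul (p : k⟦X⟧) (u : U) :
    algebraMap k⟦X⟧ (LF k) p • u = p • u :=
  algebraMap_smul (LF k) p u

theorem LF.OrdGE.smul_mem {L : Submodule k⟦X⟧ U} (hf : OrdGE f 0) (hu : u ∈ L) : f • u ∈ L := by
  obtain ⟨p, rfl⟩ := hf.exists_powerSeries
  rw [algebraMap_powerSeries_smul]
  exact L.smul_mem p hu

theorem LF.OrdGE.smul_mem_of_zpow_smul_mem {L : Submodule k⟦X⟧ U} (hf : OrdGE f m)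
    (hu : (LF.zpow m : LF k) • u ∈ L) : f • u ∈ L := by
  rw [← zpow_neg_smul_zpow_smul (k := k) m u, smul_smul, mul_comm]
  exact OrdGE.smul_mem (OrdGE.zpow_mul_iff.2 (hf.mono (by simp))) hu

/-- The lattice of all `∑ f i • e i` with `f i` of order at least `s - a i`. -/
def weightedFilt (e : Module.Basis ι (LF k) U) (a : ι → ℝ) (s : ℝ) : Submodule k⟦X⟧ U where
  carrier := {u | ∀ i, OrdGE (e.repr u i) (s - a i)}
  add_mem' hu hv i := by rw [map_add]; exact (hu i).add (hv i)
  zero_mem' i := by rw [map_zero]; exact OrdGE.zero _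
  smul_mem' p u hu i := by
    rw [← algebraMap_powerSeries_smul, map_smul, Finsupp.smul_apply, smul_eq_mul]
    simpa only [zero_add] using (OrdGE.powerSeries p).mul (hu i)

variable {e : Module.Basis ι (LF k) U} {a : ι → ℝ} {s t : ℝ}

theorem weightedFilt_anti (h : s ≤ t) : weightedFilt e a t ≤ weightedFilt e a s :=
  fun _ hu i => (hu i).mono (by linarith)

theorem smul_mem_weightedFilt (hf : OrdGE f t) (hu : u ∈ weightedFilt e a s) :
    f • u ∈ weightedFilt e a (s + t) := fun i => by
  rw [map_smul]
  exact (hf.mul (hu i)).mono (by linarith)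

theorem zpow_smul_mem_weightedFilt :
    (zpow m : LF k) • u ∈ weightedFilt e a s ↔ u ∈ weightedFilt e a (s - m) := by
  refine forall_congr' fun i => ?_
  rw [map_smul, Finsupp.smul_apply, smul_eq_mul, OrdGE.zpow_mul_iff, sub_right_comm]

variable (e a) in
theorem basis_mem_weightedFilt (i : ι) : e i ∈ weightedFilt e a (a i) := fun j => by
  rw [Module.Basis.repr_self]
  obtain rfl | h := eq_or_ne j i
  · rw [Finsupp.single_eq_same]; exact OrdGE.one (by simp)
  · rw [Finsupp.single_eq_of_ne h]; exact OrdGE.zero _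

variable (e a s) in
theorem zpow_ceil_smul_basis_mem_weightedFilt (i : ι) :
    (zpow ⌈s - a i⌉ : LF k) • e i ∈ weightedFilt e a s := by
  rw [zpow_smul_mem_weightedFilt]
  exact weightedFilt_anti (by linarith [Int.le_ceil (s - a i)]) (basis_mem_weightedFilt e a i)

theorem eventually_zpow_smul_mem_lattice (L : Submodule k⟦X⟧ U) [Submodule.IsLattice (LF k) L]
    (u : U) : ∀ᶠ c : ℤ in atTop, (zpow c : LF k) • u ∈ L := by
  have hu : u ∈ Submodule.span (LF k) (L : Set U) := by
    rw [Submodule.IsLattice.span_eq_top]; trivial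
  induction hu using Submodule.span_induction with
  | mem v hv =>
    filter_upwards [eventually_ge_atTop 0] with c hc
    exact OrdGE.smul_mem (OrdGE.zpow (by exact_mod_cast hc)) hv
  | zero => exact .of_forall fun c => by rw [smul_zero]; exact L.zero_mem
  | add v w _ _ hv hw =>
    filter_upwards [hv, hw] with c hcv hcw
    rw [smul_add]
    exact L.add_mem hcv hcw
  | smul f v _ hv =>
    obtain ⟨c, hc⟩ := hv.exists
    filter_upwards [tendsto_intCast_atTop_atTop.eventually
      ((tendsto_atTop_add_const_right atTop (-c : ℝ) tendsto_id).eventually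
        (eventually_ordGE_neg f))] with d hd
    rw [smul_smul]
    exact OrdGE.smul_mem_of_zpow_smul_mem (OrdGE.zpow_mul_iff.2 (hd.mono (by simp))) hc

section finite

variable [Finite ι]

variable (e a) in
theorem eventually_mem_weightedFilt (u : U) :
    ∀ᶠ c : ℝ in atTop, u ∈ weightedFilt e a (-c) :=
  eventually_all.2 fun i => by
    filter_upwards [(tendsto_atTop_add_const_right atTop (a i) tendsto_id).eventually
      (eventually_ordGE_neg (e.repr u i))] with c hc
    exact hc.mono (by simp; linarith)

variable (e a s) in
theorem weightedFilt_eq_span :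
    weightedFilt e a s
      = Submodule.span k⟦X⟧ (Set.range fun i => (zpow ⌈s - a i⌉ : LF k) • e i) := by
  have := Fintype.ofFinite ι
  refine le_antisymm (fun u hu => ?_) (Submodule.span_le.2 ?_)
  · rw [← e.sum_repr u]
    exact Submodule.sum_mem _ fun i _ =>
      (hu i).ceil.smul_mem_of_zpow_smul_mem (Submodule.subset_span ⟨i, rfl⟩)
  · rintro _ ⟨i, rfl⟩
    exact zpow_ceil_smul_basis_mem_weightedFilt e a s i

variable (e a s) in
theorem isLattice_weightedFilt : Submodule.IsLattice (LF k) (weightedFilt e a s) where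
  fg := by
    rw [weightedFilt_eq_span]
    exact Submodule.fg_span (Set.finite_range _)
  span_eq_top := span_eq_top_of_zpow_smul_mem _ (zpow_ceil_smul_basis_mem_weightedFilt e a s)

variable (e a) in
theorem eventually_lattice_le_weightedFilt (L : Submodule k⟦X⟧ U)
    [Submodule.IsLattice (LF k) L] : ∀ᶠ c : ℝ in atTop, L ≤ weightedFilt e a (-c) := by
  obtain ⟨S, hS⟩ := Submodule.IsLattice.fg (A := LF k) (M := L)
  filter_upwards [(S.eventually_all).2 fun u _ => eventually_mem_weightedFilt e a u] with c hc
  rwa [← hS, Submodule.span_le]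

variable (e a) in
theorem eventually_weightedFilt_le_lattice (L : Submodule k⟦X⟧ U)
    [Submodule.IsLattice (LF k) L] : ∀ᶠ c : ℝ in atTop, weightedFilt e a c ≤ L := by
  have := Fintype.ofFinite ι
  choose m hm using fun i => (eventually_zpow_smul_mem_lattice L (e i)).exists
  filter_upwards [eventually_all.2 fun i => eventually_ge_atTop (m i + a i)] with c hc u hu
  rw [← e.sum_repr u]
  exact L.sum_mem fun i _ =>
    ((hu i).mono (le_sub_iff_add_le.2 (hc i))).smul_mem_of_zpow_smul_mem (hm i)

end finite

/-- The union of the lattices `weightedFilt e a t` with `t > s`. -/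
def weightedFiltPlus (e : Module.Basis ι (LF k) U) (a : ι → ℝ) (s : ℝ) : Submodule k⟦X⟧ U :=
  ⨆ t : {t : ℝ // s < t}, weightedFilt e a t

theorem mem_weightedFiltPlus :
    u ∈ weightedFiltPlus e a s ↔ ∃ t > s, u ∈ weightedFilt e a t := by
  have : Nonempty {t : ℝ // s < t} := ⟨⟨s + 1, by linarith⟩⟩
  rw [weightedFiltPlus, Submodule.mem_iSup_of_directed]
  · simp
  · intro x y
    exact ⟨⟨min x y, lt_min x.2 y.2⟩, weightedFilt_anti (min_le_left _ _),
      weightedFilt_anti (min_le_right _ _)⟩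

theorem weightedFilt_le_plus (h : s < t) : weightedFilt e a t ≤ weightedFiltPlus e a s :=
  fun _ hu => mem_weightedFiltPlus.2 ⟨t, h, hu⟩

end weighted

/-! ### Growth of the iterates of a connection -/

theorem nonpos_of_forall_mul_natCast_le {x C : ℝ} (h : ∀ i : ℕ, 0 < i → x * i ≤ C) : x ≤ 0 := by
  by_contra! hx
  obtain ⟨i, hi⟩ := exists_nat_gt (C / x)
  have hlt : C < x * i := (div_lt_iff₀' hx).1 hi
  have hle : x * (i + 1 : ℕ) ≤ C := h _ i.succ_pos
  push_cast at hle
  linarith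

theorem exists_isGreatest_abs_add_le {S : ℕ → Set ℤ} {r c d : ℝ}
    (lower : ∀ i : ℕ, ∃ m ∈ S i, c - r * i ≤ m) (upper : ∀ i : ℕ, ∀ m ∈ S i, m ≤ d - r * i) :
    ∃ (v : ℕ → ℤ) (C : ℝ), ∀ i : ℕ, IsGreatest (S i) (v i) ∧ |(v i : ℝ) + r * i| ≤ C := by
  have greatest (i : ℕ) : ∃ v : ℤ, IsGreatest (S i) v := by
    obtain ⟨m, hm, -⟩ := lower i
    obtain ⟨v, hv⟩ := Int.exists_greatest_of_bdd
      ⟨⌊d - r * i⌋, fun z hz => Int.le_floor.2 (upper i z hz)⟩ ⟨m, hm⟩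
    exact ⟨v, hv⟩
  choose v hv using greatest
  refine ⟨v, max |c| |d|, fun i => ⟨hv i, ?_⟩⟩
  obtain ⟨m, hm, hcm⟩ := lower i
  have hmv : (m : ℝ) ≤ v i := by exact_mod_cast (hv i).2 hm
  exact abs_le_max_abs_abs (by linarith) (by linarith [upper i _ (hv i).1])

namespace FlatConn

open LF Filter

variable {k : Type u} [Field k] {U : Type u} [AddCommGroup U] [Module (LF k) U]
  {ι κ : Type*} {s t r : ℝ}

theorem iterate_sum (D : FlatConn k U) (i : ℕ) (S : Finset κ) (f : κ → U) :
    D.op^[i] (∑ l ∈ S, f l) = ∑ l ∈ S, D.op^[i] (f l) := by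
  induction i with
  | zero => rfl
  | succ i ih => simp only [Function.iterate_succ_apply', ih, map_sum]

variable [Module k⟦X⟧ U] [IsScalarTower k⟦X⟧ (LF k) U]

/-- The integers `v i` are within bounded distance of `-r i`, where `v i` is the valuation of the
`i`-th iterate of `D` on a basis, for all lattices and bases. -/
def GrowthRate (D : FlatConn k U) (r : ℝ) : Prop :=
  ∀ L : Submodule k⟦X⟧ U, Submodule.IsLattice (LF k) L →
    ∀ (n : ℕ) (e : Module.Basis (Fin n) (LF k) U),
    ∃ (v : ℕ → ℤ) (C : ℝ), ∀ i : ℕ, 0 < i →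
      IsGreatest {m : ℤ | ∀ j, (LF.zpow (-m) : LF k) • (D.op^[i] (e j)) ∈ L} (v i) ∧
      |(v i : ℝ) + r * i| ≤ C

variable {e : Module.Basis ι (LF k) U} {a : ι → ℝ}

theorem iterate_smul_mem (D : FlatConn k U) {i : ℕ} {f : LF k} {u : U} (hf : OrdGE f t)
    (h : ∀ l ≤ i, D.op^[l] u ∈ weightedFilt e a s) :
    D.op^[i] (f • u) ∈ weightedFilt e a (s + t) := by
  induction i generalizing f u with
  | zero => exact smul_mem_weightedFilt hf (h 0 le_rfl)
  | succ i ih =>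
    rw [Function.iterate_succ_apply, D.leibniz, iterate_map_add]
    refine add_mem (ih hf.tau fun l hl => h l (hl.trans i.le_succ)) (ih hf fun l hl => ?_)
    rw [← Function.iterate_succ_apply]
    exact h (l + 1) (Nat.succ_le_succ hl)

/-- `D` lowers the depth in the filtration attached to the weighted basis `(e, a)` by at most
`r`. -/
def LowersDepthBy (D : FlatConn k U) (e : Module.Basis ι (LF k) U) (a : ι → ℝ) (r : ℝ) : Prop :=
  ∀ s, ∀ u ∈ weightedFilt e a s, D.op u ∈ weightedFilt e a (s - r)

theorem LowersDepthBy.iterate_mem {D : FlatConn k U} (hD : D.LowersDepthBy e a r) {u : U}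
    (hu : u ∈ weightedFilt e a s) (i : ℕ) : D.op^[i] u ∈ weightedFilt e a (s - r * i) := by
  induction i with
  | zero => simpa using hu
  | succ i ih =>
    rw [Function.iterate_succ_apply']
    convert hD _ _ ih using 2
    push_cast
    ring

/-- If all `D.op^[i] (e' l)` were of larger depth, a long further iteration would take the
basis `e`, expanded in `e'`, beyond the depth allowed by `hex`. -/
theorem LowersDepthBy.le_of_forall_iterate_mem [Finite κ] {D : FlatConn k U}
    (hD : D.LowersDepthBy e a r) (hr : 0 < r)
    (hex : ∀ i : ℕ, ∃ j, D.op^[i] (e j) ∉ weightedFiltPlus e a (a j - r * i))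
    {e' : Module.Basis κ (LF k) U} {c : ℝ} (ha : ∀ j, a j ≤ c)
    (he' : ∀ l, e' l ∈ weightedFilt e a (-c)) (hf : ∀ j l, OrdGE (e'.repr (e j) l) (-c)) {i : ℕ}
    (h : ∀ l, D.op^[i] (e' l) ∈ weightedFilt e a s) : s ≤ 2 * c - r * i := by
  by_contra! hlt
  have := Fintype.ofFinite κ
  obtain ⟨K, hK⟩ := exists_nat_gt (3 * c / r)
  rw [div_lt_iff₀' hr] at hK
  obtain ⟨t, ht, htK⟩ : ∃ t, 2 * c - r * (i + K) < t ∧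
      t ≤ min (s - r * K) (-c - r * i) :=
    ⟨_, lt_min (by linarith) (by linarith), le_rfl⟩
  have depth (l) (q : ℕ) (hq : q ≤ i + K) : D.op^[q] (e' l) ∈ weightedFilt e a t := by
    rcases le_total i q with hiq | hqi
    · obtain ⟨p, rfl⟩ := Nat.exists_eq_add_of_le hiq
      rw [add_comm i p, Function.iterate_add_apply]
      refine weightedFilt_anti (htK.trans ((min_le_left _ _).trans ?_)) (hD.iterate_mem (h l) p)
      gcongr
      lia
    · refine weightedFilt_anti (htK.trans ((min_le_right _ _).trans ?_)) (hD.iterate_mem (he' l) q)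
      gcongr
  obtain ⟨j, hj⟩ := hex (i + K)
  apply hj
  rw [← e'.sum_repr (e j), D.iterate_sum]
  refine Submodule.sum_mem _ fun l _ =>
    weightedFilt_le_plus ?_ (D.iterate_smul_mem (hf j l) (depth l))
  push_cast
  linarith [ha j]

theorem LowersDepthBy.growthRate [Finite ι] {D : FlatConn k U} (hD : D.LowersDepthBy e a r)
    (hr : 0 < r) (hex : ∀ i : ℕ, ∃ j, D.op^[i] (e j) ∉ weightedFiltPlus e a (a j - r * i)) :
    D.GrowthRate r := by
  intro L hL n e'
  obtain ⟨c, ha, he', hf, hcL, hLc⟩ := ((eventually_all.2 fun j => eventually_ge_atTop (a j)).and <|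
    (eventually_all.2 fun l => eventually_mem_weightedFilt e a (e' l)).and <|
    (eventually_all.2 fun j => eventually_all.2 fun l =>
      eventually_ordGE_neg (e'.repr (e j) l)).and <|
    (eventually_weightedFilt_le_lattice e a L).and
      (eventually_lattice_le_weightedFilt e a L)).exists
  have lower (i : ℕ) : ∃ m ∈ {m : ℤ | ∀ j, (zpow (-m) : LF k) • D.op^[i] (e' j) ∈ L},
      -2 * c - 1 - r * i ≤ m := by
    refine ⟨⌊-2 * c - r * i⌋, fun j => hcL ?_, by linarith [Int.sub_one_lt_floor (-2 * c - r * i)]⟩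
    rw [zpow_smul_mem_weightedFilt]
    refine weightedFilt_anti ?_ (hD.iterate_mem (he' j) i)
    push_cast
    linarith [Int.floor_le (-2 * c - r * i)]
  have upper (i : ℕ) : ∀ m ∈ {m : ℤ | ∀ j, (zpow (-m) : LF k) • D.op^[i] (e' j) ∈ L},
      m ≤ 3 * c - r * i := by
    intro m hm
    have := hD.le_of_forall_iterate_mem hr hex ha he' hf fun l =>
      zpow_smul_mem_weightedFilt.1 (hLc (hm l))
    push_cast at this
    linarith
  obtain ⟨v, C, hv⟩ := exists_isGreatest_abs_add_le lower upper
  exact ⟨v, C, fun i _ => hv i⟩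

theorem regularSingular_of_basis [Finite ι] (D : FlatConn k U)
    (hD : ∀ j, D.op (e j) ∈ weightedFilt e 0 0) : D.RegularSingular := by
  have := Fintype.ofFinite ι
  refine ⟨weightedFilt e 0 0, isLattice_weightedFilt e 0 0, fun u hu => ?_⟩
  rw [← e.sum_repr u, map_sum]
  refine Submodule.sum_mem _ fun j _ => ?_
  have hj : OrdGE (e.repr u j) 0 := by simpa using hu j
  rw [D.leibniz]
  exact add_mem (hj.tau.smul_mem (basis_mem_weightedFilt e 0 j)) (hj.smul_mem (hD j))

theorem LowersDepthBy.regularSingular [Finite ι] {D : FlatConn k U} (hD : D.LowersDepthBy e a 0) :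
    D.RegularSingular :=
  ⟨weightedFilt e a 0, isLattice_weightedFilt e a 0, fun u hu => by
    simpa only [sub_zero] using hD 0 u hu⟩

theorem zpow_smul_iterate_mem (D : FlatConn k U) {L : Submodule k⟦X⟧ U}
    (hL : ∀ u ∈ L, D.op u ∈ L) {m : ℤ} {u : U} (hu : (zpow m : LF k) • u ∈ L) (i : ℕ) :
    (zpow m : LF k) • D.op^[i] u ∈ L := by
  induction i with
  | zero => exact hu
  | succ i ih =>
    have leibniz := D.leibniz (zpow m) (D.op^[i] u)
    rw [tau_zpow, Algebra.smul_def, mul_smul] at leibniz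
    rw [Function.iterate_succ_apply', ← sub_eq_of_eq_add' leibniz]
    exact L.sub_mem (hL _ ih) (OrdGE.smul_mem (OrdGE.const _ le_rfl) ih)

variable [FiniteDimensional (LF k) U] {D : FlatConn k U}

theorem GrowthRate.not_regularSingular (h : D.GrowthRate r) (hr : 0 < r) :
    ¬ D.RegularSingular := by
  rintro ⟨L, hL, hst⟩
  let e := Module.finBasis (LF k) U
  obtain ⟨v, C, hv⟩ := h L hL _ e
  obtain ⟨m, hm⟩ := (eventually_all.2 fun j => eventually_zpow_smul_mem_lattice L (e j)).exists
  refine hr.not_ge (nonpos_of_forall_mul_natCast_le (C := C + m) fun i hi => ?_)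
  obtain ⟨hg, hb⟩ := hv i hi
  have hmv : -m ≤ v i := hg.2 fun j => by
    rw [neg_neg]; exact D.zpow_smul_iterate_mem hst (hm j) i
  have hmv' : -(m : ℝ) ≤ v i := by exact_mod_cast hmv
  linarith [(abs_le.1 hb).2]

theorem GrowthRate.unique (h : D.GrowthRate r) (h' : D.GrowthRate s) : r = s := by
  let e := Module.finBasis (LF k) U
  obtain ⟨v, C, hv⟩ := h _ (isLattice_weightedFilt e 0 0) _ e
  obtain ⟨v', C', hv'⟩ := h' _ (isLattice_weightedFilt e 0 0) _ e
  have hrs : |r - s| ≤ 0 := nonpos_of_forall_mul_natCast_le (C := C + C') fun i hi => by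
    have hvv' : v i = v' i := (hv i hi).1.unique (hv' i hi).1
    calc |r - s| * i = |(v i + r * i) - (v i + s * i)| := by
          rw [add_sub_add_left_eq_sub, ← sub_mul, abs_mul, Nat.abs_cast]
      _ ≤ |v i + r * i| + |v i + s * i| := abs_sub _ _
      _ ≤ C + C' := add_le_add (hv i hi).2 (hvv' ▸ (hv' i hi).2)
  exact sub_eq_zero.1 (abs_nonpos_iff.1 hrs)

end FlatConn

/-! ### Cyclic vectors -/

section perturbation

variable {K U ι : Type*} [Field K] [AddCommGroup U] [Module K U] [Finite ι] {u : ι → U}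

theorem finite_setOf_not_linearIndependent_add_smul (hu : LinearIndependent K u) (w : ι → U) :
    {c : K | ¬ LinearIndependent K (fun j => u j + c • w j)}.Finite := by
  classical
  have := Fintype.ofFinite ι
  obtain ⟨T, hT⟩ := LinearMap.exists_leftInverse_of_injective (Fintype.linearCombination K u)
    (LinearMap.ker_eq_bot.2 hu.fintypeLinearCombination_injective)
  have hTu (j) : T (u j) = Pi.single j 1 := by
    simpa [Fintype.linearCombination_apply_single] using LinearMap.congr_fun hT (Pi.single j 1)
  let A : Matrix ι ι K := Matrix.of fun j => T (w j)
  have hp : (-A).charpolyRev ≠ 0 := fun h => by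
    simpa [h] using Matrix.eval_charpolyRev (M := -A)
  have eval_charpolyRev (c : K) : (-A).charpolyRev.eval c = (1 + c • A).det := by
    rw [Matrix.charpolyRev, ← Polynomial.coe_evalRingHom, RingHom.map_det]
    congr 1
    ext i j
    by_cases h : i = j <;> simp [h, mul_comm c]
  refine (-A).charpolyRev.roots.toFinset.finite_toSet.subset fun c hc => ?_
  rw [Finset.mem_coe, Multiset.mem_toFinset, Polynomial.mem_roots hp, Polynomial.IsRoot,
    eval_charpolyRev]
  contrapose hc
  rw [Set.mem_ofPred_eq, not_not]
  have rows_eq : (T ∘ fun j => u j + c • w j) = (1 + c • A).row := by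
    ext j i
    simp [hTu, A, Matrix.row, Matrix.one_apply, Pi.single_apply, eq_comm]
  refine LinearIndependent.of_comp T ?_
  rw [rows_eq, Matrix.linearIndependent_rows_iff_isUnit, Matrix.isUnit_iff_isUnit_det]
  exact isUnit_iff_ne_zero.2 hc

theorem exists_ne_zero_linearIndependent_add_smul {k : Type*} [Field k] [Infinite k] [Algebra k K]
    {m : ℕ} {u : Fin m → U} (hu : LinearIndependent K u) {x : U}
    (hx : x ∉ Submodule.span K (Set.range u)) (w : Fin m → U) :
    ∃ c : k, c ≠ 0 ∧ LinearIndependent K (fun j => u j + algebraMap k K c • w j) ∧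
      x ∉ Submodule.span K (Set.range fun j => u j + algebraMap k K c • w j) := by
  have hfin := finite_setOf_not_linearIndependent_add_smul
    (linearIndependent_finSnoc.2 ⟨hu, hx⟩) (Fin.snoc w 0)
  have hinf : (algebraMap k K '' {0}ᶜ).Infinite :=
    (Set.finite_singleton 0).infinite_compl.image (algebraMap k K).injective.injOn
  obtain ⟨_, ⟨c, hc, rfl⟩, hli⟩ := (hinf.sdiff hfin).nonempty
  refine ⟨c, hc, linearIndependent_finSnoc.1 ?_⟩
  convert not_not.1 hli using 1
  ext j
  refine Fin.lastCases ?_ (fun j => ?_) j <;> simp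

end perturbation

namespace FlatConn

open LF Polynomial

variable {k : Type u} [Field k] {U : Type u} [AddCommGroup U] [Module (LF k) U]

theorem iterate_const_smul (D : FlatConn k U) (c : k) (u : U) (j : ℕ) :
    D.op^[j] (algebraMap k (LF k) c • u) = algebraMap k (LF k) c • D.op^[j] u := by
  have tau_const : tau (algebraMap k (LF k) c) = 0 := by
    rw [Algebra.algebraMap_eq_smul_one, map_smul, tau_one, smul_zero]
  induction j with
  | zero => rfl
  | succ j ih =>
    rw [Function.iterate_succ_apply', ih, D.leibniz, tau_const, zero_smul, zero_add,
      Function.iterate_succ_apply']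

theorem iterate_zpow_smul (D : FlatConn k U) (p : ℤ) (u : U) (j : ℕ) :
    D.op^[j] ((zpow p : LF k) • u) = (zpow p : LF k) •
      ∑ m ∈ Finset.range (j + 1), ((p : LF k) ^ (j - m) * j.choose m) • D.op^[m] u := by
  let E : AddMonoid.End U := D.op
  have twist : D.op^[j] ((zpow p : LF k) • u) = (zpow p : LF k) • ((E + p) ^ j) u := by
    induction j with
    | zero => rfl
    | succ j ih =>
      rw [Function.iterate_succ_apply', ih, D.leibniz, tau_zpow, pow_succ']
      change _ = (zpow p : LF k) • (D.op _ + (p : AddMonoid.End U) _)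
      rw [AddMonoid.End.intCast_apply, smul_add, add_comm, ← Int.cast_smul_eq_zsmul (LF k),
        smul_smul, mul_comm, Algebra.smul_def, map_intCast]
      rfl
  have term (m : ℕ) : (E ^ m * (p : AddMonoid.End U) ^ (j - m) * (j.choose m : AddMonoid.End U)) u
      = ((p : LF k) ^ (j - m) * j.choose m) • D.op^[m] u := by
    have comm : E ^ m * (p : AddMonoid.End U) ^ (j - m) * (j.choose m : AddMonoid.End U)
        = ((p ^ (j - m) * j.choose m : ℤ) : AddMonoid.End U) * E ^ m := by
      rw [(Int.cast_commute (p ^ (j - m) * j.choose m) (E ^ m)).eq, mul_assoc]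
      push_cast
      rfl
    have apply_comm : (((p ^ (j - m) * j.choose m : ℤ) : AddMonoid.End U) * E ^ m) u
        = (p ^ (j - m) * j.choose m : ℤ) • (E ^ m) u := rfl
    rw [comm, apply_comm, AddMonoid.End.coe_pow, ← Int.cast_smul_eq_zsmul (LF k)]
    push_cast
    rfl
  rw [twist, (Int.cast_commute p E).symm.add_pow]
  congr 1
  exact (AddMonoidHom.finsetSum_apply _ _ u).trans (Finset.sum_congr rfl fun m _ => term m)

theorem exists_polynomial_iterate_zpow_smul (D : FlatConn k U) (φ : U →ₗ[LF k] LF k) (u : U)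
    (j : ℕ) : ∃ Q : (LF k)[X], Q.natDegree ≤ j ∧ Q.coeff j = φ u ∧
      ∀ p : ℤ, φ (D.op^[j] ((zpow p : LF k) • u)) = zpow p * Q.eval (p : LF k) := by
  refine ⟨∑ m ∈ Finset.range (j + 1), C (φ (D.op^[m] u) * (j.choose m : LF k)) * X ^ (j - m),
    ?_, ?_, fun p => ?_⟩
  · exact natDegree_sum_le_of_forall_le _ _ fun m _ =>
      (natDegree_C_mul_X_pow_le _ _).trans (Nat.sub_le j m)
  · rw [finsetSum_coeff, Finset.sum_eq_single 0]
    · simp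
    · intro m hm h0
      rw [coeff_C_mul_X_pow, if_neg]
      have := Finset.mem_range.1 hm
      lia
    · simp
  · rw [D.iterate_zpow_smul, map_smul, map_sum, smul_eq_mul, eval_finsetSum]
    congr 1
    refine Finset.sum_congr rfl fun m _ => ?_
    simp only [map_smul, smul_eq_mul, eval_mul, eval_C, eval_pow, eval_X]
    ring

variable [CharZero k]

/-- A functional `φ` that kills `S` and not `f` turns the expression into `z ^ p R(p)`, where the
polynomial `R` has the coefficient `φ f` in degree `m`. -/
theorem exists_zpow_iterate_sub_sum_notMem (D : FlatConn k U) {S : Submodule (LF k) U} {f : U}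
    (hf : f ∉ S) {m : ℕ} (α : Fin m → LF k) :
    ∃ p : ℤ, D.op^[m] ((zpow p : LF k) • f)
      - ∑ j : Fin m, α j • D.op^[j] ((zpow p : LF k) • f) ∉ S := by
  obtain ⟨φ, hφf, hφS⟩ := Submodule.exists_le_ker_of_notMem hf
  choose Q hQdeg hQcoeff hQ using D.exists_polynomial_iterate_zpow_smul φ f
  let R : (LF k)[X] := Q m - ∑ j : Fin m, C (α j) * Q j
  have coeff_R : R.coeff m = φ f := by
    rw [coeff_sub, hQcoeff, finsetSum_coeff, Finset.sum_eq_zero, sub_zero]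
    intro j _
    rw [coeff_C_mul, coeff_eq_zero_of_natDegree_lt ((hQdeg j).trans_lt j.2), mul_zero]
  have hchar : CharZero (LF k) := charZero_of_injective_algebraMap (algebraMap k (LF k)).injective
  obtain ⟨p, hp⟩ : ∃ p : ℤ, R.eval (p : LF k) ≠ 0 := by
    by_contra! h
    have hR : R = 0 := R.eq_zero_of_infinite_isRoot
      ((Set.infinite_range_of_injective (Int.cast_injective (α := LF k))).mono
        (Set.range_subset_iff.2 h))
    exact hφf (by rw [← coeff_R, hR, Polynomial.coeff_zero])
  refine ⟨p, fun hmem => mul_ne_zero (LF.zpow_ne_zero p) hp ?_⟩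
  rw [← LinearMap.mem_ker.1 (hφS hmem)]
  simp only [R, map_sub, map_sum, map_smul, hQ, eval_sub, eval_finsetSum, eval_mul, eval_C,
    smul_eq_mul, mul_sub, Finset.mul_sum, mul_left_comm]

/-- If `D.op^[m] e = ∑ j, α j • D.op^[j] e`, the operator `D ^ m - ∑ j, α j D ^ j` kills `e`, and so
takes the perturbation `e + c w` to `c` times its value at `w`. -/
theorem exists_linearIndependent_iterate_succ (D : FlatConn k U) {e w : U} {m : ℕ}
    (he : LinearIndependent (LF k) fun j : Fin m => D.op^[j] e) {α : Fin m → LF k}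
    (hα : ∑ j, α j • D.op^[j] e = D.op^[m] e)
    (hw : D.op^[m] w - ∑ j, α j • D.op^[j] w
      ∉ Submodule.span (LF k) (Set.range fun j : Fin m => D.op^[j] e)) :
    ∃ v : U, LinearIndependent (LF k) fun j : Fin (m + 1) => D.op^[j] v := by
  obtain ⟨c, hc, hli, hmem⟩ := exists_ne_zero_linearIndependent_add_smul (k := k) he hw
    fun j => D.op^[j] w
  have iterate_perturbed (j : ℕ) : D.op^[j] (e + algebraMap k (LF k) c • w)
      = D.op^[j] e + algebraMap k (LF k) c • D.op^[j] w := by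
    rw [iterate_map_add, iterate_const_smul]
  refine ⟨e + algebraMap k (LF k) c • w, linearIndependent_finSucc'.2 ?_⟩
  have init_eq : (Fin.init fun j : Fin (m + 1) => D.op^[j] (e + algebraMap k (LF k) c • w))
      = fun j : Fin m => D.op^[j] e + algebraMap k (LF k) c • D.op^[j] w :=
    funext fun j => iterate_perturbed j
  rw [init_eq, Fin.val_last, iterate_perturbed]
  refine ⟨hli, fun hlast => hmem ?_⟩
  refine (Submodule.smul_mem_iff _ ((map_ne_zero (algebraMap k (LF k))).2 hc)).1 ?_
  convert Submodule.sub_mem _ hlast (Submodule.sum_mem _ fun j (_ : j ∈ Finset.univ) =>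
    Submodule.smul_mem _ (α j) (Submodule.subset_span (Set.mem_range_self j))) using 1
  simp only [← hα, smul_sub, smul_add, Finset.sum_add_distrib, Finset.smul_sum,
    add_sub_add_left_eq_sub, smul_comm (α _)]

theorem exists_linearIndependent_iterate (D : FlatConn k U) (m : ℕ)
    (hm : m ≤ Module.finrank (LF k) U) :
    ∃ e : U, LinearIndependent (LF k) fun j : Fin m => D.op^[j] e := by
  induction m with
  | zero => exact ⟨0, linearIndependent_empty_type⟩
  | succ m ih =>
    obtain ⟨e, he⟩ := ih (by lia)
    by_cases hdep : D.op^[m] e ∈ Submodule.span (LF k) (Set.range fun j : Fin m => D.op^[j] e)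
    · obtain ⟨α, hα⟩ := (Submodule.mem_span_range_iff_exists_fun (LF k)).1 hdep
      have hlt : Submodule.span (LF k) (Set.range fun j : Fin m => D.op^[j] e) < ⊤ := by
        refine lt_top_iff_ne_top.2 fun htop => ?_
        have hrank := finrank_range_le_card (R := LF k) (fun j : Fin m => D.op^[j] e)
        rw [Set.finrank, htop, finrank_top, Fintype.card_fin] at hrank
        lia
      obtain ⟨f, -, hf⟩ := SetLike.exists_of_lt hlt
      obtain ⟨p, hp⟩ := D.exists_zpow_iterate_sub_sum_notMem hf α
      exact D.exists_linearIndependent_iterate_succ he hα hp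
    · exact ⟨e, linearIndependent_finSucc'.2 ⟨he, hdep⟩⟩

theorem exists_cyclic_basis [FiniteDimensional (LF k) U] (D : FlatConn k U) {n : ℕ}
    (hn : Module.finrank (LF k) U = n) :
    ∃ (u : U) (e : Module.Basis (Fin n) (LF k) U), ∀ j : Fin n, e j = D.op^[j] u := by
  obtain ⟨u, hu⟩ := D.exists_linearIndependent_iterate n hn.ge
  obtain rfl | hpos := n.eq_zero_or_pos
  · exact ⟨u, Module.finBasisOfFinrankEq (LF k) U hn, fun j => j.elim0⟩
  · have : Nonempty (Fin n) := ⟨⟨0, hpos⟩⟩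
    exact ⟨u, basisOfLinearIndependentOfCardEqFinrank hu (by simp [hn]), fun j => by simp⟩

end FlatConn

/-! ### Homogeneous matrices -/

/-- The matrix `C` is homogeneous of degree `δ` when the `i`-th coordinate vector has degree `d i`:
it maps vectors of degree `ε` to vectors of degree `ε + δ`. -/
def IsHomogeneousMatrix {K ι Δ : Type*} [Zero K] [Add Δ] (d : ι → Δ) (δ : Δ) (C : Matrix ι ι K) :
    Prop :=
  ∀ i j, C i j ≠ 0 → d i = d j + δ

namespace IsHomogeneousMatrix

section semiring

variable {K ι Δ : Type*} [Semiring K] {d : ι → Δ} {A B : Matrix ι ι K}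

theorem one [AddZeroClass Δ] [DecidableEq ι] : IsHomogeneousMatrix d 0 (1 : Matrix ι ι K) :=
  fun i j h => by
    obtain rfl : i = j := not_imp_comm.1 Matrix.one_apply_ne h
    rw [add_zero]

theorem add [Add Δ] {δ : Δ} (hA : IsHomogeneousMatrix d δ A) (hB : IsHomogeneousMatrix d δ B) :
    IsHomogeneousMatrix d δ (A + B) := fun i j h => by
  by_cases hAij : A i j = 0
  · exact hB i j fun hBij => h (by rw [Matrix.add_apply, hAij, hBij, add_zero])
  · exact hA i j hAij

theorem smul [Add Δ] {δ : Δ} (c : K) (hA : IsHomogeneousMatrix d δ A) :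
    IsHomogeneousMatrix d δ (c • A) := fun i j h =>
  hA i j (right_ne_zero_of_mul h)

theorem mul [Fintype ι] [AddCommSemigroup Δ] {δ ε : Δ} (hA : IsHomogeneousMatrix d δ A)
    (hB : IsHomogeneousMatrix d ε B) : IsHomogeneousMatrix d (δ + ε) (A * B) := fun i j h => by
  rw [Matrix.mul_apply] at h
  obtain ⟨l, -, hl⟩ := Finset.exists_ne_zero_of_sum_ne_zero h
  rw [hA i l (left_ne_zero_of_mul hl), hB l j (right_ne_zero_of_mul hl), add_assoc, add_comm ε]

end semiring

end IsHomogeneousMatrix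

theorem exists_comp_comp_self_eq_self {K M N : Type*} [Field K] [AddCommGroup M] [Module K M]
    [AddCommGroup N] [Module K N] (f : M →ₗ[K] N) : ∃ g : N →ₗ[K] M, f ∘ₗ g ∘ₗ f = f := by
  obtain ⟨s, hs⟩ := f.rangeRestrict.exists_rightInverse_of_surjective f.range_rangeRestrict
  obtain ⟨g, hg⟩ := s.exists_extend
  refine ⟨g, LinearMap.ext fun x => ?_⟩
  have hgx : g (f x) = s (f.rangeRestrict x) := LinearMap.congr_fun hg (f.rangeRestrict x)
  rw [LinearMap.comp_apply, LinearMap.comp_apply, hgx]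
  exact congrArg Subtype.val (LinearMap.congr_fun hs (f.rangeRestrict x))

section projection

variable {K ι Δ : Type*} [Field K] [Fintype ι] [AddCommGroup Δ] {d : ι → Δ} {δ : Δ}
  {A : Matrix ι ι K}

theorem IsHomogeneousMatrix.exists_mul_mul_self_eq_self (hA : IsHomogeneousMatrix d δ A) :
    ∃ S : Matrix ι ι K, IsHomogeneousMatrix d (-δ) S ∧ A * S * A = A := by
  classical
  obtain ⟨g, hg⟩ := exists_comp_comp_self_eq_self (Matrix.toLin' A)
  let T := LinearMap.toMatrix' g
  have hT : A * T * A = A := Matrix.toLin'.injective <| by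
    rw [Matrix.toLin'_mul, Matrix.toLin'_mul, Matrix.toLin'_toMatrix', LinearMap.comp_assoc, hg]
  -- Only the entries of `T` of degree `-δ` contribute to the entries of `A * T * A` of degree `δ`.
  let S : Matrix ι ι K := Matrix.of fun i j => if d i = d j + -δ then T i j else 0
  have hS : IsHomogeneousMatrix d (-δ) S := fun i j h => not_imp_comm.1 (fun hij => if_neg hij) h
  refine ⟨S, hS, Matrix.ext fun i j => ?_⟩
  by_cases hij : d i = d j + δ
  · rw [← congrFun₂ hT i j]
    simp only [Matrix.mul_apply, Finset.sum_mul]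
    refine Finset.sum_congr rfl fun m _ => Finset.sum_congr rfl fun l _ => ?_
    by_cases hil : A i l = 0
    · simp only [hil, zero_mul]
    by_cases hmj : A m j = 0
    · simp only [hmj, mul_zero]
    have hSlm : S l m = T l m := if_pos <| by
      rw [hA m j hmj, add_neg_cancel_right]
      exact add_right_cancel ((hA i l hil).symm.trans hij)
    rw [hSlm]
  · have hASA := (hA.mul hS).mul hA i j
    rw [add_neg_cancel, zero_add] at hASA
    rw [not_imp_comm.1 (hA i j) hij, not_imp_comm.1 hASA hij]

theorem IsHomogeneousMatrix.exists_idempotent (hA : IsHomogeneousMatrix d δ A) :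
    ∃ Q : Matrix ι ι K, IsHomogeneousMatrix d 0 Q ∧ Q * Q = Q ∧ A * Q = A ∧
      ∀ B : Matrix ι ι K, A * B = 0 → Q * B = 0 := by
  obtain ⟨S, hS, hASA⟩ := hA.exists_mul_mul_self_eq_self
  refine ⟨S * A, neg_add_cancel δ ▸ hS.mul hA, ?_, by rw [← mul_assoc, hASA], fun B hB => ?_⟩
  · rw [mul_assoc, ← mul_assoc A, hASA]
  · rw [mul_assoc, hB, mul_zero]

end projection

/-! ### Leading matrices of endomorphisms -/

section leading

open LF Filter Topology

theorem unitAddCircle_coe_eq_iff {x y : ℝ} :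
    (x : UnitAddCircle) = y ↔ ∃ m : ℤ, (m : ℝ) = x - y := by
  rw [eq_comm, QuotientAddGroup.eq, AddSubgroup.mem_zmultiples_iff]
  refine exists_congr fun m => ?_
  rw [zsmul_eq_mul, mul_one, neg_add_eq_sub]

theorem IsHomogeneousMatrix.exists_intCast_eq {k : Type*} [Field k] {ι : Type*} {a : ι → ℝ}
    {r : ℝ} {C : Matrix ι ι k}
    (hC : IsHomogeneousMatrix (fun i => (a i : UnitAddCircle)) (r : UnitAddCircle) C) (i j : ι)
    (h : C i j ≠ 0) : ∃ m : ℤ, (m : ℝ) = r - a i + a j := by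
  have hij := hC i j h
  rw [← AddCircle.coe_add, unitAddCircle_coe_eq_iff] at hij
  obtain ⟨m, hm⟩ := hij
  exact ⟨-m, by push_cast; linarith⟩

variable {k : Type u} [Field k] {U : Type u} [AddCommGroup U] [Module (LF k) U]
  {ι : Type*} [Fintype ι] [DecidableEq ι] {e : Module.Basis ι (LF k) U} {a : ι → ℝ} {r s : ℝ}
  {X Y : Module.End (LF k) U} {C C' : Matrix ι ι k}

/-- `X` maps every `weightedFilt e a s` into `weightedFilt e a (s + r)`, in terms of the matrix
of `X`. -/
def HasDepth (e : Module.Basis ι (LF k) U) (a : ι → ℝ) (r : ℝ) (X : Module.End (LF k) U) : Prop :=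
  ∀ i j, OrdGE (LinearMap.toMatrix e e X i j) (r - a i + a j)

/-- The matrix of the map induced by `X`, of depth `r`, between the graded pieces of the filtration
`weightedFilt e a`. -/
def leadMatrix (e : Module.Basis ι (LF k) U) (a : ι → ℝ) (r : ℝ) (X : Module.End (LF k) U) :
    Matrix ι ι k :=
  Matrix.of fun i j => rcoeff (r - a i + a j) (LinearMap.toMatrix e e X i j)

theorem leadMatrix_apply (i j : ι) :
    leadMatrix e a r X i j = rcoeff (r - a i + a j) (LinearMap.toMatrix e e X i j) := rfl

namespace HasDepth

theorem one : HasDepth e a 0 (1 : Module.End (LF k) U) := fun i j => by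
  rw [LinearMap.toMatrix_one]
  obtain rfl | hij := eq_or_ne i j
  · rw [Matrix.one_apply_eq]
    exact OrdGE.one (by simp)
  · rw [Matrix.one_apply_ne hij]
    exact OrdGE.zero _

theorem add (hX : HasDepth e a r X) (hY : HasDepth e a r Y) : HasDepth e a r (X + Y) :=
  fun i j => by
    rw [map_add]
    exact (hX i j).add (hY i j)

theorem mono (hX : HasDepth e a r X) (h : s ≤ r) : HasDepth e a s X :=
  fun i j => (hX i j).mono (by linarith)

theorem mul (hX : HasDepth e a r X) (hY : HasDepth e a s Y) : HasDepth e a (r + s) (X * Y) :=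
  fun i j => by
    rw [LinearMap.toMatrix_mul, Matrix.mul_apply]
    exact OrdGE.sum fun l _ => ((hX i l).mul (hY l j)).mono (by linarith)

theorem leadMatrix_mul (hX : HasDepth e a r X) (hY : HasDepth e a s Y) :
    leadMatrix e a (r + s) (X * Y) = leadMatrix e a r X * leadMatrix e a s Y := by
  ext i j
  rw [leadMatrix_apply, LinearMap.toMatrix_mul, Matrix.mul_apply, Matrix.mul_apply, map_sum]
  refine Finset.sum_congr rfl fun l _ => ?_
  rw [show r + s - a i + a j = (r - a i + a l) + (s - a l + a j) by ring,
    (hX i l).rcoeff_mul (hY l j)]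
  rfl

end HasDepth

theorem leadMatrix_zero_diag (i : ι) :
    leadMatrix e a 0 X i i = (LinearMap.toMatrix e e X i i).coeff 0 := by
  rw [leadMatrix_apply, show (0 : ℝ) - a i + a i = (0 : ℤ) by simp, rcoeff_intCast]

theorem leadMatrix_one : leadMatrix e a 0 (1 : Module.End (LF k) U) = 1 := by
  ext i j
  obtain rfl | hij := eq_or_ne i j
  · rw [leadMatrix_zero_diag, LinearMap.toMatrix_one, Matrix.one_apply_eq, Matrix.one_apply_eq]
    rw [← LF.zpow_zero, coeff_zpow, if_pos rfl]
  · rw [leadMatrix_apply, LinearMap.toMatrix_one, Matrix.one_apply_ne hij, Matrix.one_apply_ne hij,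
      map_zero]

theorem leadMatrix_add : leadMatrix e a r (X + Y) = leadMatrix e a r X + leadMatrix e a r Y := by
  ext i j
  simp only [leadMatrix_apply, map_add, Matrix.add_apply]

theorem leadMatrix_algebraMap_smul (c : k) :
    leadMatrix e a r (algebraMap k (LF k) c • X) = c • leadMatrix e a r X := by
  ext i j
  rw [leadMatrix_apply, map_smul, Matrix.smul_apply, algebraMap_smul, map_smul]
  rfl

namespace HasDepth

theorem pow (hX : HasDepth e a r X) (m : ℕ) :
    HasDepth e a (r * m) (X ^ m) ∧ leadMatrix e a (r * m) (X ^ m) = leadMatrix e a r X ^ m := by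
  induction m with
  | zero => simpa using ⟨HasDepth.one, leadMatrix_one⟩
  | succ m ih =>
    rw [pow_succ, pow_succ, Nat.cast_succ, mul_add, mul_one]
    exact ⟨ih.1.mul hX, by rw [ih.1.leadMatrix_mul hX, ih.2]⟩

theorem leadMatrix_eq_zero (hX : HasDepth e a s X) (h : r < s) : leadMatrix e a r X = 0 := by
  ext i j
  exact (hX i j).rcoeff_eq_zero (by linarith)

theorem exists_gt (hX : HasDepth e a r X) (h : leadMatrix e a r X = 0) :
    ∃ s > r, HasDepth e a s X := by
  choose v hv hXv using fun i j => (hX i j).exists_gt (congrFun₂ h i j)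
  have gap_pos (i j : ι) : ∀ᶠ ε : ℝ in 𝓝[>] 0, ε < v i j - (r - a i + a j) :=
    eventually_nhdsWithin_of_eventually_nhds (eventually_lt_nhds (sub_pos.2 (hv i j)))
  obtain ⟨ε, hgap, hε⟩ := ((eventually_all.2 fun i => eventually_all.2 fun j => gap_pos i j).and
    self_mem_nhdsWithin).exists
  exact ⟨r + ε, lt_add_of_pos_right r hε, fun i j => (hXv i j).mono (by linarith [hgap i j])⟩

end HasDepth

theorem isHomogeneousMatrix_leadMatrix :
    IsHomogeneousMatrix (fun i => (a i : UnitAddCircle)) (r : UnitAddCircle)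
      (leadMatrix e a r X) := by
  intro i j h
  contrapose h
  refine rcoeff_eq_zero_of_forall_ne _ fun m hm => h ?_
  rw [← AddCircle.coe_add, unitAddCircle_coe_eq_iff]
  exact ⟨-m, by push_cast; linarith⟩

theorem coeff_zero_trace_eq (Z : Module.End (LF k) U) :
    (LinearMap.trace (LF k) U Z).coeff 0 = (leadMatrix e a 0 Z).trace := by
  rw [LinearMap.trace_eq_matrix_trace (LF k) e, ← rcoeff_intCast]
  simp only [Matrix.trace, map_sum, Matrix.diag_apply, leadMatrix_zero_diag, rcoeff_intCast]

theorem coeff_zero_trace_mul_eq (hX : HasDepth e a (-r) X) (hY : HasDepth e a r Y) :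
    (LinearMap.trace (LF k) U (X * Y)).coeff 0
      = (leadMatrix e a (-r) X * leadMatrix e a r Y).trace := by
  rw [coeff_zero_trace_eq (e := e) (a := a), ← hX.leadMatrix_mul hY, neg_add_cancel]

/-- The endomorphism with monomial matrix entries whose leading matrix in depth `r` is `C`, provided
`C` is homogeneous of degree `r`. -/
def ofLeadMatrix (e : Module.Basis ι (LF k) U) (a : ι → ℝ) (r : ℝ) (C : Matrix ι ι k) :
    Module.End (LF k) U :=
  Matrix.toLin e e (Matrix.of fun i j => rmonomial (r - a i + a j) (C i j))

theorem toMatrix_ofLeadMatrix (i j : ι) :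
    LinearMap.toMatrix e e (ofLeadMatrix e a r C) i j = rmonomial (r - a i + a j) (C i j) := by
  rw [ofLeadMatrix, LinearMap.toMatrix_toLin]
  rfl

theorem hasDepth_ofLeadMatrix : HasDepth e a r (ofLeadMatrix e a r C) := fun i j => by
  rw [toMatrix_ofLeadMatrix]
  exact ordGE_rmonomial _ _

theorem leadMatrix_ofLeadMatrix
    (hC : IsHomogeneousMatrix (fun i => (a i : UnitAddCircle)) (r : UnitAddCircle) C) :
    leadMatrix e a r (ofLeadMatrix e a r C) = C := by
  ext i j
  rw [leadMatrix_apply, toMatrix_ofLeadMatrix]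
  exact rcoeff_rmonomial (hC.exists_intCast_eq i j)

theorem ofLeadMatrix_one : ofLeadMatrix e a 0 (1 : Matrix ι ι k) = 1 := by
  refine (LinearMap.toMatrix e e).injective (Matrix.ext fun i j => ?_)
  rw [toMatrix_ofLeadMatrix, LinearMap.toMatrix_one]
  obtain rfl | hij := eq_or_ne i j
  · rw [show (0 : ℝ) - a i + a i = (0 : ℤ) by simp, rmonomial_intCast, Matrix.one_apply_eq,
      Matrix.one_apply_eq, one_smul, LF.zpow_zero]
  · rw [Matrix.one_apply_ne hij, Matrix.one_apply_ne hij, map_zero]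

theorem ofLeadMatrix_mul
    (hC : IsHomogeneousMatrix (fun i => (a i : UnitAddCircle)) (r : UnitAddCircle) C)
    (hC' : IsHomogeneousMatrix (fun i => (a i : UnitAddCircle)) (s : UnitAddCircle) C') :
    ofLeadMatrix e a r C * ofLeadMatrix e a s C' = ofLeadMatrix e a (r + s) (C * C') := by
  refine (LinearMap.toMatrix e e).injective (Matrix.ext fun i j => ?_)
  rw [toMatrix_ofLeadMatrix, LinearMap.toMatrix_mul, Matrix.mul_apply, Matrix.mul_apply, map_sum]
  refine Finset.sum_congr rfl fun l _ => ?_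
  rw [toMatrix_ofLeadMatrix, toMatrix_ofLeadMatrix,
    rmonomial_mul_rmonomial (hC.exists_intCast_eq i l) (hC'.exists_intCast_eq l j)]
  congr 2
  ring

variable [Module k⟦X⟧ U] [IsScalarTower k⟦X⟧ (LF k) U] {u : U}

theorem HasDepth.map_mem (hX : HasDepth e a r X) (hu : u ∈ weightedFilt e a s) :
    X u ∈ weightedFilt e a (s + r) := fun i => by
  rw [← LinearMap.toMatrix_mulVec_repr e e X u]
  exact OrdGE.sum fun j _ => ((hX i j).mul (hu j)).mono (by linarith)

theorem hasDepth_iff_forall_map_mem : HasDepth e a r X ↔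
    ∀ s, ∀ u ∈ weightedFilt e a s, X u ∈ weightedFilt e a (s + r) := by
  refine ⟨fun hX s u hu => hX.map_mem hu, fun h i j => ?_⟩
  rw [LinearMap.toMatrix_apply]
  exact (h _ _ (basis_mem_weightedFilt e a j) i).mono (by linarith)

theorem HasDepth.map_mem_plus (hX : HasDepth e a r X) (hu : u ∈ weightedFiltPlus e a s) :
    X u ∈ weightedFiltPlus e a (s + r) := by
  obtain ⟨t, ht, hu⟩ := mem_weightedFiltPlus.1 hu
  exact mem_weightedFiltPlus.2 ⟨t + r, by linarith, hX.map_mem hu⟩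

theorem leadMatrix_eq_zero_of_basis_mem_plus
    (h : ∀ j, X (e j) ∈ weightedFiltPlus e a (a j + r)) : leadMatrix e a r X = 0 := by
  ext i j
  obtain ⟨t, ht, hm⟩ := mem_weightedFiltPlus.1 (h j)
  rw [leadMatrix_apply, LinearMap.toMatrix_apply]
  exact (hm i).rcoeff_eq_zero (by linarith)

namespace FlatConn

variable {D : FlatConn k U}

/-- `X`, of depth `-r`, is the leading term of `D` for the filtration `weightedFilt e a`. -/
structure HasLeadingTerm (D : FlatConn k U) (e : Module.Basis ι (LF k) U) (a : ι → ℝ) (r : ℝ)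
    (X : Module.End (LF k) U) : Prop where
  hasDepth : HasDepth e a (-r) X
  sub_mem : ∀ s, ∀ u ∈ weightedFilt e a s, D.op u - X u ∈ weightedFiltPlus e a (s - r)

theorem HasLeadingTerm.lowersDepthBy (hX : D.HasLeadingTerm e a r X) :
    D.LowersDepthBy e a r := by
  intro s u hu
  obtain ⟨t, ht, hm⟩ := mem_weightedFiltPlus.1 (hX.sub_mem s u hu)
  rw [← sub_add_cancel (D.op u) (X u)]
  exact add_mem (weightedFilt_anti ht.le hm) (hX.hasDepth.map_mem hu)

theorem HasLeadingTerm.iterate_sub_pow_mem (hX : D.HasLeadingTerm e a r X)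
    (hu : u ∈ weightedFilt e a s) (i : ℕ) :
    D.op^[i] u - (X ^ i) u ∈ weightedFiltPlus e a (s - r * i) := by
  induction i with
  | zero => simp
  | succ i ih =>
    have split : D.op^[i + 1] u - (X ^ (i + 1)) u
        = (D.op (D.op^[i] u) - X (D.op^[i] u)) + X (D.op^[i] u - (X ^ i) u) := by
      rw [Function.iterate_succ_apply', pow_succ', Module.End.mul_apply, map_sub]
      abel
    rw [split, show s - r * (i + 1 : ℕ) = s - r * i - r by push_cast; ring]
    exact add_mem (hX.sub_mem _ _ (hX.lowersDepthBy.iterate_mem hu i)) (hX.hasDepth.map_mem_plus ih)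

theorem HasLeadingTerm.growthRate (hX : D.HasLeadingTerm e a r X) (hr : 0 < r)
    (hnil : ¬ IsNilpotent (leadMatrix e a (-r) X)) : D.GrowthRate r := by
  refine hX.lowersDepthBy.growthRate hr fun i => ?_
  by_contra! h
  refine hnil ⟨i, ?_⟩
  rw [← (hX.hasDepth.pow i).2]
  refine leadMatrix_eq_zero_of_basis_mem_plus fun j => ?_
  rw [neg_mul, ← sub_eq_add_neg, ← sub_sub_self (D.op^[i] (e j)) ((X ^ i) (e j))]
  exact _root_.sub_mem (h j) (hX.iterate_sub_pow_mem (basis_mem_weightedFilt e a j) i)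

end FlatConn

end leading

/-! ### The standard representation -/

theorem two_zpow_injective {K : Type*} [DivisionRing K] [CharZero K] :
    Function.Injective fun m : ℤ => (2 : K) ^ m := by
  intro m n h
  refine zpow_right_injective₀ (a := (2 : ℚ)) two_pos (by norm_num)
    (Rat.cast_injective (α := K) ?_)
  simpa using h

section standard

open LF

variable {k V : Type u} [Field k] [AddCommGroup V] [Module k V] {n : ℕ}
  {b : Module.Basis (Fin n) k V}

theorem repr_torusElt (t : Fin n → kˣ) (u : k ⊗[k] V) (i : Fin n) :
    (b.baseChange k).repr ((torusElt b t).1 u) i = t i * (b.baseChange k).repr u i := by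
  set e := b.baseChange k
  have h : (e.unitsSMul t).repr ((torusElt b t).1 u) i = e.repr u i := by
    change (e.unitsSMul t).repr (e.equiv (e.unitsSMul t) (Equiv.refl _) u) i = e.repr u i
    rw [Module.Basis.equiv, Equiv.refl_symm, Module.Basis.reindex_refl, LinearEquiv.trans_apply,
      LinearEquiv.apply_symm_apply]
  rwa [Module.Basis.repr_unitsSMul, inv_smul_eq_iff] at h

theorem mem_weightSpace_std_iff {χ : Fin n → ℤ} {w : V} :
    w ∈ weightSpace b (AlgRep.std k V) χ ↔ ∀ (t : Fin n → kˣ) (i : Fin n),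
      (t i : k) * b.repr w i = ((∏ l, t l ^ χ l : kˣ) : k) * b.repr w i := by
  refine forall_congr' fun t => ?_
  rw [← (b.baseChange k).repr.injective.eq_iff, Finsupp.ext_iff]
  refine forall_congr' fun i => ?_
  change (b.baseChange k).repr ((torusElt b t).1 (1 ⊗ₜ w)) i = _ ↔ _
  rw [repr_torusElt, Module.Basis.baseChange_repr_tmul, Module.Basis.baseChange_repr_tmul, map_smul,
    Finsupp.smul_apply, smul_eq_mul, smul_eq_mul, smul_eq_mul, mul_one, mul_one]

theorem basis_mem_weightSpace_std (j : Fin n) :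
    b j ∈ weightSpace b (AlgRep.std k V) (Pi.single j 1) := by
  refine mem_weightSpace_std_iff.2 fun t i => ?_
  rw [Finset.prod_eq_single j (fun l _ hl => by rw [Pi.single_eq_of_ne hl, zpow_zero]) (by simp),
    Pi.single_eq_same, zpow_one, b.repr_self]
  obtain rfl | hij := eq_or_ne j i
  · rfl
  · rw [Finsupp.single_eq_of_ne hij.symm, mul_zero, mul_zero]

theorem eq_single_of_mem_weightSpace_std [CharZero k] {χ : Fin n → ℤ} {w : V}
    (hw : w ∈ weightSpace b (AlgRep.std k V) χ) {j : Fin n} (hj : b.repr w j ≠ 0) :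
    χ = Pi.single j 1 := by
  have character (t : Fin n → kˣ) : (t j : k) = (∏ l, t l ^ χ l : kˣ) :=
    mul_right_cancel₀ hj (mem_weightSpace_std_iff.1 hw t j)
  ext i
  have h := character (Pi.mulSingle i (Units.mk0 2 two_ne_zero))
  rw [Finset.prod_eq_single i (fun l _ hl => by rw [Pi.mulSingle_eq_of_ne hl, one_zpow]) (by simp),
    Pi.mulSingle_eq_same, Units.val_zpow_eq_zpow_val, Units.val_mk0] at h
  refine two_zpow_injective (K := k) (h.symm.trans ?_)
  obtain rfl | hij := eq_or_ne j i
  · simp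
  · simp [hij, hij.symm]

theorem sum_single_mul (j : Fin n) (a : Fin n → ℝ) :
    ∑ i, (((Pi.single j 1 : Fin n → ℤ) i : ℤ) : ℝ) * a i = a j := by
  rw [Finset.sum_eq_single j (fun i _ hi => by rw [Pi.single_eq_of_ne hi, Int.cast_zero, zero_mul])
    (by simp), Pi.single_eq_same, Int.cast_one, one_mul]

theorem stdFilt_std [CharZero k] (a : Fin n → ℝ) (s : ℝ) :
    stdFilt b (AlgRep.std k V) a s = weightedFilt (b.baseChange (LF k)) a s := by
  refine le_antisymm (Submodule.span_le.2 ?_) ?_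
  · rintro _ ⟨χ, m, hm, w, hw, rfl⟩ j
    rw [Module.Basis.baseChange_repr_tmul]
    by_cases hj : b.repr w j = 0
    · rw [hj, zero_smul]
      exact OrdGE.zero _
    · rw [eq_single_of_mem_weightSpace_std hw hj, sum_single_mul] at hm
      exact (OrdGE.zpow (by linarith)).smul _
  · rw [weightedFilt_eq_span, Submodule.span_le]
    rintro _ ⟨j, rfl⟩
    refine Submodule.subset_span
      ⟨Pi.single j 1, ⌈s - a j⌉, ?_, b j, basis_mem_weightSpace_std j, ?_⟩
    · rw [sum_single_mul]
      linarith [Int.le_ceil (s - a j)]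
    · beta_reduce
      rw [Module.Basis.baseChange_apply, TensorProduct.smul_tmul', smul_eq_mul, mul_one]

theorem GLhat.apply_inv_apply (g : GLhat k V) (u : LF k ⊗[k] V) : g.1 (g⁻¹.1 u) = u :=
  LinearMap.congr_fun g.mul_inv u

theorem GLhat.inv_apply_apply (g : GLhat k V) (u : LF k ⊗[k] V) : g⁻¹.1 (g.1 u) = u :=
  LinearMap.congr_fun g.inv_mul u

variable (b)

/-- The basis `g (1 ⊗ b i)` of `F ⊗ V`, which splits the lattices of the points `g a` of the
building. -/
def movedBasis (g : GLhat k V) : Module.Basis (Fin n) (LF k) (LF k ⊗[k] V) :=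
  (b.baseChange (LF k)).map (LinearMap.GeneralLinearGroup.toLinearEquiv g)

theorem movedBasis_apply (g : GLhat k V) (j : Fin n) : movedBasis b g j = g.1 (1 ⊗ₜ b j) := by
  rw [movedBasis, Module.Basis.map_apply, Module.Basis.baseChange_apply]
  rfl

theorem preFilt_std [CharZero k] (g : GLhat k V) (a : Fin n → ℝ) (s : ℝ) :
    preFilt b (g, a) (AlgRep.std k V) s = weightedFilt (movedBasis b g) a s := by
  rw [preFilt, stdFilt_std]
  ext u
  constructor
  · rintro ⟨v, hv, rfl⟩ j
    change OrdGE ((b.baseChange (LF k)).repr (g⁻¹.1 (g.1 v)) j) _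
    rw [g.inv_apply_apply]
    exact hv j
  · exact fun hu => ⟨g⁻¹.1 u, hu, g.apply_inv_apply u⟩

/-- The point `g a` of the building. -/
def Building.mk (g : GLhat k V) (a : Fin n → ℝ) : Building b :=
  Quotient.mk (buildingSetoid b) (g, a)

namespace Building

theorem exists_eq_mk (x : Building b) : ∃ g a, x = mk b g a := by
  obtain ⟨⟨g, a⟩, rfl⟩ := Quotient.exists_rep x
  exact ⟨g, a, rfl⟩

variable {b} [CharZero k] [FiniteDimensional k V] {g : GLhat k V} {a : Fin n → ℝ} {r : ℝ}
  {X : Module.End (LF k) (LF k ⊗[k] V)}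

theorem filt_mk_std (s : ℝ) :
    (mk b g a).filt (AlgRep.std k V) s = weightedFilt (movedBasis b g) a s := preFilt_std b g a s

theorem filtPlus_mk_std (s : ℝ) :
    (mk b g a).filtPlus (AlgRep.std k V) s = weightedFiltPlus (movedBasis b g) a s :=
  iSup_congr fun t => filt_mk_std t

theorem mem_glFilt_mk : X ∈ (mk b g a).glFilt r ↔ HasDepth (movedBasis b g) a r X := by
  rw [hasDepth_iff_forall_map_mem]
  simp only [← filt_mk_std]
  rfl

theorem mem_glFiltPlus_mk : X ∈ (mk b g a).glFiltPlus r ↔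
    HasDepth (movedBasis b g) a r X ∧ leadMatrix (movedBasis b g) a r X = 0 := by
  have : Nonempty {t : ℝ // r < t} := ⟨⟨r + 1, lt_add_one r⟩⟩
  have directed : Directed (· ≤ ·) fun t : {t : ℝ // r < t} => (mk b g a).glFilt t := by
    intro t t'
    refine ⟨⟨min t t', lt_min t.2 t'.2⟩, fun Y hY => ?_, fun Y hY => ?_⟩ <;>
      rw [mem_glFilt_mk] at hY ⊢
    · exact hY.mono (min_le_left _ _)
    · exact hY.mono (min_le_right _ _)
  simp only [glFiltPlus, Submodule.mem_iSup_of_directed _ directed, mem_glFilt_mk]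
  constructor
  · rintro ⟨t, hX⟩
    exact ⟨hX.mono t.2.le, hX.leadMatrix_eq_zero t.2⟩
  · rintro ⟨hX, h0⟩
    obtain ⟨t, ht, hXt⟩ := hX.exists_gt h0
    exact ⟨⟨t, ht⟩, hXt⟩

theorem mem_parahoric_mk {h : GLhat k V} : h ∈ (mk b g a).parahoric ↔
    HasDepth (movedBasis b g) a 0 h.1 ∧ HasDepth (movedBasis b g) a 0 h⁻¹.1 := by
  simp only [hasDepth_iff_forall_map_mem, ← filt_mk_std, add_zero]
  constructor
  · exact fun hh => ⟨fun s u => (hh s u).2, fun s u => ((mk b g a).parahoric.inv_mem hh s u).2⟩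
  · rintro ⟨h_map, h_inv_map⟩ s u
    exact ⟨fun hu => by simpa only [h.inv_apply_apply] using h_inv_map s _ hu, h_map s u⟩

end Building

end standard

/-! ### Zariski closures -/

section zariski

open Polynomial

variable {k M N : Type u} [Field k] [AddCommGroup M] [Module k M] [AddCommGroup N] [Module k N]

variable (k M) in
/-- The algebra of polynomial functions on a vector space. -/
abbrev regularFunctions : Subalgebra k (M → k) :=
  Algebra.adjoin k (Set.range fun (l : Module.Dual k M) (y : M) => l y)

theorem comp_mem_of_mem_regularFunctions {X : Type*} {A : Subalgebra k (X → k)} {f : X → M}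
    (hf : ∀ l : Module.Dual k M, (fun x => l (f x)) ∈ A) {p : M → k}
    (hp : p ∈ regularFunctions k M) : p ∘ f ∈ A := by
  induction hp using Algebra.adjoin_induction with
  | mem _ hl =>
    obtain ⟨l, rfl⟩ := hl
    exact hf l
  | algebraMap c => exact A.algebraMap_mem c
  | add p q _ _ ihp ihq => exact A.add_mem ihp ihq
  | mul p q _ _ ihp ihq => exact A.mul_mem ihp ihq

theorem zariskiClosure_subset_of_subset {S T : Set M} (h : S ⊆ zariskiClosure (k := k) T) :
    zariskiClosure (k := k) S ⊆ zariskiClosure (k := k) T :=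
  fun _ hx p hp hT => hx p hp fun _ hy => h hy p hp hT

theorem zariskiClosure_mono {S T : Set M} (h : S ⊆ T) :
    zariskiClosure (k := k) S ⊆ zariskiClosure (k := k) T :=
  fun _ hx p hp hT => hx p hp fun y hy => hT y (h hy)

theorem map_mem_zariskiClosure_image (f : M →ₗ[k] N) {S : Set M} {x : M}
    (hx : x ∈ zariskiClosure (k := k) S) : f x ∈ zariskiClosure (k := k) (f '' S) := by
  intro p hp hS
  refine hx (p ∘ f) (comp_mem_of_mem_regularFunctions (fun l => ?_) hp) fun y hy =>
    hS _ ⟨y, hy, rfl⟩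
  exact Algebra.subset_adjoin ⟨l ∘ₗ f, rfl⟩

theorem eq_of_mem_zariskiClosure {S : Set M} {p : M → k} (hp : p ∈ regularFunctions k M) {c : k}
    (hS : ∀ y ∈ S, p y = c) {x : M} (hx : x ∈ zariskiClosure (k := k) S) : p x = c :=
  sub_eq_zero.1 (hx (p - algebraMap k _ c) (sub_mem hp (Subalgebra.algebraMap_mem _ c))
    fun y hy => sub_eq_zero.2 (hS y hy))

theorem mem_zariskiClosure_of_forall_add_smul_mem [Infinite k] {S : Set M} {x y : M}
    (h : ∀ t : k, t ≠ 0 → x + t • y ∈ S) : x ∈ zariskiClosure (k := k) S := by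
  intro p hp hS
  let evals : k[X] →ₐ[k] (k → k) := AlgHom.pi fun t => aeval t
  obtain ⟨q, hq⟩ : p ∘ (fun t : k => x + t • y) ∈ evals.range := by
    refine comp_mem_of_mem_regularFunctions (fun l => ?_) hp
    refine ⟨C (l x) + C (l y) * X, funext fun t => ?_⟩
    change aeval t (C (l x) + C (l y) * X) = l (x + t • y)
    rw [map_add, map_add, map_mul, map_smul, aeval_C, aeval_C, aeval_X, smul_eq_mul, mul_comm]
    rfl
  have eval_eq (t : k) : q.eval t = p (x + t • y) := congrFun hq t
  have hq0 : q = 0 := eq_zero_of_infinite_isRoot q <|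
    (Set.finite_singleton (0 : k)).infinite_compl.mono fun t ht => (eval_eq t).trans (hS _ (h t ht))
  rw [← add_zero x, ← zero_smul k y, ← eval_eq, hq0, eval_zero]

theorem charpoly_coeff_mem_regularFunctions {ι : Type} [Fintype ι] [DecidableEq ι] (i : ℕ) :
    (fun B : Matrix ι ι k => B.charpoly.coeff i) ∈ regularFunctions k (Matrix ι ι k) := by
  let A := regularFunctions k (Matrix ι ι k)
  let generic : Matrix ι ι A := Matrix.of fun i j =>
    ⟨fun B => B i j, Algebra.subset_adjoin ⟨Matrix.entryLinearMap k k i j, rfl⟩⟩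
  let ev (B : Matrix ι ι k) : A →+* k := (Pi.evalRingHom (fun _ => k) B).comp A.val.toRingHom
  have charpoly_eq (B : Matrix ι ι k) : B.charpoly = generic.charpoly.map (ev B) := by
    rw [← Matrix.charpoly_map]
    rfl
  have coeff_eq : (fun B : Matrix ι ι k => B.charpoly.coeff i) = generic.charpoly.coeff i :=
    funext fun B => by
      rw [charpoly_eq, Polynomial.coeff_map]
      rfl
  rw [coeff_eq]
  exact (generic.charpoly.coeff i).2

theorem charpoly_eq_of_mem_zariskiClosure {ι : Type} [Fintype ι] [DecidableEq ι]
    {S : Set (Matrix ι ι k)} {P : k[X]} (hS : ∀ B ∈ S, B.charpoly = P) {C : Matrix ι ι k}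
    (hC : C ∈ zariskiClosure (k := k) S) : C.charpoly = P :=
  Polynomial.ext fun i => eq_of_mem_zariskiClosure (charpoly_coeff_mem_regularFunctions i)
    (fun B hB => by rw [hS B hB]) hC

end zariski

/-! ### Semistability of strata -/

section semistable

open LF

variable {k V : Type u} [Field k] [AddCommGroup V] [Module k V] {n : ℕ}
  {b : Module.Basis (Fin n) k V} [FiniteDimensional k V]

section orbit

variable {x : Building b} {r : ℝ} {β β' : Module.Dual k (x.Gr r)}

/-- The orbit of `β` under the coadjoint action of the parahoric subgroup at `x`. -/
def coadjointOrbit (x : Building b) (r : ℝ) (β : Module.Dual k (x.Gr r)) :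
    Set (Module.Dual k (x.Gr r)) :=
  Set.range fun g : x.parahoric => β ∘ₗ x.adGr r g⁻¹

theorem Building.adGr_mul (g h : x.parahoric) :
    x.adGr r (g * h) = x.adGr r g ∘ₗ x.adGr r h := by
  refine LinearMap.ext fun y => ?_
  obtain ⟨Y, rfl⟩ := Submodule.Quotient.mk_surjective _ y
  refine congrArg Submodule.Quotient.mk (Subtype.ext ?_)
  change (g.1 * h.1).1 * Y.1 * ((g.1 * h.1)⁻¹).1 = g.1.1 * (h.1.1 * Y.1 * (h.1⁻¹).1) * (g.1⁻¹).1
  rw [mul_inv_rev, Units.val_mul, Units.val_mul]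
  simp only [mul_assoc]

theorem IsFundamental.of_mem_zariskiClosure (hβ : IsFundamental x r β)
    (h : β' ∈ zariskiClosure (k := k) (coadjointOrbit x r β)) : IsFundamental x r β' := by
  refine fun h0 => hβ (zariskiClosure_subset_of_subset ?_ h0)
  rintro _ ⟨g, rfl⟩
  have translate : (fun γ : Module.Dual k (x.Gr r) => γ ∘ₗ x.adGr r g⁻¹) '' coadjointOrbit x r β
      ⊆ coadjointOrbit x r β := by
    rintro _ ⟨_, ⟨h, rfl⟩, rfl⟩
    refine ⟨g * h, ?_⟩
    change β ∘ₗ x.adGr r (g * h)⁻¹ = β ∘ₗ x.adGr r h⁻¹ ∘ₗ x.adGr r g⁻¹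
    rw [mul_inv_rev, Building.adGr_mul]
  exact zariskiClosure_mono translate
    (map_mem_zariskiClosure_image (LinearMap.lcomp k k (x.adGr r g⁻¹)) h)

theorem not_isFundamental_zero : ¬ IsFundamental x r 0 :=
  fun h => h fun _ _ hp => hp 0 ⟨1, LinearMap.zero_comp _⟩

end orbit

namespace Building

variable [CharZero k] {g : GLhat k V} {a : Fin n → ℝ} {r : ℝ} {B C : Matrix (Fin n) (Fin n) k}

variable (g a) in
/-- The leading matrix of an endomorphism of depth `r`, as a linear map on
`gl(F ⊗ V)_{x, r} / gl(F ⊗ V)_{x, r+}`. -/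
def grLeadMatrix (r : ℝ) : (mk b g a).Gr r →ₗ[k] Matrix (Fin n) (Fin n) k :=
  Submodule.liftQ _
    { toFun := fun Y : (mk b g a).glFilt r => leadMatrix (movedBasis b g) a r Y.1
      map_add' := fun _ _ => leadMatrix_add
      map_smul' := fun c Y => by
        rw [SetLike.val_smul, ← algebraMap_smul (LF k) c Y.1]
        exact leadMatrix_algebraMap_smul c }
    fun _ hY => (mem_glFiltPlus_mk.1 (Submodule.mem_comap.1 hY)).2

variable (g a) in
/-- The functional `Y ↦ Tr(B Y)` on leading matrices of depth `r`. -/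
def dualOfMatrix (r : ℝ) : Matrix (Fin n) (Fin n) k →ₗ[k] Module.Dual k ((mk b g a).Gr r) where
  toFun B := Matrix.traceLinearMap (Fin n) k k ∘ₗ LinearMap.mulLeft k B ∘ₗ grLeadMatrix g a r
  map_add' B C := LinearMap.ext fun y => by simp [add_mul]
  map_smul' c B := LinearMap.ext fun y => by simp

theorem dualOfMatrix_mk (B : Matrix (Fin n) (Fin n) k) (Y : (mk b g a).glFilt r) :
    dualOfMatrix g a r B (Submodule.Quotient.mk Y)
      = (B * leadMatrix (movedBasis b g) a r Y.1).trace := rfl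

theorem isRepresentative_mk_iff {β : Module.Dual k ((mk b g a).Gr r)}
    {X : Module.End (LF k) (LF k ⊗[k] V)} : IsRepresentative (mk b g a) r β X ↔
      HasDepth (movedBasis b g) a (-r) X ∧
        β = dualOfMatrix g a r (leadMatrix (movedBasis b g) a (-r) X) := by
  rw [IsRepresentative, mem_glFilt_mk]
  refine and_congr_right fun hX => ?_
  have trace_eq (Y : (mk b g a).glFilt r) := coeff_zero_trace_mul_eq hX (mem_glFilt_mk.1 Y.2)
  simp only [trace_eq, ← dualOfMatrix_mk]
  refine ⟨fun h => LinearMap.ext fun y => ?_, fun h Y => LinearMap.congr_fun h _⟩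
  obtain ⟨Y, rfl⟩ := Submodule.Quotient.mk_surjective _ y
  exact h Y

theorem dualOfMatrix_comp_adGr (h : (mk b g a).parahoric) :
    dualOfMatrix g a r C ∘ₗ (mk b g a).adGr r h⁻¹
      = dualOfMatrix g a r (leadMatrix (movedBasis b g) a 0 h.1.1 * C
          * leadMatrix (movedBasis b g) a 0 (h.1⁻¹).1) := by
  refine LinearMap.ext fun y => ?_
  obtain ⟨Y, rfl⟩ := Submodule.Quotient.mk_surjective _ y
  obtain ⟨h_depth, h_inv_depth⟩ := mem_parahoric_mk.1 h.2
  have hY := mem_glFilt_mk.1 Y.2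
  have lead_conj : leadMatrix (movedBasis b g) a r ((h.1⁻¹).1 * Y.1 * h.1.1)
      = leadMatrix (movedBasis b g) a 0 (h.1⁻¹).1 * leadMatrix (movedBasis b g) a r Y.1
        * leadMatrix (movedBasis b g) a 0 h.1.1 := by
    rw [← h_inv_depth.leadMatrix_mul hY, ← (h_inv_depth.mul hY).leadMatrix_mul h_depth, zero_add,
      add_zero]
  change (C * leadMatrix (movedBasis b g) a r ((h.1⁻¹).1 * Y.1 * (h.1⁻¹)⁻¹.1)).trace = _
  rw [inv_inv, lead_conj, dualOfMatrix_mk, ← mul_assoc, ← mul_assoc, Matrix.trace_mul_comm]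
  simp only [mul_assoc]

theorem leadMatrix_mul_leadMatrix_inv (h : (mk b g a).parahoric) :
    leadMatrix (movedBasis b g) a 0 h.1.1 * leadMatrix (movedBasis b g) a 0 (h.1⁻¹).1 = 1 := by
  obtain ⟨h_depth, h_inv_depth⟩ := mem_parahoric_mk.1 h.2
  rw [← h_depth.leadMatrix_mul h_inv_depth, add_zero, Units.mul_inv, leadMatrix_one]

theorem dualOfMatrix_mul_mul_mem_coadjointOrbit {A A' : Matrix (Fin n) (Fin n) k}
    (hA : IsHomogeneousMatrix (fun i => (a i : UnitAddCircle)) 0 A)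
    (hA' : IsHomogeneousMatrix (fun i => (a i : UnitAddCircle)) 0 A') (h : A * A' = 1) :
    dualOfMatrix g a r (A * C * A')
      ∈ coadjointOrbit (mk b g a) r (dualOfMatrix g a r C) := by
  rw [← AddCircle.coe_zero] at hA hA'
  let u : GLhat k V :=
    { val := ofLeadMatrix (movedBasis b g) a 0 A
      inv := ofLeadMatrix (movedBasis b g) a 0 A'
      val_inv := by rw [ofLeadMatrix_mul hA hA', h, add_zero, ofLeadMatrix_one]
      inv_val := by rw [ofLeadMatrix_mul hA' hA, mul_eq_one_comm.1 h, add_zero, ofLeadMatrix_one] }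
  have hu : u ∈ (mk b g a).parahoric :=
    mem_parahoric_mk.2 ⟨hasDepth_ofLeadMatrix, hasDepth_ofLeadMatrix⟩
  refine ⟨⟨u, hu⟩, (dualOfMatrix_comp_adGr ⟨u, hu⟩).trans ?_⟩
  congr
  · exact leadMatrix_ofLeadMatrix hA
  · exact leadMatrix_ofLeadMatrix hA'

/-- Conjugate `C` by `t` on the kernel of `Q` and `1` on its image, and let `t` tend to `0`. -/
theorem dualOfMatrix_idempotent_mul_mem_zariskiClosure {Q : Matrix (Fin n) (Fin n) k}
    (hQ : IsHomogeneousMatrix (fun i => (a i : UnitAddCircle)) 0 Q) (hQQ : Q * Q = Q)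
    (hCQ : C * Q = C) : dualOfMatrix g a r (Q * C)
      ∈ zariskiClosure (k := k) (coadjointOrbit (mk b g a) r (dualOfMatrix g a r C)) := by
  let cochar (t : k) : Matrix (Fin n) (Fin n) k := t • 1 + (1 - t) • Q
  have cochar_homogeneous (t : k) :
      IsHomogeneousMatrix (fun i => (a i : UnitAddCircle)) 0 (cochar t) :=
    (IsHomogeneousMatrix.one.smul t).add (hQ.smul _)
  have cochar_mul_inv {t : k} (ht : t ≠ 0) : cochar t * cochar t⁻¹ = 1 := by
    simp only [cochar, add_mul, mul_add, smul_mul_smul_comm, mul_one, one_mul, hQQ,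
      mul_inv_cancel₀ ht]
    match_scalars
    · ring
    · linear_combination -mul_inv_cancel₀ ht
  have conj_eq (t : k) : cochar t * C * cochar t⁻¹ = Q * C + t • (C - Q * C) := by
    have C_mul : C * cochar t⁻¹ = C := by
      simp only [cochar, mul_add, mul_smul_comm, mul_one, hCQ, ← add_smul, add_sub_cancel, one_smul]
    rw [mul_assoc, C_mul, add_mul, smul_mul_assoc, smul_mul_assoc, one_mul, sub_smul, one_smul,
      smul_sub]
    abel
  refine mem_zariskiClosure_of_forall_add_smul_mem (y := dualOfMatrix g a r (C - Q * C))
    fun t ht => ?_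
  rw [← map_smul, ← map_add, ← conj_eq]
  exact dualOfMatrix_mul_mul_mem_coadjointOrbit (cochar_homogeneous t) (cochar_homogeneous t⁻¹)
    (cochar_mul_inv ht)

theorem not_isFundamental_dualOfMatrix
    (hC : IsHomogeneousMatrix (fun i => (a i : UnitAddCircle)) ((-r : ℝ) : UnitAddCircle) C)
    (hnil : IsNilpotent C) : ¬ IsFundamental (mk b g a) r (dualOfMatrix g a r C) := by
  obtain ⟨N, hN⟩ := hnil
  replace hN : C ^ (N + 1) = 0 := by rw [pow_succ, hN, zero_mul]
  induction N generalizing C with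
  | zero =>
    rw [zero_add, pow_one] at hN
    rw [hN, map_zero]
    exact not_isFundamental_zero
  | succ N ih =>
    obtain ⟨Q, hQ, hQQ, hCQ, hker⟩ := hC.exists_idempotent
    have pow_eq (m : ℕ) : (Q * C) ^ (m + 1) = Q * C ^ (m + 1) := by
      induction m with
      | zero => simp
      | succ m ihm => rw [pow_succ', ihm, mul_assoc, ← mul_assoc C, hCQ, ← pow_succ']
    refine fun hfund => ih (zero_add ((-r : ℝ) : UnitAddCircle) ▸ hQ.mul hC) ?_
      (hfund.of_mem_zariskiClosure (dualOfMatrix_idempotent_mul_mem_zariskiClosure hQ hQQ hCQ))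
    rw [pow_eq, hker _ (by rw [← pow_succ', hN])]

variable (g a) in
/-- The matrix of the values of a functional at the endomorphisms with a single monomial entry. -/
def matrixOfDual (r : ℝ) : Module.Dual k ((mk b g a).Gr r) →ₗ[k] Matrix (Fin n) (Fin n) k where
  toFun β := Matrix.of fun i j => β (Submodule.Quotient.mk
    ⟨ofLeadMatrix (movedBasis b g) a r (Matrix.single j i 1),
      mem_glFilt_mk.2 hasDepth_ofLeadMatrix⟩)
  map_add' _ _ := Matrix.ext fun _ _ => rfl
  map_smul' _ _ := Matrix.ext fun _ _ => rfl

theorem matrixOfDual_apply (β : Module.Dual k ((mk b g a).Gr r)) (i j : Fin n) :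
    matrixOfDual g a r β i j = β (Submodule.Quotient.mk
      ⟨ofLeadMatrix (movedBasis b g) a r (Matrix.single j i 1),
        mem_glFilt_mk.2 hasDepth_ofLeadMatrix⟩) := rfl

theorem matrixOfDual_dualOfMatrix
    (hB : IsHomogeneousMatrix (fun i => (a i : UnitAddCircle)) ((-r : ℝ) : UnitAddCircle) B) :
    matrixOfDual (b := b) g a r (dualOfMatrix g a r B) = B := by
  ext i j
  rw [matrixOfDual_apply, dualOfMatrix_mk]
  by_cases hij : B i j = 0
  · rw [hij]
    simp only [Matrix.trace, Matrix.diag_apply, Matrix.mul_apply]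
    refine Finset.sum_eq_zero fun l _ => Finset.sum_eq_zero fun m _ => ?_
    by_cases hml : j = m ∧ i = l
    · rw [← hml.1, ← hml.2, hij, zero_mul]
    · rw [leadMatrix_apply, toMatrix_ofLeadMatrix, Matrix.single_apply, if_neg hml, map_zero,
        map_zero, mul_zero]
  · have single_homogeneous : IsHomogeneousMatrix (fun i => (a i : UnitAddCircle))
        (r : UnitAddCircle) (Matrix.single j i (1 : k)) := by
      intro l m hlm
      obtain ⟨rfl, rfl⟩ : j = l ∧ i = m := by
        by_contra h
        exact hlm (if_neg h)
      rw [hB i j hij, AddCircle.coe_neg, neg_add_cancel_right]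
    rw [leadMatrix_ofLeadMatrix single_homogeneous, Matrix.trace_mul_single, MulOpposite.op_one,
      one_smul]

theorem isFundamental_dualOfMatrix_iff
    (hC : IsHomogeneousMatrix (fun i => (a i : UnitAddCircle)) ((-r : ℝ) : UnitAddCircle) C) :
    IsFundamental (mk b g a) r (dualOfMatrix g a r C) ↔ ¬ IsNilpotent C := by
  refine ⟨fun h hnil => not_isFundamental_dualOfMatrix hC hnil h, fun hnil h0 => hnil ?_⟩
  have charpoly_eq : (matrixOfDual (b := b) g a r 0).charpoly = C.charpoly := by
    refine charpoly_eq_of_mem_zariskiClosure ?_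
      (map_mem_zariskiClosure_image (matrixOfDual g a r) h0)
    rintro _ ⟨_, ⟨h, rfl⟩, rfl⟩
    have conj_homogeneous := ((isHomogeneousMatrix_leadMatrix (e := movedBasis b g) (a := a)
      (r := 0) (X := h.1.1)).mul hC).mul (isHomogeneousMatrix_leadMatrix (e := movedBasis b g)
        (a := a) (r := 0) (X := (h.1⁻¹).1))
    rw [AddCircle.coe_zero, zero_add, add_zero] at conj_homogeneous
    beta_reduce
    rw [dualOfMatrix_comp_adGr, matrixOfDual_dualOfMatrix conj_homogeneous,
      Matrix.charpoly_mul_comm, ← mul_assoc, mul_eq_one_comm.1 (leadMatrix_mul_leadMatrix_inv h),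
      one_mul]
  have cayley_hamilton := Matrix.aeval_self_charpoly C
  rw [← charpoly_eq, map_zero, Matrix.charpoly_zero, map_pow, Polynomial.aeval_X] at cayley_hamilton
  exact ⟨_, cayley_hamilton⟩

end Building

end semistable

/-! ### Transport of connections -/

section transport

open LF

variable {k : Type u} [Field k] {U U' : Type u} [AddCommGroup U] [Module (LF k) U]
  [Module k⟦X⟧ U] [IsScalarTower k⟦X⟧ (LF k) U] [AddCommGroup U'] [Module (LF k) U']
  [Module k⟦X⟧ U'] [IsScalarTower k⟦X⟧ (LF k) U'] (f : U ≃ₗ[LF k] U')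

theorem isLattice_map (L : Submodule k⟦X⟧ U) [Submodule.IsLattice (LF k) L] :
    Submodule.IsLattice (LF k) (L.map (f.toLinearMap.restrictScalars k⟦X⟧)) where
  fg := (Submodule.IsLattice.fg (A := LF k) (M := L)).map _
  span_eq_top := by
    have map_span := Submodule.map_span f.toLinearMap (L : Set U)
    rw [Submodule.IsLattice.span_eq_top, Submodule.map_top, LinearEquiv.range] at map_span
    exact map_span.symm

namespace FlatConn

variable {f} {D : FlatConn k U} {D' : FlatConn k U'}

theorem RegularSingular.map (h : ∀ u, f (D.op u) = D'.op (f u)) (hD : D.RegularSingular) :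
    D'.RegularSingular := by
  obtain ⟨L, hL, hst⟩ := hD
  refine ⟨_, isLattice_map f L, ?_⟩
  rintro _ ⟨u, hu, rfl⟩
  exact ⟨_, hst u hu, h u⟩

theorem regularSingular_congr (h : ∀ u, f (D.op u) = D'.op (f u)) :
    D.RegularSingular ↔ D'.RegularSingular := by
  refine ⟨fun hD => hD.map h, fun hD => hD.map (f := f.symm) fun u => ?_⟩
  rw [LinearEquiv.symm_apply_eq, h, LinearEquiv.apply_symm_apply]

theorem GrowthRate.comap {r : ℝ} (h : ∀ u, f (D.op u) = D'.op (f u)) (hD : D'.GrowthRate r) :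
    D.GrowthRate r := by
  intro L hL n e
  obtain ⟨v, C, hv⟩ := hD _ (isLattice_map f L) n (e.map f)
  refine ⟨v, C, fun i hi => ⟨?_, (hv i hi).2⟩⟩
  have iterate_comm (u : U) : f (D.op^[i] u) = D'.op^[i] (f u) :=
    (Function.Semiconj.iterate_right (f := f) h i) u
  have mem_map_iff (u : U) : f u ∈ L.map (f.toLinearMap.restrictScalars k⟦X⟧) ↔ u ∈ L :=
    f.injective.mem_set_image
  simpa only [Module.Basis.map_apply, ← iterate_comm, ← map_smul, mem_map_iff] using (hv i hi).1

end FlatConn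

end transport

/-! ### Base change of differentials of representations -/

section basechange

namespace AlgRep

variable {k V W : Type u} [Field k] [AddCommGroup V] [Module k V] [AddCommGroup W] [Module k W]
  {R S : Type u} [CommRing R] [Algebra k R] [CommRing S] [Algebra k S] (f : R →ₐ[k] S)

theorem diff_std (X : Module.End R (R ⊗[k] V)) : (std k V).diff X = X :=
  oneAddEps_injective (act_oneAddEps (std k V) X).symm

/-- The map of dual numbers induced by a `k`-algebra homomorphism. -/
def dualNumberMap : DualNumber R →ₐ[k] DualNumber S :=
  AlgHom.ofLinearMap
    (inl S ∘ₗ f.toLinearMap ∘ₗ (fst R).toLinearMap + inr S ∘ₗ f.toLinearMap ∘ₗ snd R)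
    (by ext <;> simp [inl, inr, fst, snd])
    (fun x y => by ext <;> simp [inl, inr, fst, snd, mul_comm])

theorem bc_dualNumberMap_inl (x : R ⊗[k] V) :
    bc V (dualNumberMap f).toLinearMap (bc V (inl R) x) = bc V (inl S) (bc V f.toLinearMap x) := by
  simp only [bc, ← LinearMap.rTensor_comp_apply]
  congr 2
  refine LinearMap.ext fun r => ?_
  ext <;> simp [dualNumberMap, inl, inr, fst, snd]

theorem bc_dualNumberMap_inr (x : R ⊗[k] V) :
    bc V (dualNumberMap f).toLinearMap (bc V (inr R) x) = bc V (inr S) (bc V f.toLinearMap x) := by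
  simp only [bc, ← LinearMap.rTensor_comp_apply]
  congr 2
  refine LinearMap.ext fun r => ?_
  ext <;> simp [dualNumberMap, inl, inr, fst, snd]

theorem bc_snd_dualNumberMap (x : DualNumber R ⊗[k] V) :
    bc V (snd S) (bc V (dualNumberMap f).toLinearMap x) = bc V f.toLinearMap (bc V (snd R) x) := by
  simp only [bc, ← LinearMap.rTensor_comp_apply]
  congr 2
  refine LinearMap.ext fun r => ?_
  simp [dualNumberMap, inl, inr, fst, snd]

theorem diff_bcEnd (ρ : AlgRep k V W) (X : Module.End R (R ⊗[k] V)) (w : R ⊗[k] W) :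
    ρ.diff (bcEnd f X) (bc W f.toLinearMap w) = bc W f.toLinearMap (ρ.diff X w) := by
  rw [← bc_snd_act, ← bc_snd_act, ← bc_dualNumberMap_inl, ← bc_snd_dualNumberMap]
  congr 1
  refine ρ.natural _ _ (dualNumberMap f) (oneAddEps X) (oneAddEps (bcEnd f X)) (fun v => ?_) _
  rw [decomp v]
  simp only [map_add, bc_dualNumberMap_inl, bc_dualNumberMap_inr, oneAddEps_inl, oneAddEps_inr,
    bcEnd_bc]

theorem bc_basis_baseChange {ι : Type*} (b : Module.Basis ι k V) (i : ι) :
    bc V f.toLinearMap (b.baseChange R i) = b.baseChange S i := by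
  simp

end AlgRep

variable {k V : Type u} [Field k] [AddCommGroup V] [Module k V]

/-- The inclusion `k⟦z⟧ → F`, as a homomorphism of `k`-algebras. -/
def LF.ofPowerSeries (k : Type u) [Field k] : k⟦X⟧ →ₐ[k] LF k :=
  { algebraMap k⟦X⟧ (LF k) with
    commutes' := HahnSeries.ofPowerSeries_C }

theorem bc_ofPowerSeries_mem_weightedFilt {ι : Type*} (b : Module.Basis ι k V) (x : k⟦X⟧ ⊗[k] V) :
    bc V (LF.ofPowerSeries k).toLinearMap x ∈ weightedFilt (b.baseChange (LF k)) 0 0 := by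
  induction x with
  | zero => rw [map_zero]; exact zero_mem _
  | add x y hx hy => rw [map_add]; exact add_mem hx hy
  | tmul p v =>
    intro i
    rw [bc, LinearMap.rTensor_tmul, Module.Basis.baseChange_repr_tmul, Pi.zero_apply, sub_zero]
    exact (LF.OrdGE.powerSeries p).smul _

theorem HasDepth.exists_eq_bcEnd {ι : Type*} [Fintype ι] [DecidableEq ι] {b : Module.Basis ι k V}
    {X : Module.End (LF k) (LF k ⊗[k] V)} (hX : HasDepth (b.baseChange (LF k)) 0 0 X) :
    ∃ Y : Module.End k⟦X⟧ (k⟦X⟧ ⊗[k] V), X = AlgRep.bcEnd (LF.ofPowerSeries k) Y := by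
  have hX' (i j : ι) : LF.OrdGE
      (LinearMap.toMatrix (b.baseChange (LF k)) (b.baseChange (LF k)) X i j) 0 := by
    simpa using hX i j
  choose A hA using fun i j => (hX' i j).exists_powerSeries
  refine ⟨Matrix.toLin (b.baseChange k⟦X⟧) (b.baseChange k⟦X⟧) (Matrix.of A),
    (b.baseChange (LF k)).ext fun j => ?_⟩
  conv_rhs =>
    rw [← AlgRep.bc_basis_baseChange (LF.ofPowerSeries k), AlgRep.bcEnd_bc, Matrix.toLin_self,
      map_sum]
  rw [← (b.baseChange (LF k)).sum_repr (X _)]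
  refine Finset.sum_congr rfl fun i _ => ?_
  rw [AlgRep.bc_algHom_smul, AlgRep.bc_basis_baseChange, ← LinearMap.toMatrix_apply, ← hA]
  rfl

theorem tauHat_one_tmul (v : V) : tauHat V ((1 : LF k) ⊗ₜ[k] v) = 0 := by
  rw [tauHat, bc, LinearMap.rTensor_tmul, LF.tau_one, TensorProduct.zero_tmul]

theorem tauHat_basis_baseChange {ι : Type*} (b : Module.Basis ι k V) (i : ι) :
    tauHat V (b.baseChange (LF k) i) = 0 := by
  rw [Module.Basis.baseChange_apply, tauHat_one_tmul]

end basechange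

/-! ### Flat bundles in a trivialization -/

namespace FlatGLBundle

open LF

variable {k V W : Type u} [Field k] [AddCommGroup V] [Module k V] [AddCommGroup W] [Module k W]
  (P : FlatGLBundle k V) (ρ : AlgRep k V W) (φ : P.Triv)

/-- The connection `d + ρ([∇]_φ)` on `F ⊗ W`. -/
def connAt : FlatConn k (LF k ⊗[k] W) where
  op := (tauHat W).toAddMonoidHom + (ρ.diff (P.conn φ)).toAddMonoidHom
  leibniz f u := by
    change tauHat W (f • u) + ρ.diff (P.conn φ) (f • u)
      = LF.tau f • u + f • (tauHat W u + ρ.diff (P.conn φ) u)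
    rw [tauHat_smul, map_smul, smul_add]
    abel

theorem connAt_apply (u : LF k ⊗[k] W) :
    (P.connAt ρ φ).op u = tauHat W u + ρ.diff (P.conn φ) u := rfl

theorem evalAt_bijective : Function.Bijective fun s : P.assocSpace ρ => s.1 φ := by
  constructor
  · intro s t h
    refine Subtype.ext (funext fun ψ => ?_)
    obtain ⟨g, rfl, -⟩ := P.simply_transitive φ ψ
    rw [s.2, t.2]
    exact congrArg _ h
  · intro w
    choose g hg hunique using fun ψ => P.simply_transitive φ ψ
    have map_smul_triv (h : GLhat k V) (ψ : P.Triv) : g (h • ψ) = h * g ψ := by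
      refine (hunique _ _ ?_).symm
      change (h * g ψ) • φ = h • ψ
      rw [mul_smul]
      exact congrArg (h • ·) (hg ψ)
    refine ⟨⟨fun ψ => (ρ.act (LF k) (g ψ)).1 w, fun h ψ => ?_⟩, ?_⟩
    · beta_reduce
      rw [map_smul_triv, map_mul]
      rfl
    · change (ρ.act (LF k) (g φ)).1 w = w
      rw [← hunique φ 1 (one_smul _ _), map_one]
      rfl

/-- Evaluation of a section in the trivialization `φ`. -/
def evalAt : P.assocSpace ρ ≃ₗ[LF k] LF k ⊗[k] W :=
  LinearEquiv.ofBijective ((LinearMap.proj φ).comp (P.assocSpace ρ).subtype)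
    (P.evalAt_bijective ρ φ)

theorem evalAt_op (s : P.assocSpace ρ) :
    P.evalAt ρ φ ((P.assoc ρ).op s) = (P.connAt ρ φ).op (P.evalAt ρ φ s) := rfl

theorem assoc_regularSingular_iff :
    (P.assoc ρ).RegularSingular ↔ (P.connAt ρ φ).RegularSingular :=
  FlatConn.regularSingular_congr (P.evalAt_op ρ φ)

variable {φ}

theorem connAt_std (u : LF k ⊗[k] V) :
    (P.connAt (AlgRep.std k V) φ).op u = tauHat V u + P.conn φ u := by
  rw [connAt_apply, AlgRep.diff_std]

theorem connAt_std_smul (g : GLhat k V) (u : LF k ⊗[k] V) :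
    (P.connAt (AlgRep.std k V) (g • φ)).op (g.1 u)
      = g.1 ((P.connAt (AlgRep.std k V) φ).op u) :=
  P.assoc_equivariant (AlgRep.std k V) g φ u

theorem regularSingular_of_hasDepth {ι : Type*} [Fintype ι] [DecidableEq ι]
    {b : Module.Basis ι k V} (h : HasDepth (b.baseChange (LF k)) 0 0 (P.conn φ)) :
    P.RegularSingular := by
  intro W _ _ _ ρ
  obtain ⟨X, hX⟩ := h.exists_eq_bcEnd
  rw [P.assoc_regularSingular_iff ρ φ]
  refine (P.connAt ρ φ).regularSingular_of_basis
    (e := (Module.finBasis k W).baseChange (LF k)) fun j => ?_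
  rw [connAt_apply, tauHat_basis_baseChange, zero_add, hX,
    ← AlgRep.bc_basis_baseChange (ofPowerSeries k), AlgRep.diff_bcEnd]
  exact bc_ofPowerSeries_mem_weightedFilt _ _

end FlatGLBundle

/-! ### Contained strata -/

section lattices

open LF

variable {k : Type u} [Field k] {U : Type u} [AddCommGroup U] [Module (LF k) U] [Module k⟦X⟧ U]
  [IsScalarTower k⟦X⟧ (LF k) U]

theorem const_smul_mem_submodule [Module k U] [IsScalarTower k (LF k) U] (c : k)
    {L : Submodule k⟦X⟧ U} {u : U} (hu : u ∈ L) : c • u ∈ L := by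
  rw [← algebraMap_smul (LF k) c]
  exact (OrdGE.const c le_rfl).smul_mem hu

end lattices

namespace FlatGLBundle

open LF Building

variable {k V : Type u} [Field k] [AddCommGroup V] [Module k V]
  {n : ℕ} {b : Module.Basis (Fin n) k V}

section slope

variable [CharZero k] [FiniteDimensional k V] [Algebra ℝ k] {P : FlatGLBundle k V} {φ : P.Triv}
  {r : ℝ}

theorem ContainsStratum.exists_leadMatrix_eq {g : GLhat k V} {a : Fin n → ℝ}
    {β : Module.Dual k ((Building.mk b g a).Gr r)}
    (h : P.ContainsStratum φ (Building.mk b g a) r β) :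
    ∃ X, HasDepth (movedBasis b g) a (-r) X ∧
      β = dualOfMatrix g a r (leadMatrix (movedBasis b g) a (-r) X) ∧
      ∀ s, ∀ u ∈ weightedFilt (movedBasis b g) a s,
        (P.connAt (AlgRep.std k V) φ).op u - X u - algebraMap ℝ k s • u
          ∈ weightedFiltPlus (movedBasis b g) a (s - r) := by
  obtain ⟨X, hX, hsub⟩ := h
  obtain ⟨hX_depth, hβ⟩ := isRepresentative_mk_iff.1 hX
  refine ⟨X, hX_depth, hβ, fun s u hu => ?_⟩
  have := hsub V (AlgRep.std k V) s u (by rwa [filt_mk_std])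
  rwa [filtPlus_mk_std, AlgRep.diff_std X, sub_right_comm] at this

theorem regularSingular_or_growthRate_of_containsStratum {x : Building b}
    {β : Module.Dual k (x.Gr r)} (hr : 0 ≤ r) (hβ : IsFundamental x r β)
    (h : P.ContainsStratum φ x r β) :
    (r = 0 ∧ (P.assoc (AlgRep.std k V)).RegularSingular) ∨
      (0 < r ∧ (P.assoc (AlgRep.std k V)).GrowthRate r) := by
  obtain ⟨g, a, rfl⟩ := exists_eq_mk b x
  obtain ⟨X, hX, rfl, hsub⟩ := h.exists_leadMatrix_eq
  rcases hr.eq_or_lt with rfl | hr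
  · refine Or.inl ⟨rfl, ?_⟩
    rw [P.assoc_regularSingular_iff _ φ]
    refine FlatConn.LowersDepthBy.regularSingular (e := movedBasis b g) (a := a) fun s u hu => ?_
    obtain ⟨t, ht, hmem⟩ := mem_weightedFiltPlus.1 (hsub s u hu)
    rw [← sub_add_cancel ((P.connAt _ φ).op u) (X u),
      ← sub_add_cancel (_ - X u) (algebraMap ℝ k s • u)]
    refine add_mem (add_mem (weightedFilt_anti ht.le hmem) ?_) ?_
    · rw [sub_zero]
      exact const_smul_mem_submodule _ hu
    · simpa only [neg_zero, add_zero, sub_zero] using hX.map_mem hu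
  · refine Or.inr ⟨hr, ?_⟩
    have leading : (P.connAt (AlgRep.std k V) φ).HasLeadingTerm (movedBasis b g) a r X :=
      ⟨hX, fun s u hu => by
        rw [← sub_add_cancel (_ - X u) (algebraMap ℝ k s • u)]
        exact add_mem (hsub s u hu)
          (weightedFilt_le_plus (by linarith) (const_smul_mem_submodule _ hu))⟩
    exact (leading.growthRate hr
      ((isFundamental_dualOfMatrix_iff isHomogeneousMatrix_leadMatrix).1 hβ)).comap
        (P.evalAt_op _ φ)

end slope

section stdFilt

variable {W : Type u} [AddCommGroup W] [Module k W] {ρ : AlgRep k V W} {a : Fin n → ℝ} {r s : ℝ}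
  {w : LF k ⊗[k] W}

theorem tauHat_zpow_tmul (m : ℤ) (w : W) :
    tauHat W ((zpow m : LF k) ⊗ₜ[k] w) = (m : k) • ((zpow m : LF k) ⊗ₜ[k] w) := by
  rw [tauHat, bc, LinearMap.rTensor_tmul, tau_zpow, TensorProduct.smul_tmul']

theorem tauHat_powerSeries_smul (p : k⟦X⟧) (w : LF k ⊗[k] W) :
    tauHat W (p • w) = tau (algebraMap k⟦X⟧ (LF k) p) • w + p • tauHat W w := by
  rw [← algebraMap_powerSeries_smul p w, tauHat_smul,
    algebraMap_powerSeries_smul p (tauHat W w)]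

theorem tauHat_mem_stdFilt (hw : w ∈ stdFilt b ρ a s) : tauHat W w ∈ stdFilt b ρ a s := by
  induction hw using Submodule.span_induction with
  | mem y hy =>
    obtain ⟨χ, m, hm, w, hw, rfl⟩ := hy
    rw [tauHat_zpow_tmul]
    exact const_smul_mem_submodule _ (Submodule.subset_span ⟨χ, m, hm, w, hw, rfl⟩)
  | zero => rw [map_zero]; exact zero_mem _
  | add x y _ _ hx hy => rw [map_add]; exact add_mem hx hy
  | smul p y hy h =>
    rw [tauHat_powerSeries_smul]
    exact add_mem ((OrdGE.powerSeries p).tau.smul_mem hy) (Submodule.smul_mem _ _ h)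

theorem zpow_smul_mem_stdFilt (m : ℤ) (hw : w ∈ stdFilt b ρ a s) :
    (zpow m : LF k) • w ∈ stdFilt b ρ a (s + m) := by
  induction hw using Submodule.span_induction with
  | mem y hy =>
    obtain ⟨χ, l, hl, w, hw, rfl⟩ := hy
    rw [TensorProduct.smul_tmul', smul_eq_mul, zpow_mul_zpow]
    exact Submodule.subset_span ⟨χ, m + l, by push_cast; linarith, w, hw, rfl⟩
  | zero => rw [smul_zero]; exact zero_mem _
  | add x y _ _ hx hy => rw [smul_add]; exact add_mem hx hy
  | smul p y hy h => rw [smul_comm]; exact Submodule.smul_mem _ _ h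

theorem smul_mem_stdFilt {f : LF k} {m : ℤ} (hf : OrdGE f m) (hw : w ∈ stdFilt b ρ a s) :
    f • w ∈ stdFilt b ρ a (s + m) := by
  obtain ⟨p, rfl⟩ := hf.exists_eq_zpow_mul
  rw [mul_smul, algebraMap_powerSeries_smul]
  exact zpow_smul_mem_stdFilt m (Submodule.smul_mem _ p hw)

variable [FiniteDimensional k W]

theorem filt_mk_one : (Building.mk b 1 a).filt ρ s = stdFilt b ρ a s := by
  change (stdFilt b ρ a s).map ((ρ.act (LF k) 1).1.restrictScalars k⟦X⟧) = _
  rw [map_one]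
  exact Submodule.map_id _

theorem stdFilt_le_filtPlus_mk_one {t : ℝ} (h : s < t) :
    stdFilt b ρ a t ≤ (Building.mk b 1 a).filtPlus ρ s := by
  rw [← filt_mk_one]
  exact le_iSup (fun t : {t : ℝ // s < t} => (Building.mk b 1 a).filt ρ t) ⟨t, h⟩

variable [Algebra ℝ k]

theorem tauHat_sub_smul_mem_filtPlus_origin (hw : w ∈ stdFilt b ρ 0 s) :
    tauHat W w - algebraMap ℝ k s • w ∈ (Building.mk b 1 0).filtPlus ρ s := by
  induction hw using Submodule.span_induction with
  | mem y hy =>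
    obtain ⟨χ, m, hm, w, hw, rfl⟩ := hy
    have hm : s ≤ m := by simpa using hm
    have eigenvector : tauHat W ((zpow m : LF k) ⊗ₜ[k] w)
          - algebraMap ℝ k s • ((zpow m : LF k) ⊗ₜ[k] w)
        = algebraMap ℝ k (m - s) • ((zpow m : LF k) ⊗ₜ[k] w) := by
      rw [tauHat_zpow_tmul, map_sub, map_intCast]
      exact (sub_smul (m : k) (algebraMap ℝ k s) ((zpow m : LF k) ⊗ₜ[k] w)).symm
    rw [eigenvector]
    rcases hm.eq_or_lt with h | h
    · rw [h, sub_self, map_zero, zero_smul]; exact zero_mem _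
    · exact stdFilt_le_filtPlus_mk_one h <| const_smul_mem_submodule _ <|
        Submodule.subset_span ⟨χ, m, by simp, w, hw, rfl⟩
  | zero => rw [map_zero, smul_zero, sub_zero]; exact zero_mem _
  | add x y _ _ hx hy =>
    rw [map_add, smul_add, add_sub_add_comm]
    exact add_mem hx hy
  | smul p y hy h =>
    have leibniz : tauHat W (p • y) - algebraMap ℝ k s • p • y
        = tau (algebraMap k⟦X⟧ (LF k) p) • y + p • (tauHat W y - algebraMap ℝ k s • y) := by
      rw [tauHat_powerSeries_smul, smul_comm, smul_sub, add_sub_assoc]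
    rw [leibniz]
    refine add_mem (stdFilt_le_filtPlus_mk_one (t := s + (1 : ℤ)) (by simp) ?_)
      (Submodule.smul_mem _ p h)
    exact smul_mem_stdFilt (by simpa using (OrdGE.powerSeries p).tau_ordGE_one) hy

theorem tauHat_sub_smul_mem_filtPlus (hr : 0 < r ∨ r = 0 ∧ a = 0) (hw : w ∈ stdFilt b ρ a s) :
    tauHat W w - algebraMap ℝ k s • w ∈ (Building.mk b 1 a).filtPlus ρ (s - r) := by
  rcases hr with hr | ⟨rfl, rfl⟩
  · exact stdFilt_le_filtPlus_mk_one (by linarith)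
      (sub_mem (tauHat_mem_stdFilt hw) (const_smul_mem_submodule _ hw))
  · rw [sub_zero]
    exact tauHat_sub_smul_mem_filtPlus_origin hw

end stdFilt

theorem movedBasis_one : movedBasis b (1 : GLhat k V) = b.baseChange (LF k) :=
  Module.Basis.eq_of_apply_eq fun j => by
    rw [movedBasis_apply, Module.Basis.baseChange_apply]
    rfl

theorem hasSlope_of_not_isNilpotent_leadMatrix [CharZero k] [FiniteDimensional k V]
    [Algebra ℝ k] {P : FlatGLBundle k V} {φ : P.Triv} {a : Fin n → ℝ} {r : ℝ}
    (hr : 0 < r ∨ r = 0 ∧ a = 0)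
    (hX : HasDepth (b.baseChange (LF k)) a (-r) (P.conn φ))
    (hnil : ¬ IsNilpotent (leadMatrix (b.baseChange (LF k)) a (-r) (P.conn φ))) :
    P.HasSlope b r := by
  rw [← movedBasis_one] at hX hnil
  refine ⟨by rcases hr with h | ⟨h, -⟩ <;> linarith, φ, Building.mk b 1 a, _,
    (isFundamental_dualOfMatrix_iff isHomogeneousMatrix_leadMatrix).2 hnil,
    P.conn φ, isRepresentative_mk_iff.2 ⟨hX, rfl⟩, fun W _ _ _ ρ s w hw => ?_⟩
  rw [filt_mk_one] at hw
  rw [add_sub_right_comm, add_sub_cancel_right]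
  exact tauHat_sub_smul_mem_filtPlus hr hw

end FlatGLBundle

/-! ### Companion matrices and Newton slopes -/

section companion

open LF

/-- The companion matrix of `x ^ n - ∑ i, c i * x ^ i`: it maps each basis vector except the last
to the next one, and the last one to `c`. -/
def companionMatrix {R : Type*} [Zero R] [One R] {n : ℕ} (c : Fin n → R) :
    Matrix (Fin n) (Fin n) R :=
  Matrix.of fun i j => if (j : ℕ) + 1 < n then (if (i : ℕ) = j + 1 then 1 else 0) else c i

theorem companionMatrix_apply {R : Type*} [Zero R] [One R] {n : ℕ} (c : Fin n → R) (i j : Fin n) :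
    companionMatrix c i j
      = if (j : ℕ) + 1 < n then (if (i : ℕ) = j + 1 then 1 else 0) else c i := rfl

theorem companionMatrix_mulVec_single {R : Type*} [NonAssocSemiring R] {n : ℕ} (c : Fin n → R)
    (j : Fin n) : (companionMatrix c).mulVec (Pi.single j 1)
      = if h : (j : ℕ) + 1 < n then Pi.single ⟨j + 1, h⟩ 1 else c := by
  ext i
  rw [Matrix.mulVec_single_one, Matrix.col_apply, companionMatrix_apply]
  split_ifs with h hi
  · rw [show i = ⟨j + 1, h⟩ from Fin.ext hi, Pi.single_eq_same]
  · rw [Pi.single_eq_of_ne fun hij => hi (congrArg Fin.val hij)]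
  · rfl

theorem companionMatrix_pow_mulVec_single_zero {R : Type*} [Semiring R] {m : ℕ}
    (c : Fin (m + 1) → R) (j : Fin (m + 1)) :
    (companionMatrix c ^ (j : ℕ)).mulVec (Pi.single 0 1) = Pi.single j 1 := by
  induction j using Fin.induction with
  | zero => rw [Fin.val_zero, pow_zero, Matrix.one_mulVec]
  | succ j ih =>
    rw [Fin.val_castSucc] at ih
    rw [Fin.val_succ, pow_succ', ← Matrix.mulVec_mulVec, ih, companionMatrix_mulVec_single,
      dif_pos (by simp)]
    rfl

theorem companionMatrix_pow_mulVec_single_zero_eq {R : Type*} [Semiring R] {m : ℕ}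
    (c : Fin (m + 1) → R) :
    (companionMatrix c ^ (m + 1)).mulVec (Pi.single 0 1) = c := by
  have h := companionMatrix_pow_mulVec_single_zero c (Fin.last m)
  rw [Fin.val_last] at h
  rw [pow_succ', ← Matrix.mulVec_mulVec, h, companionMatrix_mulVec_single, dif_neg (by simp)]

theorem not_isNilpotent_companionMatrix {R : Type*} [CommRing R] [IsDomain R] {n : ℕ}
    {c : Fin n → R} (hc : c ≠ 0) : ¬ IsNilpotent (companionMatrix c) := fun hnil => by
  cases n with
  | zero => exact hc (Subsingleton.elim _ _)
  | succ m =>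
    have charpoly_eq : (companionMatrix c).charpoly = Polynomial.X ^ (m + 1) := by
      have h := (Matrix.isNilpotent_charpoly_sub_pow_of_isNilpotent hnil).eq_zero
      rwa [Fintype.card_fin, sub_eq_zero] at h
    have pow_eq_zero : companionMatrix c ^ (m + 1) = 0 := by
      have cayley_hamilton := (companionMatrix c).aeval_self_charpoly
      rwa [charpoly_eq, map_pow, Polynomial.aeval_X] at cayley_hamilton
    rw [← companionMatrix_pow_mulVec_single_zero_eq c, pow_eq_zero, Matrix.zero_mulVec] at hc
    exact hc rfl

theorem exists_toMatrix_eq_companionMatrix {R M : Type*} [CommRing R] [AddCommGroup M]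
    [Module R M] {n : ℕ} {e : Module.Basis (Fin n) R M} {X : Module.End R M}
    (h : ∀ (j : Fin n) (hj : (j : ℕ) + 1 < n), X (e j) = e ⟨j + 1, hj⟩) :
    ∃ c, LinearMap.toMatrix e e X = companionMatrix c := by
  refine ⟨fun i => LinearMap.toMatrix e e X i ⟨n - 1, by have := i.2; omega⟩, ?_⟩
  ext i j
  rw [companionMatrix_apply]
  split_ifs with hj hi
  · rw [LinearMap.toMatrix_apply, h j hj, show i = ⟨j + 1, hj⟩ from Fin.ext hi,
      Module.Basis.repr_self, Finsupp.single_eq_same]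
  · rw [LinearMap.toMatrix_apply, h j hj, Module.Basis.repr_self,
      Finsupp.single_eq_of_ne fun hij => hi (congrArg Fin.val hij)]
  · rw [show j = ⟨n - 1, by have := j.2; omega⟩ from Fin.ext (by have := j.2; simp only; omega)]

variable {k : Type u} [Field k] {n : ℕ}

theorem exists_newton_slope (c : Fin n → LF k) :
    ∃ q : ℚ, 0 ≤ q ∧ (∀ j : Fin n, OrdGE (c j) (-(q * ((n : ℝ) - j)))) ∧
      (q = 0 ∨ ∃ j : Fin n, rcoeff (-(q * ((n : ℝ) - j))) (c j) ≠ 0) := by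
  have sub_pos (j : Fin n) : (0 : ℚ) < (n : ℚ) - j := sub_pos.2 (by exact_mod_cast j.2)
  choose order hcoeff hord using fun j : {j : Fin n // c j ≠ 0} =>
    exists_coeff_ne_zero_and_ordGE j.2
  let slope : Option {j : Fin n // c j ≠ 0} → ℚ := fun x =>
    x.elim 0 fun j => -(order j : ℚ) / ((n : ℚ) - (j : Fin n))
  obtain ⟨x, hx⟩ := Finite.exists_max slope
  refine ⟨slope x, hx none, fun j => ?_, ?_⟩
  · by_cases hj : c j = 0
    · rw [hj]
      exact OrdGE.zero _
    · have slope_le : -(order ⟨j, hj⟩ : ℚ) ≤ slope x * ((n : ℚ) - j) :=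
        (div_le_iff₀ (sub_pos j)).1 (hx (some ⟨j, hj⟩))
      have slope_le' : -(order ⟨j, hj⟩ : ℝ) ≤ slope x * ((n : ℝ) - j) := by
        exact_mod_cast slope_le
      exact (hord ⟨j, hj⟩).mono (by linarith)
  · refine x.rec (Or.inl rfl) fun j => Or.inr ⟨j, ?_⟩
    have slope_mul : slope (some j) * ((n : ℚ) - (j : Fin n)) = -(order j : ℚ) :=
      div_mul_cancel₀ _ (sub_pos j).ne'
    have slope_mul' : (slope (some j) : ℝ) * ((n : ℝ) - (j : Fin n)) = -(order j : ℝ) := by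
      exact_mod_cast slope_mul
    rw [slope_mul', neg_neg, rcoeff_intCast]
    exact hcoeff j

variable {U : Type u} [AddCommGroup U] [Module (LF k) U] {e : Module.Basis (Fin n) (LF k) U}
  {X : Module.End (LF k) U} {c : Fin n → LF k}

theorem hasDepth_of_toMatrix_eq_companionMatrix {q : ℝ}
    (hX : LinearMap.toMatrix e e X = companionMatrix c)
    (hc : ∀ j : Fin n, OrdGE (c j) (-(q * ((n : ℝ) - j)))) :
    HasDepth e (fun j => -(q * j)) (-q) X := fun i j => by
  rw [hX, companionMatrix_apply]
  beta_reduce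
  split_ifs with hj hij
  · have hij : ((i : ℕ) : ℝ) = j + 1 := by exact_mod_cast hij
    exact OrdGE.one (by rw [hij]; linarith)
  · exact OrdGE.zero _
  · have hj : (n : ℝ) = j + 1 := by exact_mod_cast (by omega : n = (j : ℕ) + 1)
    exact (hc i).mono (by rw [hj]; linarith)

theorem leadMatrix_eq_companionMatrix (q : ℝ)
    (hX : LinearMap.toMatrix e e X = companionMatrix c) :
    leadMatrix e (fun j => -(q * j)) (-q) X
      = companionMatrix fun i => rcoeff (-(q * ((n : ℝ) - i))) (c i) := by
  ext i j
  rw [leadMatrix_apply, hX, companionMatrix_apply, companionMatrix_apply]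
  split_ifs with hj hij
  · have hij : ((i : ℕ) : ℝ) = j + 1 := by exact_mod_cast hij
    rw [hij, show -q - -(q * (j + 1)) + -(q * j) = ((0 : ℤ) : ℝ) by push_cast; ring,
      rcoeff_intCast, ← LF.zpow_zero, coeff_zpow, if_pos rfl]
  · exact map_zero _
  · have hj : (n : ℝ) = j + 1 := by exact_mod_cast (by omega : n = (j : ℕ) + 1)
    rw [hj]
    congr 1
    ring_nf

end companion

/-! ### Existence of fundamental strata -/

namespace FlatGLBundle

open LF

variable {k V : Type u} [Field k] [AddCommGroup V] [Module k V] (P : FlatGLBundle k V)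

/-- The scalar matrix `z ^ m` in `GL(F ⊗ V)`. -/
def zpowGL (k V : Type u) [Field k] [AddCommGroup V] [Module k V] (m : ℤ) : GLhat k V :=
  Units.map (algebraMap (LF k) (Module.End (LF k) (LF k ⊗[k] V))).toMonoidHom
    (Units.mk0 (zpow m) (LF.zpow_ne_zero m))

theorem zpowGL_apply (m : ℤ) (u : LF k ⊗[k] V) : (zpowGL k V m).1 u = (zpow m : LF k) • u := rfl

theorem conn_zpowGL_neg_smul (φ : P.Triv) (m : ℤ) :
    P.conn (zpowGL k V (-m) • φ) = P.conn φ + m • 1 := by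
  refine LinearMap.ext fun u => ?_
  have gauge := P.connAt_std_smul (φ := φ) (zpowGL k V (-m)) u
  rw [zpowGL_apply, zpowGL_apply, FlatConn.leibniz, connAt_std, connAt_std, tau_zpow,
    Int.cast_smul_eq_zsmul, smul_assoc, smul_comm (-m), ← smul_add] at gauge
  have shift := smul_right_injective _ (LF.zpow_ne_zero (-m)) gauge
  rw [add_left_comm, add_right_inj, neg_smul, neg_add_eq_iff_eq_add, add_comm] at shift
  exact shift

section exists_slope

variable [CharZero k] [FiniteDimensional k V] {n : ℕ} (b : Module.Basis (Fin n) k V)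

theorem exists_toMatrix_conn_eq_companionMatrix : ∃ (φ : P.Triv) (c : Fin n → LF k),
    LinearMap.toMatrix (b.baseChange (LF k)) (b.baseChange (LF k)) (P.conn φ)
      = companionMatrix c := by
  obtain ⟨φ⟩ := P.nonempty
  let e₀ := b.baseChange (LF k)
  obtain ⟨u, e, cyclic⟩ := (P.connAt (AlgRep.std k V) φ).exists_cyclic_basis
    ((Module.finrank_eq_card_basis e₀).trans (Fintype.card_fin n))
  let g : GLhat k V := LinearMap.GeneralLinearGroup.ofLinearEquiv (e.equiv e₀ (Equiv.refl _))
  have g_apply (j : Fin n) : g.1 (e j) = e₀ j := e.equiv_apply j e₀ (Equiv.refl _)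
  refine ⟨g • φ, exists_toMatrix_eq_companionMatrix fun j hj => ?_⟩
  have gauge := P.connAt_std_smul (φ := φ) g (e j)
  rw [g_apply, connAt_std, tauHat_basis_baseChange, zero_add] at gauge
  rw [gauge, ← g_apply, cyclic, cyclic]
  exact congrArg g.1 (Function.iterate_succ_apply' _ _ _).symm

variable {P b} [Algebra ℝ k]

theorem hasSlope_zero_of_hasDepth [Nontrivial V] {φ : P.Triv}
    (hX : HasDepth (b.baseChange (LF k)) 0 0 (P.conn φ)) : P.HasSlope b 0 := by
  by_cases hnil : IsNilpotent (leadMatrix (b.baseChange (LF k)) 0 0 (P.conn φ))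
  · have : Nonempty (Fin n) := b.index_nonempty
    have conn_shift : P.conn (zpowGL k V (-1) • φ) = P.conn φ + 1 := by
      rw [conn_zpowGL_neg_smul, one_zsmul]
    refine hasSlope_of_not_isNilpotent_leadMatrix (φ := zpowGL k V (-1) • φ) (Or.inr ⟨rfl, rfl⟩)
      ?_ ?_ <;> rw [neg_zero, conn_shift]
    · exact hX.add HasDepth.one
    · rw [leadMatrix_add, leadMatrix_one]
      exact hnil.isUnit_add_one.not_isNilpotent
  · exact hasSlope_of_not_isNilpotent_leadMatrix (Or.inr ⟨rfl, rfl⟩) (by rwa [neg_zero])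
      (by rwa [neg_zero])

variable (P b)

theorem exists_rat_hasSlope [Nontrivial V] :
    ∃ q : ℚ, P.HasSlope b q ∧ (q = 0 → P.RegularSingular) := by
  obtain ⟨φ, c, hc⟩ := P.exists_toMatrix_conn_eq_companionMatrix b
  obtain ⟨q, hq, hord, hlead⟩ := exists_newton_slope c
  have hX := hasDepth_of_toMatrix_eq_companionMatrix hc hord
  rcases hq.eq_or_lt with rfl | hq_pos
  · have hX₀ : HasDepth (b.baseChange (LF k)) 0 0 (P.conn φ) := by
      convert hX using 1
      · funext j
        simp
      · simp
    exact ⟨0, by simpa using hasSlope_zero_of_hasDepth hX₀,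
      fun _ => P.regularSingular_of_hasDepth hX₀⟩
  · obtain ⟨i, hi⟩ := hlead.resolve_left hq_pos.ne'
    refine ⟨q, hasSlope_of_not_isNilpotent_leadMatrix (Or.inl (by exact_mod_cast hq_pos)) hX ?_,
      fun h => absurd h hq_pos.ne'⟩
    rw [leadMatrix_eq_companionMatrix q hc]
    exact not_isNilpotent_companionMatrix fun h => hi (congrFun h i)

end exists_slope

end FlatGLBundle

/-! ### Uniqueness of slopes -/

namespace FlatConn

variable {k : Type u} [Field k] {U : Type u} [AddCommGroup U] [Module (LF k) U] [Module k⟦X⟧ U]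
  [IsScalarTower k⟦X⟧ (LF k) U] {D : FlatConn k U} {s : ℝ}

theorem RegularSingular.hasSlope_iff (h : D.RegularSingular) : D.HasSlope s ↔ s = 0 :=
  ⟨fun hs => hs.elim And.right fun hs => absurd h hs.1, fun hs => Or.inl ⟨h, hs⟩⟩

theorem GrowthRate.hasSlope_iff [FiniteDimensional (LF k) U] {q : ℚ} (h : D.GrowthRate q)
    (hq : (0 : ℝ) < q) : D.HasSlope s ↔ s = q := by
  have irregular := h.not_regularSingular hq
  constructor
  · rintro (⟨regular, -⟩ | ⟨-, -, -, growth⟩)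
    · exact absurd regular irregular
    · exact GrowthRate.unique growth h
  · rintro rfl
    exact Or.inr ⟨irregular, hq, ⟨q, rfl⟩, h⟩

end FlatConn

theorem FlatGLBundle.HasSlope.regularSingular_or_growthRate {k V : Type u} [Field k] [CharZero k]
    [Algebra ℝ k] [AddCommGroup V] [Module k V] [FiniteDimensional k V] {n : ℕ}
    {b : Module.Basis (Fin n) k V} {P : FlatGLBundle k V} {r : ℝ} (h : P.HasSlope b r) :
    (r = 0 ∧ (P.assoc (AlgRep.std k V)).RegularSingular) ∨
      (0 < r ∧ (P.assoc (AlgRep.std k V)).GrowthRate r) := by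
  obtain ⟨hr, φ, x, β, fundamental, contains⟩ := h
  exact regularSingular_or_growthRate_of_containsStratum hr fundamental contains

theorem mainTheorem6_general {k V : Type u} [Field k] [Algebra ℝ k]
    [AddCommGroup V] [Module k V] [FiniteDimensional k V] [Nontrivial V]
    {n : ℕ} (b : Module.Basis (Fin n) k V) (P : FlatGLBundle k V) :
    (∃ r : ℝ, (∀ s : ℝ, P.HasSlope b s ↔ s = r) ∧
      (∀ s : ℝ, (P.assoc (AlgRep.std k V)).HasSlope s ↔ s = r)) ∧
    (P.RegularSingular ↔ (P.assoc (AlgRep.std k V)).RegularSingular) := by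
  have : CharZero k := charZero_of_injective_algebraMap (algebraMap ℝ k).injective
  obtain ⟨φ⟩ := P.nonempty
  have : FiniteDimensional (LF k) (P.assocSpace (AlgRep.std k V)) :=
    (P.evalAt (AlgRep.std k V) φ).symm.finiteDimensional
  obtain ⟨q, hq, regular_of_zero⟩ := P.exists_rat_hasSlope b
  rcases hq.regularSingular_or_growthRate with ⟨hq₀, regular⟩ | ⟨hq_pos, growth⟩
  · refine ⟨⟨0, fun s => ⟨fun hs => ?_, fun hs => hs ▸ hq₀ ▸ hq⟩, fun s => regular.hasSlope_iff⟩,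
      fun _ => regular, fun _ => regular_of_zero (by exact_mod_cast hq₀)⟩
    rcases hs.regularSingular_or_growthRate with ⟨h, -⟩ | ⟨hs_pos, h⟩
    · exact h
    · exact absurd regular (h.not_regularSingular hs_pos)
  · have irregular := growth.not_regularSingular hq_pos
    refine ⟨⟨q, fun s => ⟨fun hs => ?_, fun hs => hs ▸ hq⟩, fun s => growth.hasSlope_iff hq_pos⟩,
      fun h => absurd (h V (AlgRep.std k V)) irregular, fun h => absurd h irregular⟩
    rcases hs.regularSingular_or_growthRate with ⟨-, h⟩ | ⟨-, h⟩
    · exact absurd h irregular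
    · exact h.unique growth

end

theorem mainTheorem6 {k V : Type u} [Field k] [IsAlgClosed k] [Algebra ℝ k]
    [AddCommGroup V] [Module k V] [FiniteDimensional k V] [Nontrivial V]
    {n : ℕ} (b : Module.Basis (Fin n) k V) (P : FlatGLBundle k V) :
    (∃ r : ℝ, (∀ s : ℝ, P.HasSlope b s ↔ s = r) ∧
      (∀ s : ℝ, (P.assoc (AlgRep.std k V)).HasSlope s ↔ s = r)) ∧
    (P.RegularSingular ↔ (P.assoc (AlgRep.std k V)).RegularSingular) :=
  mainTheorem6_general b P
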